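/- **Setting.** An alternating Turing machine $M=(Q,\Sigma,\Gamma,\delta,q_0,g)$ has finite sets $Q$ (states) and $\Gamma\supseteq\Sigma$ (tape and input alphabet, $\Gamma$ containing a blank symbol), a transition function $\delta:Q\times\Gamma\to(Q\times\Gamma\times\{-1,0,1\})^2$, and a map $g$ that declares each state accepting, rejecting, existentially branching or universally branching. It accepts $w\in\Sigma^*$ if there is a finite run tree from the initial configuration (two-way infinite tape, blank except for $w$, head on the first character of $w$, state $q_0$) in which all leaves are accepting, every existential node has one of its two successor configurations as child, and every universal node has both. The space used so far in a run is the number of tape cells that initially held $w$ or have been visited by the head. $M$ is *$f(k)$-space bounded*, for $f:\mathbb N\to\mathbb N$, if every accepted word over $\Sigma$ of length $k$ is still accepted when all runs whose space usage exceeds $f(k)$ are considered to be rejecting. Let $n\ge 1$. In the *rotation-symmetric architecture* with $n$ processes $p_0,\dots,p_{n-1}$, finite local designated input set $\mathsf{AP}^I_L$ and finite local output set $\mathsf{AP}^O$, the global inputs are $\mathsf{AP}^I_L\times\{0,\dots,n-1\}$, the signals are $\mathsf{AP}^O\times\{0,\dots,n-1\}$, process $p_i$ reads the global input $(x,(j-i)\bmod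 n)$ as its local input $(x,j)$, and writes its local output $y$ to the signal $(y,i)$. An LTL formula over the global inputs and the signals is *symmetrically realizable* if there is one finite Moore machine with inputs $2^{\mathsf{AP}^I_L\times\{0,\dots,n-1\}}$ and outputs $2^{\mathsf{AP}^O}$ such that, when all $n$ processes run it synchronously, every trace of the resulting system satisfies the formula. The size of a formula is its number of occurrences of operators and propositions. **Statement.** There are a polynomial $p$ and a polynomial-time computable function that maps every pair $(M,w)$ of an alternating Turing machine and a word $w\in\Sigma^*$ (the machine given by its tables) to finite sets $\mathsf{AP}^I_L$, $\mathsf{AP}^O$ and an LTL formula $\psi$ over the propositions $(\mathsf{AP}^I_L\cup\mathsf{AP}^O)\times\mathbb Z$, such that the following holds. Let $w$ be nonempty of length $k$, let $M$ be $f(k)$-space bounded with $n=f(k)\ge 1$, and let $\psi_n$ be the formula over the global inputs and signals of the rotation-symmetric architecture with $n$ processes that arises from $\psi$ by reducing all process indices modulo $n$. Then 1. $\psi_n$ has size at most $p(|Q|\cdot|\Gamma|\cdot|w|)$, and 2. $\psi_n$ is symmetrically realizable if and only if $M$ does **not** accept $w$. -/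

import Mathlib

/-! ## Alternating Turing machines -/

/-- The type of a state. The transient states are partitioned into existentially and universally
branching ones. -/
inductive StateKind : Type
  | accepting
  | rejecting
  | existential
  | universal
  deriving DecidableEq

/-- The head motions `-1`, `0`, `1`. -/
inductive HeadMove : Type
  | left
  | stay
  | right
  deriving DecidableEq

/-- An alternating Turing machine with state set `Q` and tape alphabet `Γ`. The transition function
offers exactly two possible (state, written symbol, motion) combinations. -/
structure ATM (Q Γ : Type) where
  /-- the input alphabet, a subset of the tape alphabet -/
  inputAlphabet : Finset Γ
  /-- the symbol on empty tape cells -/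
  blank : Γ
  δ : Q → Γ → (Q × Γ × HeadMove) × (Q × Γ × HeadMove)
  q₀ : Q
  g : Q → StateKind

/-- A configuration on a two-way infinite tape. The lists `left` (nearest cell first) and `right`
hold the *used* cells on both sides of the head, i.e. the cells that initially held the input or
that the head has visited; all other cells are blank. -/
structure TapeConfig (Q Γ : Type) where
  state : Q
  left : List Γ
  head : Γ
  right : List Γ

/-- The number of used tape cells. -/
def TapeConfig.space {Q Γ : Type} (c : TapeConfig Q Γ) : ℕ :=
  c.left.length + 1 + c.right.length

namespace ATM

variable {Q Γ : Type}

/-- The tape holds `w`, the head is on the first character of `w`. -/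
def initConfig (M : ATM Q Γ) : List Γ → TapeConfig Q Γ
  | [] => ⟨M.q₀, [], M.blank, []⟩
  | a :: w => ⟨M.q₀, [], a, w⟩

/-- The configuration after entering a state, writing a symbol and moving the head. -/
def applyMove (M : ATM Q Γ) (c : TapeConfig Q Γ) : Q × Γ × HeadMove → TapeConfig Q Γ
  | (q, a, .stay) => ⟨q, c.left, a, c.right⟩
  | (q, a, .left) =>
      match c.left with
      | [] => ⟨q, [], M.blank, a :: c.right⟩
      | b :: l => ⟨q, l, b, a :: c.right⟩
  | (q, a, .right) =>
      match c.right with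
      | [] => ⟨q, a :: c.left, M.blank, []⟩
      | b :: r => ⟨q, a :: c.left, b, r⟩

/-- The first successor configuration. -/
def succ₁ (M : ATM Q Γ) (c : TapeConfig Q Γ) : TapeConfig Q Γ :=
  M.applyMove c (M.δ c.state c.head).1

/-- The second successor configuration. -/
def succ₂ (M : ATM Q Γ) (c : TapeConfig Q Γ) : TapeConfig Q Γ :=
  M.applyMove c (M.δ c.state c.head).2

/-- Existence of an accepting (finite) run tree from a configuration, all of whose nodes satisfy
`ok`: every leaf is accepting, a node in an existential state has one of its two successors as
child, and a node in a universal state has both. -/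
inductive AcceptsFrom (M : ATM Q Γ) (ok : TapeConfig Q Γ → Prop) : TapeConfig Q Γ → Prop
  | accepting (c : TapeConfig Q Γ) (hok : ok c) (hg : M.g c.state = .accepting) :
      AcceptsFrom M ok c
  | existential₁ (c : TapeConfig Q Γ) (hok : ok c) (hg : M.g c.state = .existential)
      (h : AcceptsFrom M ok (M.succ₁ c)) : AcceptsFrom M ok c
  | existential₂ (c : TapeConfig Q Γ) (hok : ok c) (hg : M.g c.state = .existential)
      (h : AcceptsFrom M ok (M.succ₂ c)) : AcceptsFrom M ok c
  | universal (c : TapeConfig Q Γ) (hok : ok c) (hg : M.g c.state = .universal)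
      (h₁ : AcceptsFrom M ok (M.succ₁ c)) (h₂ : AcceptsFrom M ok (M.succ₂ c)) :
      AcceptsFrom M ok c

/-- `M` accepts the word `w`. -/
def Accepts (M : ATM Q Γ) (w : List Γ) : Prop :=
  M.AcceptsFrom (fun _ => True) (M.initConfig w)

/-- `M` accepts the word `w` when all runs that use more than `s` tape cells are considered to be
rejecting. -/
def AcceptsInSpace (M : ATM Q Γ) (s : ℕ) (w : List Γ) : Prop :=
  M.AcceptsFrom (fun c => c.space ≤ s) (M.initConfig w)

/-- `M` is `f(k)`-space bounded: every accepted word over the input alphabet is still accepted when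
the runs whose space usage exceeds `f(k)`, with `k` the length of the word, are considered to be
rejecting. -/
def IsSpaceBounded (M : ATM Q Γ) (f : ℕ → ℕ) : Prop :=
  ∀ w : List Γ, (∀ a ∈ w, a ∈ M.inputAlphabet) → M.Accepts w → M.AcceptsInSpace (f w.length) w

end ATM

/-- An instance of the acceptance problem: an alternating Turing machine, whose states and tape
symbols are numbered, and a word over its input alphabet. -/
structure AcceptanceInstance where
  numStates : ℕ
  numSymbols : ℕ
  machine : ATM (Fin numStates) (Fin numSymbols)
  word : List (Fin numSymbols)
  word_mem : ∀ a ∈ word, a ∈ machine.inputAlphabet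

/-! ## Linear temporal logic -/

inductive LTL (α : Type) : Type
  | atom (p : α)
  | neg (φ : LTL α)
  | or (φ ψ : LTL α)
  | and (φ ψ : LTL α)
  | next (φ : LTL α)
  | globally (φ : LTL α)
  | eventually (φ : LTL α)
  | untl (φ ψ : LTL α)

namespace LTL

/-- The number of occurrences of operators and propositions in a formula. -/
def size {α : Type} : LTL α → ℕ
  | atom _ => 1
  | neg φ => φ.size + 1
  | or φ ψ => φ.size + ψ.size + 1
  | and φ ψ => φ.size + ψ.size + 1
  | next φ => φ.size + 1
  | globally φ => φ.size + 1
  | eventually φ => φ.size + 1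
  | .untl φ ψ => φ.size + ψ.size + 1

/-- Replace every proposition `p` by `r p`. -/
def map {α β : Type} (r : α → β) : LTL α → LTL β
  | atom p => atom (r p)
  | neg φ => neg (φ.map r)
  | or φ ψ => or (φ.map r) (ψ.map r)
  | and φ ψ => and (φ.map r) (ψ.map r)
  | next φ => next (φ.map r)
  | globally φ => globally (φ.map r)
  | eventually φ => eventually (φ.map r)
  | .untl φ ψ => .untl (φ.map r) (ψ.map r)

/-- `φ.Holds σ i`: the suffix of the infinite word `σ` from position `i` on satisfies `φ`. -/
def Holds {α : Type} : LTL α → (ℕ → Set α) → ℕ → Prop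
  | atom p, σ, i => p ∈ σ i
  | neg φ, σ, i => ¬ φ.Holds σ i
  | or φ ψ, σ, i => φ.Holds σ i ∨ ψ.Holds σ i
  | and φ ψ, σ, i => φ.Holds σ i ∧ ψ.Holds σ i
  | next φ, σ, i => φ.Holds σ (i + 1)
  | globally φ, σ, i => ∀ j, i ≤ j → φ.Holds σ j
  | eventually φ, σ, i => ∃ j, i ≤ j ∧ φ.Holds σ j
  | .untl φ ψ, σ, i => ∃ j, i ≤ j ∧ ψ.Holds σ j ∧ ∀ m, i ≤ m → m < j → φ.Holds σ m

end LTL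

/-! ## Finite-state machines and symmetric architectures -/

/-- A (finite) Moore machine. -/
structure MooreMachine (I O : Type) where
  State : Type
  finite : Finite State
  init : State
  step : State → I → State
  out : State → O

namespace MooreMachine

/-- The labelling `τ` of the computation tree induced by a Moore machine. -/
def tree {I O : Type} (F : MooreMachine I O) (t : List I) : O :=
  F.out (t.foldl F.step F.init)

/-- The trace `(τ(ε) ∪ t₀) (τ(t₀) ∪ t₁) (τ(t₀ t₁) ∪ t₂) …` of the computation tree. -/
def trace {A B : Type} (F : MooreMachine (Set A) (Set B)) (t : ℕ → Set A) (i : ℕ) :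
    Set (A ⊕ B) :=
  Sum.inl '' t i ∪ Sum.inr '' F.tree ((List.range i).map t)

/-- All traces satisfy the formula. -/
def Satisfies {A B : Type} (F : MooreMachine (Set A) (Set B)) (φ : LTL (A ⊕ B)) : Prop :=
  ∀ t : ℕ → Set A, φ.Holds (F.trace t) 0

end MooreMachine

/-- A symmetric architecture over the process interface `(API, APO)`. Every internal signal is
written to by exactly one local output of one process. -/
structure SymmetricArchitecture (API APO : Type) where
  /-- internal signals -/
  Signal : Type
  /-- processes -/
  Proc : Type
  finite_process : Finite Proc
  /-- global input signals -/
  GlobalInput : Type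
  inEdge : Proc × API → Signal ⊕ GlobalInput
  outEdge : Proc × APO → Signal
  outEdge_bijective : Function.Bijective outEdge

namespace SymmetricArchitecture

variable {API APO : Type}

/-- The signals that are set when the processes are in the states `f`. -/
def signals (E : SymmetricArchitecture API APO) (F : MooreMachine (Set API) (Set APO))
    (f : E.Proc → F.State) : Set E.Signal :=
  {s | ∃ (p : E.Proc) (x : APO), E.outEdge (p, x) = s ∧ x ∈ F.out (f p)}

/-- The aggregated Moore machine: all processes run the same machine `F`, synchronously and in
parallel. -/
def aggregate (E : SymmetricArchitecture API APO) (F : MooreMachine (Set API) (Set APO)) :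
    MooreMachine (Set E.GlobalInput) (Set E.Signal) where
  State := E.Proc → F.State
  finite := by
    have := E.finite_process
    have := F.finite
    exact Pi.finite
  init := fun _ => F.init
  step := fun f X p =>
    F.step (f p) {x | Sum.elim (fun s => s ∈ E.signals F f) (fun u => u ∈ X) (E.inEdge (p, x))}
  out := fun f => E.signals F f

/-- Symmetric realizability: some process implementation, plugged into the architecture, satisfies
the specification. -/
def Realizable (E : SymmetricArchitecture API APO) (φ : LTL (E.GlobalInput ⊕ E.Signal)) : Prop :=
  ∃ F : MooreMachine (Set API) (Set APO), (E.aggregate F).Satisfies φ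

end SymmetricArchitecture

/-- The rotation-symmetric architecture with `n` processes, local designated proposition set `L`
and local output propositions `APO`: process `i` reads the global input `(x, (j - i) mod n)` as its
local input `(x, j)`, and writes its local output `x` to the signal `(x, i)`. Subtraction in `Fin n`
is subtraction modulo `n`. -/
def rotationSymmetric (n : ℕ) [NeZero n] (L APO : Type) :
    SymmetricArchitecture (L × Fin n) APO where
  Signal := APO × Fin n
  Proc := Fin n
  finite_process := inferInstance
  GlobalInput := L × Fin n
  inEdge := fun e => Sum.inr (e.2.1, e.2.2 - e.1)
  outEdge := fun e => (e.2, e.1)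
  outEdge_bijective := (Equiv.prodComm (Fin n) APO).bijective

/-- Reduction of a process index modulo `n`. -/
def modIndex (n : ℕ) [NeZero n] (j : ℤ) : Fin n :=
  ⟨(j % (n : ℤ)).toNat, by
    have hn : (0 : ℤ) < n := by exact_mod_cast Nat.pos_of_ne_zero (NeZero.ne n)
    have h := Int.emod_lt_of_pos j hn
    have h' := Int.emod_nonneg j hn.ne'
    omega⟩

/-- The process interface (numbers of local designated input propositions and of local output
propositions) and the LTL formula of a specification for rotation-symmetric architectures. A
proposition is `(Sum.inl x, j)` (local input `x` of index `j`) or `(Sum.inr y, j)` (output `y` of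
process `j`); process indices are integers, to be read modulo the number of processes. -/
structure RotationSpec where
  numInputs : ℕ
  numOutputs : ℕ
  formula : LTL ((Fin numInputs ⊕ Fin numOutputs) × ℤ)

namespace RotationSpec

/-- The proposition for `n` processes that is written `(x, j)`, with `j` an integer. -/
def prop (ψ : RotationSpec) (n : ℕ) [NeZero n] :
    (Fin ψ.numInputs ⊕ Fin ψ.numOutputs) × ℤ →
      (Fin ψ.numInputs × Fin n) ⊕ (Fin ψ.numOutputs × Fin n)
  | (.inl x, j) => .inl (x, modIndex n j)
  | (.inr y, j) => .inr (y, modIndex n j)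

/-- The LTL formula over the global inputs and the signals of the architecture with `n`
processes. -/
def ltl (ψ : RotationSpec) (n : ℕ) [NeZero n] :
    LTL ((Fin ψ.numInputs × Fin n) ⊕ (Fin ψ.numOutputs × Fin n)) :=
  ψ.formula.map (ψ.prop n)

/-- Symmetric realizability in the rotation-symmetric architecture with `n` processes. -/
def Realizable (ψ : RotationSpec) (n : ℕ) [NeZero n] : Prop :=
  (rotationSymmetric n (Fin ψ.numInputs) (Fin ψ.numOutputs)).Realizable (ψ.ltl n)

end RotationSpec

/-! ## Encodings of the instances as words -/

/-- Self-delimiting encoding functions. -/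
def PrefixInjective {α T : Type} (e : α → List T) : Prop :=
  ∀ a b s t, e a ++ s = e b ++ t → a = b ∧ s = t

/-- `n` in unary, followed by an end marker. -/
def unary (n : ℕ) : List Bool := List.replicate n true ++ [false]

theorem unary_prefixInjective : PrefixInjective unary := by
  intro a
  induction a with
  | zero =>
    intro b s t h
    cases b with
    | zero => simpa [unary] using h
    | succ b => simp [unary, List.replicate_succ] at h
  | succ a ih =>
    intro b s t h
    cases b with
    | zero => simp [unary, List.replicate_succ] at h
    | succ b =>
      have h' : unary a ++ s = unary b ++ t := by
        simpa [unary, List.replicate_succ] using h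
      obtain ⟨h1, h2⟩ := ih b s t h'
      exact ⟨by rw [h1], h2⟩

/-- The concatenation of the codes of `v 0, …, v (n - 1)`. -/
def encodeFn {α T : Type} (e : α → List T) {n : ℕ} (v : Fin n → α) : List T :=
  (List.ofFn fun i => e (v i)).flatten

theorem encodeFn_prefixInjective {α T : Type} {e : α → List T} (he : PrefixInjective e) (n : ℕ) :
    PrefixInjective (encodeFn e : (Fin n → α) → List T) := by
  induction n with
  | zero =>
    intro u v s t h
    exact ⟨Subsingleton.elim _ _, by simpa [encodeFn] using h⟩
  | succ n ih =>
    intro u v s t h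
    simp only [encodeFn, List.ofFn_succ, List.flatten_cons, List.append_assoc] at h
    obtain ⟨h0, h1⟩ := he _ _ _ _ h
    obtain ⟨h2, h3⟩ := ih (fun i => u i.succ) (fun i => v i.succ) s t h1
    refine ⟨?_, h3⟩
    funext i
    refine Fin.cases h0 (fun j => congrFun h2 j) i

def encodeFin {n : ℕ} (i : Fin n) : List Bool := unary i

theorem encodeFin_prefixInjective (n : ℕ) : PrefixInjective (encodeFin : Fin n → List Bool) := by
  intro a b s t h
  obtain ⟨h1, h2⟩ := unary_prefixInjective _ _ _ _ h
  exact ⟨Fin.ext h1, h2⟩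

def encodeBit (b : Bool) : List Bool := [b]

theorem encodeBit_prefixInjective : PrefixInjective encodeBit := by
  intro a b s t h
  simpa [encodeBit] using h

def encodeStateKind : StateKind → List Bool
  | .accepting => [false, false]
  | .rejecting => [false, true]
  | .existential => [true, false]
  | .universal => [true, true]

theorem encodeStateKind_prefixInjective : PrefixInjective encodeStateKind := by
  intro a b s t h
  cases a <;> cases b <;> simp_all [encodeStateKind]

def encodeHeadMove : HeadMove → List Bool
  | .left => [false, false]
  | .stay => [false, true]
  | .right => [true, false]

theorem encodeHeadMove_prefixInjective : PrefixInjective encodeHeadMove := by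
  intro a b s t h
  cases a <;> cases b <;> simp_all [encodeHeadMove]

def encodePair {α β T : Type} (e : α → List T) (e' : β → List T) (x : α × β) : List T :=
  e x.1 ++ e' x.2

theorem encodePair_prefixInjective {α β T : Type} {e : α → List T} {e' : β → List T}
    (he : PrefixInjective e) (he' : PrefixInjective e') : PrefixInjective (encodePair e e') := by
  rintro ⟨a, b⟩ ⟨a', b'⟩ s t h
  simp only [encodePair, List.append_assoc] at h
  obtain ⟨h1, h2⟩ := he _ _ _ _ h
  obtain ⟨h3, h4⟩ := he' _ _ _ _ h2
  exact ⟨by rw [h1, h3], h4⟩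

/-- The code of one of the alternatives offered by the transition function. -/
def encodeMove {m n : ℕ} : Fin m × Fin n × HeadMove → List Bool :=
  encodePair encodeFin (encodePair encodeFin encodeHeadMove)

/-- The table of the transition function, row by row. -/
def encodeTable {m n : ℕ} :
    (Fin m → Fin n → (Fin m × Fin n × HeadMove) × (Fin m × Fin n × HeadMove)) → List Bool :=
  encodeFn (encodeFn (encodePair encodeMove encodeMove))

theorem encodeTable_prefixInjective (m n : ℕ) :
    PrefixInjective (encodeTable : (Fin m → Fin n →
      (Fin m × Fin n × HeadMove) × (Fin m × Fin n × HeadMove)) → List Bool) := by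
  have h : PrefixInjective (encodeMove : Fin m × Fin n × HeadMove → List Bool) :=
    encodePair_prefixInjective (encodeFin_prefixInjective m)
      (encodePair_prefixInjective (encodeFin_prefixInjective n) encodeHeadMove_prefixInjective)
  exact encodeFn_prefixInjective (encodeFn_prefixInjective (encodePair_prefixInjective h h) n) m

/-- The code of a machine and a word: the numbers of states and of tape symbols, the initial state,
the blank symbol, the input alphabet (one bit per symbol), the types of the states, the transition
table, and the characters of the word. -/
def AcceptanceInstance.encode (x : AcceptanceInstance) : List Bool :=
  unary x.numStates ++ (unary x.numSymbols ++ (encodeFin x.machine.q₀ ++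
    (encodeFin x.machine.blank ++
      (encodeFn encodeBit (fun a => decide (a ∈ x.machine.inputAlphabet)) ++
        (encodeFn encodeStateKind x.machine.g ++
          (encodeTable x.machine.δ ++ (x.word.map encodeFin).flatten))))))

theorem flatten_map_injective {α T : Type} {e : α → List T} (he : PrefixInjective e)
    (hne : ∀ a, e a ≠ []) : Function.Injective fun l : List α => (l.map e).flatten := by
  intro l
  induction l with
  | nil =>
    intro l' h
    cases l' with
    | nil => rfl
    | cons b l' => simp [hne] at h
  | cons a l ih =>
    intro l' h
    cases l' with
    | nil => simp [hne] at h
    | cons b l' =>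
      simp only [List.map_cons, List.flatten_cons] at h
      obtain ⟨h1, h2⟩ := he _ _ _ _ h
      rw [h1, ih h2]

theorem AcceptanceInstance.encode_injective : Function.Injective AcceptanceInstance.encode := by
  rintro ⟨m, n, M, w, hw⟩ ⟨m', n', M', w', hw'⟩ h
  simp only [AcceptanceInstance.encode] at h
  obtain ⟨h1, h⟩ := unary_prefixInjective _ _ _ _ h
  subst h1
  obtain ⟨h2, h⟩ := unary_prefixInjective _ _ _ _ h
  subst h2
  obtain ⟨h3, h⟩ := encodeFin_prefixInjective _ _ _ _ _ h
  obtain ⟨h4, h⟩ := encodeFin_prefixInjective _ _ _ _ _ h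
  obtain ⟨h5, h⟩ := encodeFn_prefixInjective encodeBit_prefixInjective _ _ _ _ _ h
  obtain ⟨h6, h⟩ := encodeFn_prefixInjective encodeStateKind_prefixInjective _ _ _ _ _ h
  obtain ⟨h7, h⟩ := encodeTable_prefixInjective _ _ _ _ _ _ h
  have h8 : w = w' :=
    flatten_map_injective (encodeFin_prefixInjective n) (by simp [encodeFin, unary]) h
  have h9 : M.inputAlphabet = M'.inputAlphabet := by
    ext a
    simpa using congrFun h5 a
  cases M
  cases M'
  simp only at h3 h4 h6 h7 h9
  subst h3 h4 h6 h7 h8 h9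
  rfl

/-- The characters in which LTL formulas are written: `inp`, `out` start a proposition, `one` and
the end markers `pos`, `negative` serve to write numbers in unary. -/
inductive FormulaToken : Type
  | one
  | pos
  | negative
  | inp
  | out
  | neg
  | or
  | and
  | next
  | globally
  | eventually
  | untl
  deriving DecidableEq

def tokenNat (n : ℕ) : List FormulaToken := List.replicate n .one ++ [.pos]

/-- An integer in unary: its absolute value, followed by an end marker showing its sign. -/
def tokenInt (j : ℤ) : List FormulaToken :=
  List.replicate j.natAbs .one ++ [if j < 0 then .negative else .pos]

def tokenProp {a b : ℕ} : (Fin a ⊕ Fin b) × ℤ → List FormulaToken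
  | (.inl x, j) => .inp :: (tokenNat x ++ tokenInt j)
  | (.inr y, j) => .out :: (tokenNat y ++ tokenInt j)

/-- A formula in prefix notation. -/
def LTL.tokens {α : Type} (e : α → List FormulaToken) : LTL α → List FormulaToken
  | .atom p => e p
  | .neg φ => .neg :: φ.tokens e
  | .or φ ψ => .or :: (φ.tokens e ++ ψ.tokens e)
  | .and φ ψ => .and :: (φ.tokens e ++ ψ.tokens e)
  | .next φ => .next :: φ.tokens e
  | .globally φ => .globally :: φ.tokens e
  | .eventually φ => .eventually :: φ.tokens e
  | .untl φ ψ => .untl :: (φ.tokens e ++ ψ.tokens e)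

/-- The code of a specification: the two numbers of propositions, and the formula. -/
def RotationSpec.encode (ψ : RotationSpec) : List FormulaToken :=
  tokenNat ψ.numInputs ++ (tokenNat ψ.numOutputs ++ ψ.formula.tokens tokenProp)

theorem replicate_one_append {m n : ℕ} {x y : FormulaToken} {s t : List FormulaToken}
    (hx : x ≠ .one) (hy : y ≠ .one)
    (h : List.replicate m .one ++ x :: s = List.replicate n .one ++ y :: t) :
    m = n ∧ x = y ∧ s = t := by
  induction m generalizing n with
  | zero =>
    cases n with
    | zero => simpa using h
    | succ n =>
      simp only [List.replicate_succ, List.replicate_zero, List.nil_append, List.cons_append,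
        List.cons.injEq] at h
      exact absurd h.1 hx
  | succ m ih =>
    cases n with
    | zero =>
      simp only [List.replicate_succ, List.replicate_zero, List.nil_append, List.cons_append,
        List.cons.injEq] at h
      exact absurd h.1.symm hy
    | succ n =>
      simp only [List.replicate_succ, List.cons_append, List.cons.injEq, true_and] at h
      obtain ⟨h1, h2⟩ := ih h
      exact ⟨by rw [h1], h2⟩

theorem tokenNat_prefixInjective : PrefixInjective tokenNat := by
  intro a b s t h
  simp only [tokenNat, List.append_assoc, List.singleton_append] at h
  obtain ⟨h1, -, h2⟩ := replicate_one_append (by simp) (by simp) h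
  exact ⟨h1, h2⟩

theorem tokenInt_prefixInjective : PrefixInjective tokenInt := by
  intro a b s t h
  simp only [tokenInt, List.append_assoc, List.singleton_append] at h
  obtain ⟨h1, h2, h3⟩ := replicate_one_append (by split <;> simp) (by split <;> simp) h
  refine ⟨?_, h3⟩
  split at h2 <;> split at h2 <;> first | omega | simp at h2

theorem tokenProp_prefixInjective (a b : ℕ) :
    PrefixInjective (tokenProp : (Fin a ⊕ Fin b) × ℤ → List FormulaToken) := by
  rintro ⟨x | x, i⟩ ⟨y | y, j⟩ s t h <;>
    simp only [tokenProp, List.cons_append, List.append_assoc, List.cons.injEq, reduceCtorEq,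
      false_and, true_and] at h
  all_goals
    obtain ⟨h1, h⟩ := tokenNat_prefixInjective _ _ _ _ h
    obtain ⟨h2, h⟩ := tokenInt_prefixInjective _ _ _ _ h
    exact ⟨by rw [Fin.ext h1, h2], h⟩

theorem LTL.tokens_prefixInjective (a b : ℕ) :
    PrefixInjective (LTL.tokens (tokenProp : (Fin a ⊕ Fin b) × ℤ → List FormulaToken)) := by
  intro φ
  induction φ with
  | atom p =>
    intro χ s t h
    cases χ with
    | atom q =>
      obtain ⟨h1, h2⟩ := tokenProp_prefixInjective a b _ _ _ _ h
      exact ⟨by rw [h1], h2⟩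
    | _ => obtain ⟨x | x, i⟩ := p <;> simp [LTL.tokens, tokenProp] at h
  | neg φ ih | next φ ih | globally φ ih | eventually φ ih =>
    intro χ s t h
    cases χ
    case atom q => obtain ⟨x | x, i⟩ := q <;> simp [LTL.tokens, tokenProp] at h
    all_goals simp only [LTL.tokens, List.cons_append, List.cons.injEq, reduceCtorEq,
      false_and, true_and] at h
    all_goals
      obtain ⟨h1, h2⟩ := ih _ _ _ h
      exact ⟨by rw [h1], h2⟩
  | or φ ψ ih ih' | and φ ψ ih ih' | untl φ ψ ih ih' =>
    intro χ s t h
    cases χ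
    case atom q => obtain ⟨x | x, i⟩ := q <;> simp [LTL.tokens, tokenProp] at h
    all_goals simp only [LTL.tokens, List.cons_append, List.append_assoc, List.cons.injEq,
      reduceCtorEq, false_and, true_and] at h
    all_goals
      obtain ⟨h1, h2⟩ := ih _ _ _ h
      obtain ⟨h3, h4⟩ := ih' _ _ _ h2
      exact ⟨by rw [h1, h3], h4⟩

theorem RotationSpec.encode_injective : Function.Injective RotationSpec.encode := by
  rintro ⟨a, b, φ⟩ ⟨a', b', φ'⟩ h
  simp only [RotationSpec.encode] at h
  obtain ⟨h1, h⟩ := tokenNat_prefixInjective _ _ _ _ h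
  subst h1
  obtain ⟨h2, h⟩ := tokenNat_prefixInjective _ _ _ _ h
  subst h2
  have h' : φ.tokens tokenProp ++ [] = φ'.tokens tokenProp ++ [] := by
    simpa only [List.append_nil] using h
  rw [(LTL.tokens_prefixInjective a b _ _ _ _ h').1]

/-!
The ring of processes serves as the tape: the outputs of a process show the contents of one tape
cell and whether the head is there. With `n` processes there is room for exactly the runs that use
at most `n` cells, so the number of processes plays the role of the space bound, and the formula
need not mention it. The environment has two inputs. With `start` it selects the processes at
which a tape with the input word begins, and with `choice` it resolves the existential states. The
universal states are resolved by the system. The formula `AcceptanceInstance.formula` says that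
the ring follows the transition table and never shows an accepting state at a head; it is written
from the point of view of process `0`, and by rotation symmetry (`snapshot_rotate`) this is the
same as saying it of all processes (`satisfies_iff`).

A rotation-symmetric system cannot distinguish a first process by itself; the input `start` breaks
the symmetry, but it may do so at several places. Hence several tapes may share the ring, each a
piece of consecutive cells whose inner borders are marked by `edge`. Two pieces are never joined:
a head that is about to leave its piece for a cell that is already used, or for an unused one
which another head is about to enter as well, is blocked, and the formula requires nothing of it.
A new tape may also be cut off by the next one. So a piece of tape either agrees with the used
part of the simulated configuration, or it is followed by a used cell; that is `Snapshot.Stores`,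
which transitions and motions preserve (`Snapshot.Stores.effect`, `Snapshot.Stores.shift`).

If `M` accepts within space `n`, the environment starts a single tape and plays the accepting run
tree. The head is never blocked, since a blocked head on a ring with only one tape would need more
than `n` cells (`Snapshot.Alone.not_blocked`); so every implementation has to follow the run tree,
and at a leaf the formula is violated (`not_shows_of_acceptsFrom`,
`not_realizable_of_acceptsInSpace`).

If `M` does not accept, an implementation keeps the contents of the whole ring in the state of
each process, which is possible as every process reads all inputs (`implementation`). It keeps the
invariant that the configuration stored at every head is one from which `M` does not accept: the
invariant holds at first for each tape, existential choices cannot violate it, and in a universal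
state one of the successors respects it (`RingInv.step`, `RingInv.next`,
`realizable_of_not_accepts`).

The formula has a bounded number of bounded rules per entry of the transition table and one
subformula per character of the word, which gives the size bound (`size_formula`). For the running
time, structured programs over finitely many stacks are compiled to machines of Mathlib's model
`TM2` (`StackCmd.tm2ComputableInPolyTime`). The formula is arranged such that such a program can
write it while it reads the tables from left to right, with counters in unary for the numbers of
states and symbols (`Reduction.program`, `Reduction.encode_reductionSpec`,
`Reduction.runsIn_program`).
-/

/-! ### A structured programming language for stack machines -/

/-- Structured programs over finitely many stacks, stack `k` having the alphabet `Γ k`: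
`pop k f` removes the top of stack `k` and continues with `f` applied to it (to `none` if the stack
is empty), `loop k p c` repeats `c` as long as the top of stack `k` satisfies `p`. -/
inductive StackCmd {K : Type} (Γ : K → Type) : Type
  | skip : StackCmd Γ
  | push (k : K) (a : Γ k) : StackCmd Γ
  | seq (c d : StackCmd Γ) : StackCmd Γ
  | pop (k : K) (f : Option (Γ k) → StackCmd Γ) : StackCmd Γ
  | loop (k : K) (p : Option (Γ k) → Bool) (c : StackCmd Γ) : StackCmd Γ

namespace StackCmd

variable {K : Type} {Γ : K → Type}

/-- The program points of a program, which serve as the labels of the compiled machine. -/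
def Label : StackCmd Γ → Type
  | skip => Unit
  | push _ _ => Unit
  | seq c d => c.Label ⊕ d.Label
  | pop _ f => Option (Σ o, (f o).Label)
  | loop _ _ c => Option c.Label

/-- The program point at which execution starts. -/
def entry : (c : StackCmd Γ) → c.Label
  | skip => ()
  | push _ _ => ()
  | seq c _ => Sum.inl c.entry
  | pop _ _ => none
  | loop _ _ _ => none

instance finite_label [∀ k, Finite (Γ k)] (c : StackCmd Γ) : Finite c.Label := by
  induction c with
  | skip | push => exact inferInstanceAs (Finite Unit)
  | seq c d hc hd => exact inferInstanceAs (Finite (c.Label ⊕ d.Label))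
  | pop k f h => exact inferInstanceAs (Finite (Option (Σ o, (f o).Label)))
  | loop k p c h => exact inferInstanceAs (Finite (Option c.Label))

variable [DecidableEq K]

/-- The internal state of the compiled machine: the symbol last read from each stack. -/
abbrev Register (Γ : K → Type) : Type := ∀ k, Option (Γ k)

/-- Compilation. The program is placed into a machine with labels `Λ` by `e`, and control is
transferred to `x` at the end. -/
def code {Λ : Type} : (c : StackCmd Γ) → (c.Label → Λ) → Λ → c.Label →
    Turing.TM2.Stmt Γ Λ (Register Γ)
  | skip, _, x, _ => .goto fun _ => x
  | push k a, _, x, _ => .push k (fun _ => a) (.goto fun _ => x)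
  | seq c d, e, _, .inl l => c.code (fun l => e (.inl l)) (e (.inr d.entry)) l
  | seq _ d, e, x, .inr l => d.code (fun l => e (.inr l)) x l
  | pop k f, e, _, none =>
      .pop k (fun v o => Function.update v k o) (.goto fun v => e (some ⟨v k, (f (v k)).entry⟩))
  | pop _ f, e, x, some ⟨o, l⟩ => (f o).code (fun l => e (some ⟨o, l⟩)) x l
  | loop k p c, e, x, none =>
      .peek k (fun v o => Function.update v k o)
        (.branch (fun v => p (v k)) (.goto fun _ => e (some c.entry)) (.goto fun _ => x))
  | loop _ _ c, e, _, some l => c.code (fun l => e (some l)) (e none) l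

/-- `Exec c S S' t`: the program `c` transforms the stacks `S` into `S'` in `t` machine steps. -/
inductive Exec : StackCmd Γ → (∀ k, List (Γ k)) → (∀ k, List (Γ k)) → ℕ → Prop
  | skip (S) : Exec skip S S 1
  | push (k a S) : Exec (push k a) S (Function.update S k (a :: S k)) 1
  | seq {c d S S₁ S₂ t₁ t₂} (h₁ : Exec c S S₁ t₁) (h₂ : Exec d S₁ S₂ t₂) :
      Exec (seq c d) S S₂ (t₁ + t₂)
  | pop {k f S S' t} (h : Exec (f (S k).head?) (Function.update S k (S k).tail) S' t) :
      Exec (pop k f) S S' (t + 1)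
  | loop_done {k p c S} (h : p (S k).head? = false) : Exec (loop k p c) S S 1
  | loop_step {k p c S S₁ S₂ t₁ t₂} (h : p (S k).head? = true) (h₁ : Exec c S S₁ t₁)
      (h₂ : Exec (loop k p c) S₁ S₂ t₂) : Exec (loop k p c) S S₂ (t₁ + t₂ + 1)

/-- The compiled program simulates the big-step semantics, step by step. -/
theorem Exec.simulates {Λ : Type} {M : Λ → Turing.TM2.Stmt Γ Λ (Register Γ)} {c : StackCmd Γ}
    {S S' : ∀ k, List (Γ k)} {t : ℕ} (h : Exec c S S' t) :
    ∀ (e : c.Label → Λ) (x : Λ), (∀ l, M (e l) = c.code e x l) → ∀ v, ∃ v',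
      (flip bind (Turing.TM2.step M))^[t] (some ⟨some (e c.entry), v, S⟩) =
        some ⟨some x, v', S'⟩ := by
  induction h with
  | skip S =>
    intro e x hM v
    refine ⟨v, ?_⟩
    simp [flip, hM, code]
  | push k a S =>
    intro e x hM v
    refine ⟨v, ?_⟩
    simp [flip, hM, code]
  | seq h₁ h₂ ih₁ ih₂ =>
    rename_i c d _ _ _ t₁ t₂
    intro e x hM v
    obtain ⟨v₁, h1⟩ := ih₁ (fun l => e (.inl l)) (e (.inr d.entry)) (fun l => hM (.inl l)) v
    obtain ⟨v₂, h2⟩ := ih₂ (fun l => e (.inr l)) x (fun l => hM (.inr l)) v₁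
    refine ⟨v₂, ?_⟩
    rw [Nat.add_comm, Function.iterate_add_apply]
    exact (congrArg _ h1).trans h2
  | pop h ih =>
    rename_i k f S S' t
    intro e x hM v
    obtain ⟨v', h'⟩ := ih (fun l => e (some ⟨(S k).head?, l⟩)) x
      (fun l => hM (some ⟨(S k).head?, l⟩)) (Function.update v k (S k).head?)
    refine ⟨v', ?_⟩
    rw [Function.iterate_add_apply, ← h']
    congr 1
    simp only [Function.iterate_one, flip, bind, Option.bind, Turing.TM2.step]
    rw [show M (e (entry (StackCmd.pop k f))) = _ from hM none]
    simp only [code, Turing.TM2.stepAux]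
    exact congrArg (fun o => some (Turing.TM2.Cfg.mk (some (e (some ⟨o, (f o).entry⟩)))
      (Function.update v k (S k).head?) (Function.update S k (S k).tail))) (Function.update_self ..)
  | loop_done h =>
    rename_i k p c S
    intro e x hM v
    refine ⟨Function.update v k (S k).head?, ?_⟩
    simp only [Function.iterate_one, flip, bind, Option.bind, Turing.TM2.step]
    rw [show M (e (entry (StackCmd.loop k p c))) = _ from hM none]
    simp [code, h]
  | loop_step h h₁ h₂ ih₁ ih₂ =>
    rename_i k p c S S₁ S₂ t₁ t₂
    intro e x hM v
    obtain ⟨v₁, h1⟩ := ih₁ (fun l => e (some l)) (e none) (fun l => hM (some l))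
      (Function.update v k (S k).head?)
    obtain ⟨v₂, h2⟩ := ih₂ e x hM v₁
    refine ⟨v₂, ?_⟩
    rw [Nat.add_comm t₁ t₂, Nat.add_assoc, Function.iterate_add_apply, Function.iterate_add_apply,
      ← h2]
    congr 1
    refine Eq.trans (congrArg _ ?_) h1
    simp only [Function.iterate_one, flip, bind, Option.bind, Turing.TM2.step]
    rw [show M (e (entry (StackCmd.loop k p c))) = _ from hM none]
    simp [code, h]

/-- The stacks that are all empty except for stack `k`. -/
def single (k : K) (l : List (Γ k)) : ∀ k, List (Γ k) :=
  Function.update (fun _ => []) k l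

theorem single_self (k : K) (l : List (Γ k)) : single k l k = l :=
  Function.update_self ..

theorem single_of_ne {k k' : K} (h : k' ≠ k) (l : List (Γ k)) : single k l k' = [] :=
  Function.update_of_ne h ..

/-- The machine that runs a program with input stack `k₀` and output stack `k₁`, and then resets
its internal state and halts. -/
noncomputable def machine [Fintype K] [∀ k, Fintype (Γ k)] (c : StackCmd Γ) (k₀ k₁ : K) :
    Turing.FinTM2 :=
  letI : Fintype c.Label := Fintype.ofFinite _
  { k₀ := k₀
    k₁ := k₁
    Γ := Γ
    Λ := Option c.Label
    main := some c.entry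
    σ := Register Γ
    initialState := fun _ => none
    m := fun l => match l with
      | none => .load (fun _ _ => none) .halt
      | some l => c.code some none l }

theorem initList_eq [Fintype K] [∀ k, Fintype (Γ k)] (c : StackCmd Γ) (k₀ k₁ : K)
    (l : List (Γ k₀)) :
    Turing.initList (c.machine k₀ k₁) l = ⟨some (some c.entry), fun _ => none, single k₀ l⟩ := by
  simp only [Turing.initList, machine]
  congr 1
  funext k
  by_cases h : k = k₀
  · subst h
    exact (dif_pos rfl).trans (single_self k l).symm
  · exact (dif_neg h).trans (single_of_ne h l).symm

theorem haltList_eq [Fintype K] [∀ k, Fintype (Γ k)] (c : StackCmd Γ) (k₀ k₁ : K)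
    (l : List (Γ k₁)) :
    Turing.haltList (c.machine k₀ k₁) l = ⟨none, fun _ => none, single k₁ l⟩ := by
  simp only [Turing.haltList, machine]
  congr 1
  funext k
  by_cases h : k = k₁
  · subst h
    exact (dif_pos rfl).trans (single_self k l).symm
  · exact (dif_neg h).trans (single_of_ne h l).symm

/-- A function is computable in polynomial time if a structured program computes it within a
polynomial number of steps. -/
theorem tm2ComputableInPolyTime [Fintype K] [∀ k, Fintype (Γ k)] (c : StackCmd Γ) (k₀ k₁ : K)
    {α β : Type} (ea : α → List (Γ k₀)) (eb : β → List (Γ k₁)) (f : α → β) (p : Polynomial ℕ)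
    (h : ∀ a, ∃ t ≤ p.eval (ea a).length, Exec c (single k₀ (ea a)) (single k₁ (eb (f a))) t) :
    Nonempty (Turing.TM2ComputableInPolyTime ea eb f) := by
  refine ⟨⟨⟨c.machine k₀ k₁, Equiv.refl _, Equiv.refl _⟩, p + 1, fun a => ?_⟩⟩
  have h' : ∃ t ≤ p.eval (ea a).length,
      (flip bind (c.machine k₀ k₁).step)^[t + 1] (some (Turing.initList (c.machine k₀ k₁) (ea a))) =
        some (Turing.haltList (c.machine k₀ k₁) (eb (f a))) := by
    obtain ⟨t, ht, hx⟩ := h a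
    refine ⟨t, ht, ?_⟩
    obtain ⟨v', hv⟩ := hx.simulates (M := (c.machine k₀ k₁).m) some none (fun _ => rfl)
      (fun _ => none)
    rw [initList_eq, haltList_eq, Function.iterate_succ_apply']
    exact (congrArg _ hv).trans rfl
  have h1 : List.map (Equiv.refl (Γ k₀)).invFun (ea a) = ea a := List.map_id _
  have h2 : List.map (Equiv.refl (Γ k₁)).invFun (eb (f a)) = eb (f a) := List.map_id _
  exact
    { steps := h'.choose + 1
      evals_in_steps := by
        have := h'.choose_spec.2
        convert this using 2
        · exact congrArg (fun l => some (Turing.initList (c.machine k₀ k₁) l)) h1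
        · exact congrArg (fun l => some (Turing.haltList (c.machine k₀ k₁) l)) h2
      steps_le_m := by
        have := h'.choose_spec.1
        simpa using this }

/-- `RunsIn c S S' B`: the program `c` transforms `S` into `S'` in at most `B` steps. -/
def RunsIn (c : StackCmd Γ) (S S' : ∀ k, List (Γ k)) (B : ℕ) : Prop :=
  ∃ t ≤ B, Exec c S S' t

theorem RunsIn.mono {c : StackCmd Γ} {S S' : ∀ k, List (Γ k)} {B B' : ℕ} (h : RunsIn c S S' B)
    (hB : B ≤ B') : RunsIn c S S' B' :=
  let ⟨t, ht, hx⟩ := h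
  ⟨t, ht.trans hB, hx⟩

theorem RunsIn.seq {c d : StackCmd Γ} {S S₁ S₂ : ∀ k, List (Γ k)} {B₁ B₂ : ℕ}
    (h₁ : RunsIn c S S₁ B₁) (h₂ : RunsIn d S₁ S₂ B₂) : RunsIn (seq c d) S S₂ (B₁ + B₂) :=
  let ⟨_, ht₁, hx₁⟩ := h₁
  let ⟨_, ht₂, hx₂⟩ := h₂
  ⟨_, Nat.add_le_add ht₁ ht₂, .seq hx₁ hx₂⟩

theorem RunsIn.pop {k : K} {f : Option (Γ k) → StackCmd Γ} {S S' : ∀ k, List (Γ k)} {B : ℕ}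
    (h : RunsIn (f (S k).head?) (Function.update S k (S k).tail) S' B) :
    RunsIn (pop k f) S S' (B + 1) :=
  let ⟨_, ht, hx⟩ := h
  ⟨_, Nat.add_le_add_right ht 1, .pop hx⟩

end StackCmd

/-! ### The specification -/

namespace LTL

variable {α β γ : Type}

theorem map_map (r : α → β) (r' : β → γ) (φ : LTL α) :
    (φ.map r).map r' = φ.map fun p => r' (r p) := by
  induction φ <;> simp_all [map]

theorem size_map (r : α → β) (φ : LTL α) : (φ.map r).size = φ.size := by
  induction φ <;> simp_all [map, size]

theorem holds_map (r : α → β) (φ : LTL α) (σ : ℕ → Set β) (i : ℕ) :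
    (φ.map r).Holds σ i ↔ φ.Holds (fun t => r ⁻¹' σ t) i := by
  induction φ generalizing i <;> simp_all [map, Holds]

/-- Implication. -/
def imp (φ ψ : LTL α) : LTL α := .or (.neg φ) ψ

theorem holds_imp (φ ψ : LTL α) (σ : ℕ → Set α) (i : ℕ) :
    (φ.imp ψ).Holds σ i ↔ (φ.Holds σ i → ψ.Holds σ i) := by
  simp only [imp, Holds]
  tauto

/-- The conjunction of the formulas in a list, ending with the formula `e`. -/
def bigAnd (e : LTL α) (l : List (LTL α)) : LTL α := l.foldr .and e

theorem holds_bigAnd (e : LTL α) (l : List (LTL α)) (σ : ℕ → Set α) (i : ℕ) :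
    (bigAnd e l).Holds σ i ↔ (∀ φ ∈ l, φ.Holds σ i) ∧ e.Holds σ i := by
  induction l with
  | nil => simp [bigAnd]
  | cons φ l ih =>
    simp only [bigAnd, List.foldr_cons, Holds, List.forall_mem_cons] at ih ⊢
    rw [ih, and_assoc]

theorem map_bigAnd (r : α → β) (e : LTL α) (l : List (LTL α)) :
    (bigAnd e l).map r = bigAnd (e.map r) (l.map (LTL.map r)) := by
  induction l with
  | nil => rfl
  | cons φ l ih => exact congrArg (LTL.and (φ.map r)) ih

theorem size_bigAnd (e : LTL α) (l : List (LTL α)) :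
    (bigAnd e l).size = (l.map fun φ => φ.size + 1).sum + e.size := by
  induction l with
  | nil => simp [bigAnd]
  | cons φ l ih =>
    simp only [bigAnd, List.foldr_cons, size, List.map_cons, List.sum_cons] at ih ⊢
    omega

end LTL

/-- The propositions of the specification. `start` and `choice` are inputs. Of the outputs, `used`
says that the tape cell of the process is in use, `edge` that this cell and the next one have been
joined into one piece of tape, `state q` and `sym a` give the state of a head on the cell and the
symbol in it. The head is either `ready` for its next transition, or the transition has been decided
and only the motion to the left (`pend false`) or to the right (`pend true`) is still pending. -/
inductive Sig (Q Γ : Type) : Type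
  | start
  | choice
  | used
  | edge
  | ready
  | pend (d : Bool)
  | state (q : Q)
  | sym (a : Γ)

/-- The offset of the neighbour on the left (`false`) or on the right (`true`). -/
def sgn : Bool → ℤ
  | false => -1
  | true => 1

/-- The direction of a head motion; `none` stands for no motion. -/
def HeadMove.dir : HeadMove → Option Bool
  | .left => some false
  | .stay => none
  | .right => some true

namespace Sig

variable {Q Γ Q' Γ' : Type}

/-- Renaming of states and symbols. -/
def map (f : Q → Q') (g : Γ → Γ') : Sig Q Γ → Sig Q' Γ'
  | start => start
  | choice => choice
  | used => used
  | edge => edge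
  | ready => ready
  | pend d => pend d
  | state q => state (f q)
  | sym a => sym (g a)

/-- The status of a head: `none` if it is ready, `some d` if a motion in direction `d` is pending.
-/
def head : Option Bool → Sig Q Γ
  | none => ready
  | some d => pend d

end Sig

/-! The formulas below are read at process `0`: the proposition `(s, z)` is the output `s` of
process `z`. An input `(s, z)` is the one that process `-z` receives as its own. -/

section Rules

variable {Q Γ : Type}

/-- The proposition `s` at index `z`. -/
def sAt (s : Sig Q Γ) (z : ℤ) : LTL (Sig Q Γ × ℤ) := .atom (s, z)

/-- The cell at `z` is joined to its neighbour in direction `d`. -/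
def edgeAt (d : Bool) (z : ℤ) : LTL (Sig Q Γ × ℤ) := sAt .edge (if d then z else z - 1)

/-- There is a head on the cell at `z`. -/
def headAt (z : ℤ) : LTL (Sig Q Γ × ℤ) :=
  .or (sAt .ready z) (.or (sAt (.pend false) z) (sAt (.pend true) z))

/-- The neighbour in direction `d` is unused, and no head is about to enter it from its other
side. -/
def vacantAt (d : Bool) : LTL (Sig Q Γ × ℤ) :=
  .and (.neg (sAt .used (sgn d))) (.neg (sAt (.pend !d) (2 * sgn d)))

/-- A head that leaves its piece of tape for a vacant cell joins that cell to the piece. -/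
def edgeRule (d : Bool) : LTL (Sig Q Γ × ℤ) :=
  .imp (.and (sAt (.pend d) 0) (vacantAt d)) (.next (edgeAt d 0))

/-- The invariants and frame conditions that do not depend on the machine. Used cells remain used,
and only heads create new ones; edges remain, and arise only where a head moves to an unused cell; a
head can only be where a head was ready before, or where one was about to move; a head has only one
status; joined cells and cells below a head are used; and a vacant cell that a head enters is joined
to the one that it left. -/
def frameRules : List (LTL (Sig Q Γ × ℤ)) :=
  [.imp (sAt .used 0) (.next (sAt .used 0)),
    .or (sAt .used 0) (.or (sAt (.pend true) (-1)) (.or (sAt (.pend false) 1)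
      (.neg (.next (sAt .used 0))))),
    .imp (sAt .edge 0) (.next (sAt .edge 0)),
    .or (sAt .edge 0) (.or (.and (sAt (.pend true) 0) (.neg (sAt .used 1)))
      (.or (.and (sAt (.pend false) 1) (.neg (sAt .used 0))) (.neg (.next (sAt .edge 0))))),
    .or (sAt .ready 0) (.or (.and (sAt (.pend true) (-1)) (.or (sAt .edge (-1))
      (.neg (sAt .used 0)))) (.or (.and (sAt (.pend false) 1) (.or (sAt .edge 0)
      (.neg (sAt .used 0)))) (.neg (.next (headAt 0))))),
    .neg (.and (sAt .ready 0) (sAt (.pend true) 0)),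
    .neg (.and (sAt .ready 0) (sAt (.pend false) 0)),
    .neg (.and (sAt (.pend true) 0) (sAt (.pend false) 0)),
    .imp (sAt .edge 0) (.and (sAt .used 0) (sAt .used 1)),
    .imp (headAt 0) (sAt .used 0),
    edgeRule true,
    edgeRule false]

/-- A cell that is entered for the first time holds the blank `b`. -/
def blankRule (b : Γ) : LTL (Sig Q Γ × ℤ) :=
  .imp (.and (.neg (sAt .used 0)) (.or
      (.and (sAt (.pend true) (-1)) (.neg (sAt (.pend false) 1)))
      (.and (sAt (.pend false) 1) (.neg (sAt (.pend true) (-1))))))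
    (.next (.and (sAt .used 0) (sAt (.sym b) 0)))

/-- A symbol can only be changed by a transition, that is, below a ready head. -/
def persistRule (a : Γ) : LTL (Sig Q Γ × ℤ) :=
  .imp (.and (sAt (.sym a) 0) (.neg (sAt .ready 0))) (.next (sAt (.sym a) 0))

/-- A pending motion is carried out, unless it leaves the piece of tape of this head and the next
cell is not vacant. -/
def moveRule (d : Bool) (q : Q) : LTL (Sig Q Γ × ℤ) :=
  .imp (.and (sAt (.pend d) 0) (.and (sAt (.state q) 0) (.or (edgeAt d 0) (vacantAt d))))
    (.next (.and (sAt .ready (sgn d)) (sAt (.state q) (sgn d))))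

/-- The effect of an alternative of the transition function on the cell below the head. -/
def effect (m : Q × Γ × HeadMove) : LTL (Sig Q Γ × ℤ) :=
  .next (.and (sAt (.state m.1) 0) (.and (sAt (.sym m.2.1) 0) (sAt (.head m.2.2.dir) 0)))

/-- Which transitions are allowed at a ready head, for each type of states. Accepting states are
forbidden, and nothing is required after a rejecting state. -/
def decision (κ : StateKind) (m₁ m₂ : Q × Γ × HeadMove) : LTL (Sig Q Γ × ℤ) :=
  match κ with
  | .accepting => .neg (sAt .ready 0)
  | .rejecting => sAt .ready 0
  | .existential =>
      .and (.or (.neg (sAt .choice 0)) (effect m₁)) (.or (sAt .choice 0) (effect m₂))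
  | .universal => .or (effect m₁) (effect m₂)

/-- `decision` is obeyed by a ready head in state `q` on the symbol `a`. -/
def decideRule (κ : StateKind) (q : Q) (a : Γ) (m₁ m₂ : Q × Γ × HeadMove) :
    LTL (Sig Q Γ × ℤ) :=
  .imp (.and (sAt .ready 0) (.and (sAt (.state q) 0) (sAt (.sym a) 0))) (decision κ m₁ m₂)

/-- The rules for the state `q` and the symbol `a`. -/
def tableRules (κ : StateKind) (q : Q) (a : Γ) (m₁ m₂ : Q × Γ × HeadMove) :
    List (LTL (Sig Q Γ × ℤ)) :=
  [persistRule a, moveRule true q, moveRule false q, decideRule κ q a m₁ m₂]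

/-- A tautology. -/
def verum : LTL (Sig Q Γ × ℤ) := .or (sAt .used 0) (.neg (sAt .used 0))

/-- A head in the initial state is placed exactly on the processes with input `start`. -/
def headInit (q₀ : Q) : LTL (Sig Q Γ × ℤ) :=
  .or (.and (sAt .start 0) (.next (.and (sAt .ready 0) (.and (sAt (.state q₀) 0)
      (.neg (sAt .edge (-1)))))))
    (.and (.neg (sAt .start 0)) (.next (.neg (headAt 0))))

/-- A cell whose nearest predecessor with input `start` has distance `i` (where `i ≥ j`) holds the
`(i - j)`-th character of the word and, for `i > 0`, is joined to its left neighbour; the other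
cells are unused. -/
def cellInit : ℕ → List Γ → LTL (Sig Q Γ × ℤ)
  | _, [] => .next (.neg (sAt .used 0))
  | j, a :: w =>
      .or (.and (sAt .start j) (.and (.next (.and (sAt .used 0) (sAt (.sym a) 0)))
          (.or (sAt .start 0) (.next (sAt .edge (-1))))))
        (.and (.neg (sAt .start j)) (cellInit (j + 1) w))

end Rules

namespace AcceptanceInstance

variable (x : AcceptanceInstance)

/-- All rules that govern the evolution of the ring of processes. -/
def rules : List (LTL (Sig (Fin x.numStates) (Fin x.numSymbols) × ℤ)) :=
  frameRules ++ blankRule x.machine.blank ::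
    (List.finRange x.numStates).flatMap fun q => (List.finRange x.numSymbols).flatMap fun a =>
      tableRules (x.machine.g q) q a (x.machine.δ q a).1 (x.machine.δ q a).2

/-- The input `start` of the first moment determines the second valuation, from which on all rules
hold. The rules cannot be imposed on the first valuation, since it does not depend on any input and
so cannot contain a tape yet. -/
def formula : LTL (Sig (Fin x.numStates) (Fin x.numSymbols) × ℤ) :=
  .and (headInit x.machine.q₀) (.and (.next (.globally (.bigAnd verum x.rules)))
    (cellInit 0 x.word))

end AcceptanceInstance

/-- The numbering of the propositions. -/
def Sig.index {m s : ℕ} : Sig (Fin m) (Fin s) → Fin 2 ⊕ Fin (5 + m + s)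
  | start => .inl 0
  | choice => .inl 1
  | used => .inr ⟨0, by omega⟩
  | edge => .inr ⟨1, by omega⟩
  | ready => .inr ⟨2, by omega⟩
  | pend false => .inr ⟨3, by omega⟩
  | pend true => .inr ⟨4, by omega⟩
  | state q => .inr ⟨5 + q, by omega⟩
  | sym a => .inr ⟨5 + m + a, by omega⟩

theorem Sig.index_injective {m s : ℕ} :
    Function.Injective (Sig.index : Sig (Fin m) (Fin s) → _) := by
  intro a b h
  rcases a with _ | _ | _ | _ | _ | (_ | _) | a | a <;>
    rcases b with _ | _ | _ | _ | _ | (_ | _) | b | b <;>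
    simp only [index, reduceCtorEq, Sum.inl.injEq, Sum.inr.injEq, Fin.ext_iff,
      state.injEq, sym.injEq] at h ⊢ <;> omega

/-- The specification that is realizable iff the machine does not accept the word. -/
def reductionSpec (x : AcceptanceInstance) : RotationSpec where
  numInputs := 2
  numOutputs := 5 + x.numStates + x.numSymbols
  formula := x.formula.map (Prod.map Sig.index id)

/-! ### The size of the specification -/

theorem size_cellInit {Q Γ : Type} (j : ℕ) (w : List Γ) :
    (cellInit j w : LTL (Sig Q Γ × ℤ)).size = 15 * w.length + 3 := by
  induction w generalizing j with
  | nil => rfl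
  | cons a w ih => simp only [cellInit, sAt, LTL.size, ih, List.length_cons]; omega

theorem sum_map_flatMap_le {α β : Type} (l : List α) (h : α → List β) (f : β → ℕ) (B : ℕ)
    (hB : ∀ a ∈ l, ((h a).map f).sum ≤ B) : ((l.flatMap h).map f).sum ≤ l.length * B := by
  induction l with
  | nil => simp
  | cons a l ih =>
    have h1 := hB a (by simp)
    have h2 := ih fun b hb => hB b (by simp [hb])
    simp only [List.flatMap_cons, List.map_append, List.sum_append, List.length_cons, Nat.add_mul]
    omega

theorem size_tableRules {Q Γ : Type} (κ : StateKind) (q : Q) (a : Γ) (m₁ m₂ : Q × Γ × HeadMove) :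
    ((tableRules κ q a m₁ m₂).map fun φ => φ.size + 1).sum ≤ 100 := by
  cases κ <;> simp [tableRules, persistRule, moveRule, decideRule, decision, effect, vacantAt,
    edgeAt, sAt, LTL.imp, LTL.size]

theorem size_formula (x : AcceptanceInstance) (hw : x.word ≠ []) :
    x.formula.size ≤ 1000 * (x.numStates * x.numSymbols * x.word.length) := by
  have h1 := sum_map_flatMap_le (List.finRange x.numStates)
    (fun q => (List.finRange x.numSymbols).flatMap fun a =>
      tableRules (x.machine.g q) q a (x.machine.δ q a).1 (x.machine.δ q a).2)
    (fun φ => φ.size + 1) (x.numSymbols * 100) (fun q _ => by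
      have := sum_map_flatMap_le (List.finRange x.numSymbols)
        (fun a => tableRules (x.machine.g q) q a (x.machine.δ q a).1 (x.machine.δ q a).2)
        (fun φ => φ.size + 1) 100 (fun a _ => size_tableRules ..)
      simpa using this)
  have hm : 0 < x.numStates := x.machine.q₀.pos
  have hs : 0 < x.numSymbols := x.machine.blank.pos
  have hk : 0 < x.word.length := List.length_pos_iff.mpr hw
  have h2 : ((frameRules : List (LTL (Sig (Fin x.numStates) (Fin x.numSymbols) × ℤ))).map
      fun φ => φ.size + 1).sum ≤ 150 := by
    simp [frameRules, edgeRule, vacantAt, headAt, edgeAt, sAt, LTL.imp, LTL.size]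
  have h3 : (blankRule x.machine.blank : LTL (Sig (Fin x.numStates) _ × ℤ)).size ≤ 30 := by
    simp [blankRule, sAt, LTL.imp, LTL.size]
  have h4 : (headInit x.machine.q₀ : LTL (Sig _ (Fin x.numSymbols) × ℤ)).size ≤ 30 := by
    simp [headInit, headAt, sAt, LTL.size]
  have h5 : (verum : LTL (Sig (Fin x.numStates) (Fin x.numSymbols) × ℤ)).size = 4 := rfl
  simp only [AcceptanceInstance.formula, LTL.size, LTL.size_bigAnd, AcceptanceInstance.rules,
    List.map_append, List.sum_append, List.map_cons, List.sum_cons, size_cellInit, h5]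
  simp only [List.length_finRange] at h1
  have h6 : 1 ≤ x.numStates * x.numSymbols := Nat.mul_pos hm hs
  have h7 : x.numStates * x.numSymbols ≤ x.numStates * x.numSymbols * x.word.length :=
    Nat.le_mul_of_pos_right _ hk
  have h8 : x.word.length ≤ x.numStates * x.numSymbols * x.word.length :=
    Nat.le_mul_of_pos_left _ h6
  have h9 : x.numStates * (x.numSymbols * 100) = 100 * (x.numStates * x.numSymbols) := by ring
  omega

/-! ### Semantics of the specification -/

/-- A valuation of the propositions at all processes. The processes are indexed by integers, and the
inputs are attributed to the process that receives them as its own. -/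
abbrev Snapshot (Q Γ : Type) : Type := Sig Q Γ → ℤ → Prop

namespace Snapshot

variable {Q Γ : Type}

/-- The propositions as seen from process `x`. -/
def view (V : Snapshot Q Γ) (x : ℤ) : Set (Sig Q Γ × ℤ) :=
  {p | match p.1 with
    | .start => V .start (x - p.2)
    | .choice => V .choice (x - p.2)
    | s => V s (x + p.2)}

/-- The cell at `x` is joined to its neighbour in direction `d`. The edge between two cells is kept
by the left one. -/
def Edge (V : Snapshot Q Γ) (d : Bool) (x : ℤ) : Prop := V .edge (if d then x else x - 1)

/-- There is a head on the cell at `x`. -/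
def Head (V : Snapshot Q Γ) (x : ℤ) : Prop :=
  V .ready x ∨ V (.pend false) x ∨ V (.pend true) x

/-- The neighbour of `x` in direction `d` is unused, and no head is about to enter it from its other
side. -/
def Vacant (V : Snapshot Q Γ) (d : Bool) (x : ℤ) : Prop :=
  ¬ V .used (x + sgn d) ∧ ¬ V (.pend !d) (x + 2 * sgn d)

/-- The effect of an alternative of the transition function at `x`. -/
def Effect (V : Snapshot Q Γ) (x : ℤ) (m : Q × Γ × HeadMove) : Prop :=
  V (.state m.1) x ∧ V (.sym m.2.1) x ∧ V (.head m.2.2.dir) x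

/-- The semantics of `decision` at `x`. -/
def Decision (V V' : Snapshot Q Γ) (x : ℤ) (κ : StateKind) (m₁ m₂ : Q × Γ × HeadMove) : Prop :=
  match κ with
  | .accepting => ¬ V .ready x
  | .rejecting => V .ready x
  | .existential => (V .choice x → V'.Effect x m₁) ∧ (¬ V .choice x → V'.Effect x m₂)
  | .universal => V'.Effect x m₁ ∨ V'.Effect x m₂

/-- The rules of the specification at process `x`, for the consecutive valuations `V` and `V'`. -/
structure Step (M : ATM Q Γ) (V V' : Snapshot Q Γ) (x : ℤ) : Prop where
  used_mono : V .used x → V' .used x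
  used_new : V' .used x → V .used x ∨ V (.pend true) (x - 1) ∨ V (.pend false) (x + 1)
  edge_mono : V .edge x → V' .edge x
  edge_new : V' .edge x → V .edge x ∨ V (.pend true) x ∧ ¬ V .used (x + 1) ∨
    V (.pend false) (x + 1) ∧ ¬ V .used x
  head_new : V'.Head x → V .ready x ∨ V (.pend true) (x - 1) ∧ (V .edge (x - 1) ∨ ¬ V .used x) ∨
    V (.pend false) (x + 1) ∧ (V .edge x ∨ ¬ V .used x)
  ready_pend : ∀ d, ¬ (V .ready x ∧ V (.pend d) x)
  pend_pend : ¬ (V (.pend true) x ∧ V (.pend false) x)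
  edge_used : V .edge x → V .used x ∧ V .used (x + 1)
  head_used : V.Head x → V .used x
  edge_enter : ∀ d, V (.pend d) x → V.Vacant d x → V'.Edge d x
  blank : ¬ V .used x → (V (.pend true) (x - 1) ∧ ¬ V (.pend false) (x + 1) ∨
    V (.pend false) (x + 1) ∧ ¬ V (.pend true) (x - 1)) → V' .used x ∧ V' (.sym M.blank) x
  persist : ∀ a, V (.sym a) x → ¬ V .ready x → V' (.sym a) x
  move : ∀ d q, V (.pend d) x → V (.state q) x → V.Edge d x ∨ V.Vacant d x →
    V' .ready (x + sgn d) ∧ V' (.state q) (x + sgn d)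
  decide : ∀ q a, V .ready x → V (.state q) x → V (.sym a) x →
    V.Decision V' x (M.g q) (M.δ q a).1 (M.δ q a).2

/-- A head in the initial state is placed exactly on the processes with input `start`. -/
def HeadInit (M : ATM Q Γ) (V V' : Snapshot Q Γ) (x : ℤ) : Prop :=
  V .start x ∧ V' .ready x ∧ V' (.state M.q₀) x ∧ ¬ V' .edge (x - 1) ∨
    ¬ V .start x ∧ ¬ V'.Head x

/-- The cell of process `x` holds the character of `w` given by the distance to the nearest
predecessor with input `start`, and is unused if that distance is too large. -/
def CellInit (w : List Γ) (V V' : Snapshot Q Γ) (x : ℤ) : Prop :=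
  (∃ (j : ℕ) (a : Γ), w[j]? = some a ∧ V .start (x - j) ∧ (∀ i : ℕ, i < j → ¬ V .start (x - i)) ∧
      V' .used x ∧
      V' (.sym a) x ∧ (V .start x ∨ V' .edge (x - 1))) ∨
    (∀ i : ℕ, i < w.length → ¬ V .start (x - i)) ∧ ¬ V' .used x

end Snapshot

open Snapshot

section Semantics

variable {Q Γ : Type} (W : ℕ → Snapshot Q Γ) (x : ℤ) (t : ℕ)

theorem holds_sAt (s : Sig Q Γ) (z : ℤ) (hs : s ≠ .start) (hc : s ≠ .choice) :
    (sAt s z).Holds (fun t => (W t).view x) t ↔ W t s (x + z) := by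
  cases s <;> first | contradiction | exact Iff.rfl

theorem holds_edgeAt (d : Bool) (z : ℤ) :
    (edgeAt d z).Holds (fun t => (W t).view x) t ↔ (W t).Edge d (x + z) := by
  cases d
  · simp only [edgeAt, Edge, Bool.false_eq_true, if_false, add_sub_assoc]
    exact holds_sAt W x t .edge _ (by simp) (by simp)
  · simp only [edgeAt, Edge, if_true]
    exact holds_sAt W x t .edge _ (by simp) (by simp)

theorem holds_headAt (z : ℤ) :
    (headAt z).Holds (fun t => (W t).view x) t ↔ (W t).Head (x + z) := by
  simp [headAt, Head, LTL.Holds, holds_sAt]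

theorem holds_vacantAt (d : Bool) :
    (vacantAt d).Holds (fun t => (W t).view x) t ↔ (W t).Vacant d x := by
  simp [vacantAt, Vacant, LTL.Holds, holds_sAt]

theorem holds_start (z : ℤ) :
    (sAt .start z).Holds (fun t => (W t).view x) t ↔ W t .start (x - z) := Iff.rfl

theorem holds_choice (z : ℤ) :
    (sAt .choice z).Holds (fun t => (W t).view x) t ↔ W t .choice (x - z) := Iff.rfl

theorem holds_effect (m : Q × Γ × HeadMove) :
    (effect m).Holds (fun t => (W t).view x) t ↔ (W (t + 1)).Effect x m := by
  have : Sig.head m.2.2.dir ≠ (Sig.start : Sig Q Γ) ∧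
      Sig.head m.2.2.dir ≠ (Sig.choice : Sig Q Γ) := by
    cases m.2.2 <;> simp [Sig.head, HeadMove.dir]
  simp [effect, Effect, LTL.Holds, holds_sAt, this]

theorem holds_decision (κ : StateKind) (m₁ m₂ : Q × Γ × HeadMove) :
    (decision κ m₁ m₂).Holds (fun t => (W t).view x) t ↔
      (W t).Decision (W (t + 1)) x κ m₁ m₂ := by
  cases κ <;> simp only [decision, Decision, LTL.Holds, holds_sAt, holds_effect, holds_choice, ne_eq,
    reduceCtorEq, not_false_eq_true, add_zero, sub_zero]
  tauto

theorem holds_headInit (M : ATM Q Γ) :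
    (headInit M.q₀).Holds (fun t => (W t).view x) t ↔ HeadInit M (W t) (W (t + 1)) x := by
  simp [headInit, HeadInit, LTL.Holds, holds_sAt, holds_start, holds_headAt, sub_eq_add_neg]

theorem holds_cellInit_from (w : List Γ) (j : ℕ) :
    (cellInit j w).Holds (fun t => (W t).view x) t ↔
      (∃ i a, w[i]? = some a ∧ W t .start (x - (j + i : ℕ)) ∧
        (∀ i' < i, ¬ W t .start (x - (j + i' : ℕ))) ∧ W (t + 1) .used x ∧ W (t + 1) (.sym a) x ∧
        (W t .start x ∨ W (t + 1) .edge (x - 1))) ∨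
      (∀ i < w.length, ¬ W t .start (x - (j + i : ℕ))) ∧ ¬ W (t + 1) .used x := by
  induction w generalizing j with
  | nil => simp [cellInit, LTL.Holds, holds_sAt]
  | cons b w ih =>
    simp only [cellInit, LTL.Holds, ih, holds_start, holds_sAt, ne_eq, reduceCtorEq,
      not_false_eq_true, add_zero, sub_zero]
    by_cases h : W t .start (x - j)
    · simp only [h, true_and, not_true_eq_false, false_and, or_false]
      constructor
      · rintro ⟨⟨h1, h2⟩, h3⟩
        exact .inl ⟨0, b, rfl, by simpa using h, by simp, h1, h2, h3⟩
      · rintro (⟨i, a, h1, -, h2, h3, h4, h5⟩ | ⟨h1, -⟩)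
        · cases i with
          | zero =>
            simp only [List.getElem?_cons_zero, Option.some.injEq] at h1
            subst h1
            exact ⟨⟨h3, h4⟩, h5⟩
          | succ i => exact absurd (by simpa using h) (h2 0 (by omega))
        · exact absurd (by simpa using h) (h1 0 (by simp))
    · simp only [h, false_and, not_false_eq_true, true_and, false_or]
      have e : ∀ i : ℕ, ((j + 1 + i : ℕ) : ℤ) = (j + (i + 1) : ℕ) := by intro i; push_cast; ring
      simp only [e]
      refine or_congr ⟨?_, ?_⟩ (and_congr_left fun _ => ⟨?_, ?_⟩)
      · rintro ⟨i, a, h1, h2, h3, h4⟩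
        refine ⟨i + 1, a, by simpa using h1, h2, fun i' hi' => ?_, h4⟩
        cases i' with
        | zero => simpa using h
        | succ i' => exact h3 i' (by omega)
      · rintro ⟨i, a, h1, h2, h3, h4⟩
        cases i with
        | zero => exact absurd (by simpa using h2) h
        | succ i => exact ⟨i, a, by simpa using h1, h2, fun i' hi' => h3 (i' + 1) (by omega), h4⟩
      · intro h1 i hi
        cases i with
        | zero => simpa using h
        | succ i => exact h1 i (by simpa using hi)
      · exact fun h1 i hi => h1 (i + 1) (by simpa using hi)

theorem holds_cellInit (w : List Γ) :
    (cellInit 0 w).Holds (fun t => (W t).view x) t ↔ CellInit w (W t) (W (t + 1)) x := by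
  simp only [holds_cellInit_from, CellInit, Nat.zero_add]

end Semantics

theorem or_or_or_not {A B C D : Prop} : A ∨ B ∨ C ∨ ¬ D ↔ (D → A ∨ B ∨ C) := by
  tauto

namespace AcceptanceInstance

variable (x : AcceptanceInstance)

theorem holds_rules (W : ℕ → Snapshot (Fin x.numStates) (Fin x.numSymbols)) (i : ℤ) (t : ℕ) :
    (LTL.bigAnd verum x.rules).Holds (fun t => (W t).view i) t ↔
      Step x.machine (W t) (W (t + 1)) i := by
  have hv : (verum : LTL (Sig (Fin x.numStates) (Fin x.numSymbols) × ℤ)).Holds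
      (fun t => (W t).view i) t := by
    simp only [verum, LTL.Holds]
    tauto
  have hm : 0 < x.numStates := x.machine.q₀.pos
  have hs : 0 < x.numSymbols := x.machine.blank.pos
  rw [LTL.holds_bigAnd, and_iff_left hv]
  simp only [rules, List.forall_mem_append, List.forall_mem_cons, frameRules, List.mem_flatMap,
    List.mem_finRange, true_and, forall_exists_index, tableRules, blankRule, persistRule, moveRule,
    decideRule, edgeRule, LTL.holds_imp, LTL.Holds, holds_edgeAt, holds_headAt, holds_vacantAt,
    holds_sAt, ne_eq, reduceCtorEq, not_false_eq_true, add_zero, List.not_mem_nil,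
    false_imp_iff, implies_true, and_true, ← sub_eq_add_neg]
  constructor
  · rintro ⟨⟨h1, h2, h3, h4, h5, h6, h7, h8, h9, h10, h11, h12⟩, hb, ht⟩
    have ht' := fun q a φ => fun h => ht φ q a h
    simp only [List.forall_mem_cons, LTL.holds_imp, LTL.Holds, holds_edgeAt,
      holds_vacantAt, holds_decision, holds_sAt, ne_eq, reduceCtorEq, not_false_eq_true, add_zero,
      List.not_mem_nil, false_imp_iff, implies_true, and_true] at ht'
    exact
      { used_mono := h1
        used_new := or_or_or_not.1 h2
        edge_mono := h3
        edge_new := or_or_or_not.1 h4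
        head_new := or_or_or_not.1 h5
        ready_pend := fun d => match d with
          | true => h6
          | false => h7
        pend_pend := h8
        edge_used := h9
        head_used := h10
        edge_enter := fun d h h' => match d with
          | true => h11 ⟨h, h'⟩
          | false => h12 ⟨h, h'⟩
        blank := fun h h' => hb ⟨h, h'⟩
        persist := fun a h h' => (ht' ⟨0, hm⟩ a).1 ⟨h, h'⟩
        move := fun d q h h' h'' => match d with
          | true => (ht' q ⟨0, hs⟩).2.1 ⟨h, h', h''⟩
          | false => (ht' q ⟨0, hs⟩).2.2.1 ⟨h, h', h''⟩
        decide := fun q a h h' h'' => (ht' q a).2.2.2 ⟨h, h', h''⟩ }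
  · intro h
    refine ⟨⟨h.used_mono, or_or_or_not.2 h.used_new, h.edge_mono, or_or_or_not.2 h.edge_new,
      or_or_or_not.2 h.head_new, h.ready_pend _, h.ready_pend _, h.pend_pend, h.edge_used,
      h.head_used, fun h' => h.edge_enter _ h'.1 h'.2, fun h' => h.edge_enter _ h'.1 h'.2⟩,
      fun h' => h.blank h'.1 h'.2, ?_⟩
    intro φ q a hφ
    revert φ
    simp only [List.forall_mem_cons, LTL.holds_imp, LTL.Holds, holds_edgeAt,
      holds_vacantAt, holds_decision, holds_sAt, ne_eq, reduceCtorEq, not_false_eq_true, add_zero,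
      List.not_mem_nil, false_imp_iff, implies_true, and_true]
    exact ⟨fun h' => h.persist a h'.1 h'.2, fun h' => h.move _ q h'.1 h'.2.1 h'.2.2,
      fun h' => h.move _ q h'.1 h'.2.1 h'.2.2, fun h' => h.decide q a h'.1 h'.2.1 h'.2.2⟩

theorem holds_formula (W : ℕ → Snapshot (Fin x.numStates) (Fin x.numSymbols)) (i : ℤ) :
    x.formula.Holds (fun t => (W t).view i) 0 ↔
      HeadInit x.machine (W 0) (W 1) i ∧ CellInit x.word (W 0) (W 1) i ∧
        ∀ t, 1 ≤ t → Step x.machine (W t) (W (t + 1)) i := by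
  simp only [formula, LTL.Holds, holds_headInit, holds_cellInit, holds_rules]
  tauto

end AcceptanceInstance

/-! ### Tape configurations on a ring of processes -/

theorem sgn_not (d : Bool) : sgn (!d) = - sgn d := by
  cases d <;> rfl

namespace TapeConfig

variable {Q Γ : Type}

/-- The used cells on one side of the head, nearest cell first. -/
def side (c : TapeConfig Q Γ) : Bool → List Γ
  | false => c.left
  | true => c.right

end TapeConfig

namespace ATM

variable {Q Γ : Type} (M : ATM Q Γ)

/-- The configuration after a motion of the head. -/
def shift (c : TapeConfig Q Γ) (d : Bool) : TapeConfig Q Γ :=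
  M.applyMove c (c.state, c.head, if d then .right else .left)

/-- The configuration after carrying out the pending motion, if any. -/
def resolve (c : TapeConfig Q Γ) : Option Bool → TapeConfig Q Γ
  | none => c
  | some d => M.shift c d

theorem applyMove_eq_resolve (c : TapeConfig Q Γ) (q : Q) (a : Γ) (m : HeadMove) :
    M.applyMove c (q, a, m) = M.resolve ⟨q, c.left, a, c.right⟩ m.dir := by
  cases m <;> rfl

theorem shift_state (c : TapeConfig Q Γ) (d : Bool) : (M.shift c d).state = c.state := by
  obtain ⟨q, l, a, r⟩ := c
  cases d <;> [cases l; cases r] <;> rfl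

theorem shift_head (c : TapeConfig Q Γ) (d : Bool) :
    (M.shift c d).head = (c.side d).headD M.blank := by
  obtain ⟨q, l, a, r⟩ := c
  cases d <;> [cases l; cases r] <;> rfl

theorem shift_side (c : TapeConfig Q Γ) (d : Bool) :
    (M.shift c d).side d = (c.side d).tail := by
  obtain ⟨q, l, a, r⟩ := c
  cases d <;> [cases l; cases r] <;> rfl

theorem shift_side_not (c : TapeConfig Q Γ) (d : Bool) :
    (M.shift c d).side (!d) = c.head :: c.side (!d) := by
  obtain ⟨q, l, a, r⟩ := c
  cases d <;> [cases l; cases r] <;> rfl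

end ATM

namespace Snapshot

variable {Q Γ : Type} {M : ATM Q Γ} {V V' : Snapshot Q Γ}

theorem edge_not_add (V : Snapshot Q Γ) (d : Bool) (x : ℤ) :
    V.Edge (!d) (x + sgn d) ↔ V.Edge d x := by
  cases d <;> simp [Edge, sgn, sub_eq_add_neg]

theorem pend_ready_false (hS : ∀ x, Step M V V' x) {x : ℤ} {d : Bool} (h : V (.pend d) x) :
    ¬ V .ready x := fun h' => (hS x).ready_pend d ⟨h', h⟩

theorem pend_not_false (hS : ∀ x, Step M V V' x) {x : ℤ} {d : Bool} (h : V (.pend d) x) :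
    ¬ V (.pend !d) x := by
  cases d
  · exact fun h' => (hS x).pend_pend ⟨h', h⟩
  · exact fun h' => (hS x).pend_pend ⟨h, h'⟩

theorem head_of_pend {x : ℤ} {d : Bool} (h : V (.pend d) x) : V.Head x := by
  cases d
  · exact .inr (.inl h)
  · exact .inr (.inr h)

theorem edge_mono_dir (hS : ∀ x, Step M V V' x) {d : Bool} {x : ℤ} (h : V.Edge d x) :
    V'.Edge d x :=
  (hS _).edge_mono h

theorem edge_new_dir (hS : ∀ x, Step M V V' x) {d : Bool} {x : ℤ} (h : V'.Edge d x) :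
    V.Edge d x ∨ V (.pend d) x ∧ ¬ V .used (x + sgn d) ∨
      V (.pend !d) (x + sgn d) ∧ ¬ V .used x := by
  cases d
  · have := (hS _).edge_new h
    simp only [Bool.false_eq_true, if_false, sub_add_cancel] at this
    simp only [Edge, sgn, Bool.false_eq_true, if_false, Bool.not_false, ← sub_eq_add_neg]
    tauto
  · exact (hS _).edge_new h

theorem used_of_edge (hS : ∀ x, Step M V V' x) {d : Bool} {x : ℤ} (h : V.Edge d x) :
    V .used x ∧ V .used (x + sgn d) := by
  have := (hS _).edge_used h
  cases d
  · simpa [sgn, ← sub_eq_add_neg, and_comm] using this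
  · exact this

theorem head_new_dir (hS : ∀ x, Step M V V' x) {x : ℤ} (h : V'.Head x) :
    V .ready x ∨
      ∃ d, V (.pend d) (x - sgn d) ∧ (V.Edge d (x - sgn d) ∨ ¬ V .used x) := by
  rcases (hS x).head_new h with h | h | h
  · exact .inl h
  · exact .inr ⟨true, h⟩
  · exact .inr ⟨false, by simpa [sgn, Edge] using h⟩

theorem used_new_dir (hS : ∀ x, Step M V V' x) {x : ℤ} (h : V' .used x) :
    V .used x ∨ ∃ d, V (.pend d) (x - sgn d) := by
  rcases (hS x).used_new h with h | h | h
  · exact .inl h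
  · exact .inr ⟨true, h⟩
  · exact .inr ⟨false, by simpa [sgn] using h⟩

/-- The configuration `c` is stored around the head at `p`, which has the status `h`. The piece of
tape of this head comprises `ℓ d` cells in direction `d`. It may be shorter than the used part of
the tape of `c` only if it is adjacent to a used cell, which the head then cannot enter. Since no
other head is in this piece and no edge leads out of it (`free`, `ends`), no other head can change
it. -/
structure Stores (V : Snapshot Q Γ) (c : TapeConfig Q Γ) (ℓ : Bool → ℕ) (p : ℤ)
    (h : Option Bool) : Prop where
  status : V (.head h) p
  state : V (.state c.state) p
  head : V (.sym c.head) p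
  len : ∀ d, ℓ d ≤ (c.side d).length
  cell : ∀ d (j : ℕ) a, j < ℓ d → (c.side d)[j]? = some a → V (.sym a) (p + sgn d * (j + 1))
  edge : ∀ d (j : ℕ), j < ℓ d → V.Edge d (p + sgn d * j)
  ends : ∀ d, ¬ V.Edge d (p + sgn d * ℓ d)
  free : ∀ d (j : ℕ), j < ℓ d → ¬ V.Head (p + sgn d * (j + 1))
  cut : ∀ d, ℓ d < (c.side d).length → V .used (p + sgn d * (ℓ d + 1))

namespace Stores

variable {c : TapeConfig Q Γ} {ℓ : Bool → ℕ} {p : ℤ} {h : Option Bool}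

theorem headAt (H : V.Stores c ℓ p h) : V.Head p := by
  have := H.status
  cases h with
  | none => exact .inl this
  | some d => exact head_of_pend this

theorem used (H : V.Stores c ℓ p h) (hS : ∀ x, Step M V V' x) (d : Bool) (j : ℕ) (hj : j ≤ ℓ d) :
    V .used (p + sgn d * j) := by
  cases j with
  | zero => simpa using (hS p).head_used H.headAt
  | succ j =>
    have := (used_of_edge hS (H.edge d j (by omega))).2
    rwa [add_assoc, ← mul_add_one, ← Nat.cast_succ] at this

/-- No foreign head can enter the piece of tape. -/
theorem head_new (H : V.Stores c ℓ p h) (hS : ∀ x, Step M V V' x) (d : Bool) (j : ℕ)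
    (hj : j ≤ ℓ d) (hx : V'.Head (p + sgn d * j)) :
    V .ready p ∧ j = 0 ∨ V (.pend d) p ∧ j = 1 := by
  have free : ∀ e (i : ℕ), i < ℓ e → ¬ V.Head (p + sgn e * (i + 1)) := H.free
  rcases head_new_dir hS hx with hr | ⟨e, he, hb⟩
  · cases j with
    | zero => exact .inl ⟨by simpa using hr, rfl⟩
    | succ j => exact absurd (.inl (by simpa using hr)) (free d j (by omega))
  · replace hb := hb.resolve_right fun hn => hn (H.used hS d j hj)
    by_cases hde : e = d
    · subst hde
      cases j with
      | zero =>
        have hb' : V.Edge (!e) p := by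
          rw [← edge_not_add, Bool.not_not, sgn_not]
          simpa [sub_eq_add_neg] using hb
        by_cases hl : ℓ (!e) = 0
        · exact absurd hb' (by simpa [hl] using H.ends (!e))
        · refine absurd (head_of_pend (d := e) ?_) (free (!e) 0 (by omega))
          convert he using 1
          rw [sgn_not]
          simp [sub_eq_add_neg]
      | succ j =>
        have e1 : p + sgn e * ((j + 1 : ℕ) : ℤ) - sgn e = p + sgn e * j := by push_cast; ring
        rw [e1] at he
        cases j with
        | zero => exact .inr ⟨by simpa using he, rfl⟩
        | succ j => exact absurd (head_of_pend (by simpa using he)) (free e j (by omega))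
    · obtain rfl : e = !d := by cases d <;> cases e <;> simp_all
      have e1 : p + sgn d * (j : ℤ) - sgn (!d) = p + sgn d * (j + 1) := by rw [sgn_not]; ring
      have hb' : V.Edge d (p + sgn d * j) := by
        rw [← edge_not_add]
        convert hb using 1
        rw [sgn_not]
        ring
      rw [e1] at he
      have hjl : j < ℓ d := by
        by_contra hn
        obtain rfl : j = ℓ d := by omega
        exact H.ends d hb'
      exact absurd (head_of_pend he) (free d j hjl)

theorem ends_persists (H : V.Stores c ℓ p h) (hS : ∀ x, Step M V V' x) (d : Bool)
    (hd : h ≠ some d) : ¬ V'.Edge d (p + sgn d * ℓ d) := by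
  intro he
  rcases edge_new_dir hS he with he | he | he
  · exact H.ends d he
  · cases hl : ℓ d with
    | zero =>
      have hp : V (.pend d) p := by simpa [hl] using he.1
      have := H.status
      cases h with
      | none => exact pend_ready_false hS hp this
      | some e =>
        obtain rfl : e = !d := by cases d <;> cases e <;> simp_all
        exact pend_not_false hS hp this
    | succ j =>
      rw [hl] at he
      exact H.free d j (by omega) (head_of_pend (by simpa using he.1))
  · exact he.2 (H.used hS d _ le_rfl)

theorem sym_persists (H : V.Stores c ℓ p h) (hS : ∀ x, Step M V V' x) (d : Bool) (j : ℕ) (a : Γ)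
    (hj : j < ℓ d) (ha : (c.side d)[j]? = some a) : V' (.sym a) (p + sgn d * (j + 1)) :=
  (hS _).persist a (H.cell d j a hj ha) fun hr => H.free d j hj (.inl hr)

/-- The effect of a decision of a ready head. -/
theorem effect (H : V.Stores c ℓ p none) (hS : ∀ x, Step M V V' x) {q : Q} {a : Γ} {m : HeadMove}
    (he : V'.Effect p (q, a, m)) : V'.Stores ⟨q, c.left, a, c.right⟩ ℓ p m.dir := by
  have hside : ∀ d, TapeConfig.side ⟨q, c.left, a, c.right⟩ d = c.side d := by rintro (_ | _) <;> rfl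
  exact
    { status := he.2.2
      state := he.1
      head := he.2.1
      len := fun d => by rw [hside]; exact H.len d
      cell := fun d j b hj hb => H.sym_persists hS d j b hj (by rwa [hside] at hb)
      edge := fun d j hj => edge_mono_dir hS (H.edge d j hj)
      ends := fun d => H.ends_persists hS d (by simp)
      free := fun d j hj hh => by
        rcases H.head_new hS d (j + 1) (by omega) (by simpa using hh) with h' | h'
        · omega
        · exact pend_ready_false hS h'.1 H.status
      cut := fun d hl => (hS _).used_mono (H.cut d (by rwa [hside] at hl)) }

/-- A motion that is not blocked is carried out. -/
theorem shift {d : Bool} (H : V.Stores c ℓ p (some d)) (hS : ∀ x, Step M V V' x)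
    (hl : V.Edge d p ∨ V.Vacant d p) :
    V'.Stores (M.shift c d) (fun e => if e = d then ℓ e - 1 else ℓ e + 1) (p + sgn d) none := by
  have hp : V (.pend d) p := H.status
  have hnd : ∀ e, e ≠ d → e = !d := fun e he => by cases d <;> cases e <;> simp_all
  have hjoin : V.Edge d p → ℓ d ≠ 0 := fun he h0 => H.ends d (by simpa [h0] using he)
  have hvac : ¬ V.Edge d p → ℓ d = 0 ∧ c.side d = [] := fun he => by
    have h0 : ℓ d = 0 := by
      by_contra h0
      exact he (by simpa using H.edge d 0 (by omega))
    refine ⟨h0, ?_⟩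
    by_contra hne
    refine (hl.resolve_left he).1 ?_
    simpa [h0] using H.cut d (by rw [h0]; exact List.length_pos_iff.2 hne)
  have hmove := (hS p).move d c.state hp H.state hl
  have back : ∀ j : ℕ, p + sgn d + sgn (!d) * ((j : ℤ) + 1) = p + sgn (!d) * j := by
    intro j
    rw [sgn_not]
    ring
  have ahead : ∀ j : ℕ, 0 < ℓ d → p + sgn d + sgn d * (j : ℤ) = p + sgn d * (j + 1 : ℕ) := by
    intro j _
    push_cast
    ring
  refine ⟨hmove.1, ?_, ?_, ?_, ?_, ?_, ?_, ?_, ?_⟩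
  · rw [M.shift_state]
    exact hmove.2
  · rw [M.shift_head]
    by_cases he : V.Edge d p
    · have h0 := hjoin he
      have hlen := H.len d
      obtain ⟨b, l, hbl⟩ : ∃ b l, c.side d = b :: l := by
        cases hc : c.side d with
        | nil => rw [hc] at hlen; simp at hlen; omega
        | cons b l => exact ⟨b, l, rfl⟩
      have := H.sym_persists hS d 0 b (by omega) (by rw [hbl]; rfl)
      rw [hbl]
      simpa using this
    · rw [(hvac he).2]
      have hv := hl.resolve_left he
      refine ((hS _).blank hv.1 ?_).2
      have h2 := hv.2
      cases d
      · refine .inr ⟨by simpa [sgn] using hp, ?_⟩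
        simpa [sgn, two_mul, add_assoc, sub_eq_add_neg] using h2
      · refine .inl ⟨by simpa [sgn] using hp, ?_⟩
        simpa [sgn, two_mul, add_assoc, sub_eq_add_neg] using h2
  · intro e
    have := H.len e
    by_cases he : e = d
    · subst he
      rw [M.shift_side]
      simp only [if_true, List.length_tail]
      omega
    · obtain rfl := hnd e he
      rw [M.shift_side_not]
      simp only [he, if_false, List.length_cons]
      omega
  · intro e j a hj ha
    by_cases he : e = d
    · subst he
      rw [M.shift_side, List.getElem?_tail] at ha
      simp only [if_true] at hj
      have := H.sym_persists hS e (j + 1) a (by omega) ha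
      convert this using 1
      push_cast
      ring
    · obtain rfl := hnd e he
      rw [M.shift_side_not] at ha
      simp only [he, if_false] at hj
      rw [back]
      cases j with
      | zero =>
        simp only [List.getElem?_cons_zero, Option.some.injEq] at ha
        subst ha
        simpa using (hS p).persist _ H.head (pend_ready_false hS hp)
      | succ j => simpa using H.sym_persists hS (!d) j a (by omega) (by simpa using ha)
  · intro e j hj
    by_cases he : e = d
    · subst he
      simp only [if_true] at hj
      rw [ahead j (by omega)]
      exact edge_mono_dir hS (H.edge e (j + 1) (by omega))
    · obtain rfl := hnd e he
      simp only [he, if_false] at hj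
      cases j with
      | zero =>
        simp only [Nat.cast_zero, mul_zero, add_zero]
        rw [edge_not_add]
        rcases hl with hl | hl
        · exact edge_mono_dir hS hl
        · exact (hS p).edge_enter d hp hl
      | succ j =>
        push_cast
        rw [back]
        exact edge_mono_dir hS (H.edge _ j (by omega))
  · intro e
    by_cases he : e = d
    · subst he
      simp only [if_true]
      by_cases hE : V.Edge e p
      · have h0 := hjoin hE
        rw [ahead _ (by omega), Nat.sub_add_cancel (by omega)]
        intro hn
        rcases edge_new_dir hS hn with hn | hn | hn
        · exact H.ends e hn
        · obtain ⟨j, hj⟩ := Nat.exists_eq_succ_of_ne_zero h0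
          rw [hj] at hn
          exact H.free e j (by omega) (head_of_pend (by simpa using hn.1))
        · exact hn.2 (H.used hS e _ le_rfl)
      · have hv := hl.resolve_left hE
        rw [(hvac hE).1]
        simp only [Nat.zero_sub, Nat.cast_zero, mul_zero, add_zero]
        intro hn
        rcases edge_new_dir hS hn with hn | hn | hn
        · exact hv.1 (used_of_edge hS hn).1
        · exact hv.1 ((hS _).head_used (head_of_pend hn.1))
        · refine hv.2 ?_
          convert hn.1 using 1
          ring
    · obtain rfl := hnd e he
      simp only [he, if_false]
      push_cast
      rw [back]
      exact H.ends_persists hS _ (by simp)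
  · intro e j hj hh
    by_cases he : e = d
    · subst he
      simp only [if_true] at hj
      have e1 : p + sgn e + sgn e * ((j : ℤ) + 1) = p + sgn e * (j + 2 : ℕ) := by push_cast; ring
      rw [e1] at hh
      rcases H.head_new hS e (j + 2) (by omega) hh with h' | h' <;> omega
    · obtain rfl := hnd e he
      simp only [he, if_false] at hj
      rw [back] at hh
      rcases H.head_new hS (!d) j (by omega) hh with h' | h'
      · exact pend_ready_false hS hp h'.1
      · exact pend_not_false hS hp h'.1
  · intro e hlt
    refine (hS _).used_mono ?_
    by_cases he : e = d
    · subst he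
      rw [M.shift_side] at hlt
      simp only [if_true, List.length_tail] at hlt
      have h0 : ℓ e ≠ 0 := by
        by_cases hE : V.Edge e p
        · exact hjoin hE
        · have := (hvac hE).2
          rw [this] at hlt
          simp at hlt
      have := H.cut e (by omega)
      convert this using 1
      simp only [if_true]
      rw [Nat.cast_sub (by omega)]
      push_cast
      ring
    · obtain rfl := hnd e he
      rw [M.shift_side_not] at hlt
      simp only [he, if_false, List.length_cons] at hlt
      have := H.cut (!d) (by omega)
      convert this using 1
      simp only [he, if_false]
      push_cast
      rw [sgn_not]
      ring

end Stores

end Snapshot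

/-! ### Traces of the rotation-symmetric architecture -/

section ModIndex

variable (n : ℕ) [NeZero n]

theorem modIndex_val (a : ℤ) : ((modIndex n a : Fin n) : ℤ) = a % n := by
  have hn : (n : ℤ) ≠ 0 := by exact_mod_cast NeZero.ne n
  simp [modIndex, Int.toNat_of_nonneg (Int.emod_nonneg a hn)]

theorem modIndex_eq_iff {a b : ℤ} : modIndex n a = modIndex n b ↔ (n : ℤ) ∣ a - b := by
  rw [← Int.modEq_iff_dvd, Fin.ext_iff, ← Int.natCast_inj, modIndex_val, modIndex_val]
  exact eq_comm

theorem modIndex_sub (a b : ℤ) : modIndex n a - modIndex n b = modIndex n (a - b) := by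
  rw [Fin.ext_iff, ← Int.natCast_inj, modIndex_val, Fin.val_sub]
  push_cast [Nat.cast_sub (modIndex n b).isLt.le]
  rw [modIndex_val, modIndex_val]
  refine Int.ModEq.eq (n := n) ?_
  rw [Int.modEq_iff_dvd]
  have h1 := Int.dvd_sub_self_of_emod_eq (rfl : a % n = a % n)
  have h2 := Int.dvd_sub_self_of_emod_eq (rfl : b % n = b % n)
  have : a - b - ((n : ℤ) - b % n + a % n) = (b % n - b) - (a % n - a) - n := by ring
  rw [this]
  exact (h2.sub h1).sub dvd_rfl

theorem modIndex_natCast (i : Fin n) : modIndex n (i : ℕ) = i := by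
  rw [Fin.ext_iff, ← Int.natCast_inj, modIndex_val]
  exact Int.emod_eq_of_lt (by omega) (by omega)

end ModIndex

variable {n : ℕ} [NeZero n] {L O : Type}

/-- The local inputs of process `p` for the global inputs `X`. -/
def localInput (p : Fin n) (X : Set (L × Fin n)) : Set (L × Fin n) :=
  {y | (y.1, y.2 - p) ∈ X}

/-- The state of process `p` after reading a sequence of global inputs. -/
def procState (F : MooreMachine (Set (L × Fin n)) (Set O)) (p : Fin n)
    (h : List (Set (L × Fin n))) : F.State :=
  h.foldl (fun q X => F.step q (localInput p X)) F.init

/-- The ring of `n` processes that all run `F`. -/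
def ringMachine (F : MooreMachine (Set (L × Fin n)) (Set O)) :
    MooreMachine (Set (L × Fin n)) (Set (O × Fin n)) :=
  (rotationSymmetric n L O).aggregate F

theorem foldl_ringMachine (F : MooreMachine (Set (L × Fin n)) (Set O))
    (h : List (Set (L × Fin n))) :
    h.foldl (ringMachine F).step (ringMachine F).init = fun p => procState F p h := by
  induction h using List.reverseRecOn with
  | nil => rfl
  | append_singleton h X ih =>
    rw [List.foldl_concat, ih]
    funext p
    simp only [procState, List.foldl_concat]
    rfl

theorem mem_tree_ringMachine (F : MooreMachine (Set (L × Fin n)) (Set O))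
    (h : List (Set (L × Fin n))) (o : O) (p : Fin n) :
    (o, p) ∈ (ringMachine F).tree h ↔ o ∈ F.out (procState F p h) := by
  simp only [MooreMachine.tree, foldl_ringMachine]
  constructor
  · rintro ⟨p', x, he, hx⟩
    obtain ⟨rfl, rfl⟩ := Prod.mk.inj he
    exact hx
  · exact fun hx => ⟨p, o, rfl, hx⟩

variable {m s : ℕ}

/-- The valuation of the propositions after the inputs `h`, when the next input is `X`. The own
inputs of process `z` are the global inputs with index `-z`. -/
def snapshot (F : MooreMachine (Set (Fin 2 × Fin n)) (Set (Fin (5 + m + s))))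
    (h : List (Set (Fin 2 × Fin n))) (X : Set (Fin 2 × Fin n)) : Snapshot (Fin m) (Fin s) :=
  fun σ z => match σ.index with
    | .inl y => (y, modIndex n (-z)) ∈ X
    | .inr o => o ∈ F.out (procState F (modIndex n z) h)

/-- The global inputs shifted by `x`. -/
def rotate (x : ℤ) (X : Set (L × Fin n)) : Set (L × Fin n) := localInput (modIndex n x) X

theorem localInput_rotate (x z : ℤ) (X : Set (L × Fin n)) :
    localInput (modIndex n z) (rotate x X) = localInput (modIndex n (z + x)) X := by
  ext ⟨y, i⟩
  simp only [rotate, localInput, Set.mem_ofPred_eq]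
  rw [← modIndex_natCast n i, modIndex_sub, modIndex_sub, modIndex_sub, sub_sub]

theorem procState_rotate (F : MooreMachine (Set (L × Fin n)) (Set O)) (x z : ℤ)
    (h : List (Set (L × Fin n))) :
    procState F (modIndex n z) (h.map (rotate x)) = procState F (modIndex n (z + x)) h := by
  simp only [procState, List.foldl_map, localInput_rotate]

/-- Rotation symmetry: shifting the inputs shifts the outputs. -/
theorem snapshot_rotate (F : MooreMachine (Set (Fin 2 × Fin n)) (Set (Fin (5 + m + s))))
    (h : List (Set (Fin 2 × Fin n))) (X : Set (Fin 2 × Fin n)) (x : ℤ) (σ : Sig (Fin m) (Fin s))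
    (z : ℤ) :
    snapshot F (h.map (rotate x)) (rotate x X) σ z = snapshot F h X σ (z + x) := by
  simp only [snapshot]
  cases σ.index with
  | inl y =>
    simp only [rotate, localInput, Set.mem_ofPred_eq, modIndex_sub, neg_add']
  | inr o => simp only [procState_rotate]

theorem snapshot_congr (F : MooreMachine (Set (Fin 2 × Fin n)) (Set (Fin (5 + m + s))))
    (h : List (Set (Fin 2 × Fin n))) (X : Set (Fin 2 × Fin n)) (σ : Sig (Fin m) (Fin s))
    {z z' : ℤ} (hz : (n : ℤ) ∣ z - z') : snapshot F h X σ z = snapshot F h X σ z' := by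
  have h1 : modIndex n z = modIndex n z' := (modIndex_eq_iff n).2 hz
  have h2 : modIndex n (-z) = modIndex n (-z') := by
    rw [modIndex_eq_iff, ← neg_sub_neg, neg_neg, neg_neg, ← dvd_neg, neg_sub]
    exact hz
  simp only [snapshot, h1, h2]

/-- The valuations along a trace. -/
def snapshots (F : MooreMachine (Set (Fin 2 × Fin n)) (Set (Fin (5 + m + s))))
    (t : ℕ → Set (Fin 2 × Fin n)) (i : ℕ) : Snapshot (Fin m) (Fin s) :=
  snapshot F ((List.range i).map t) (t i)

/-- The proposition of the ring of `n` processes that is meant by a signal and a process index. -/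
def ringProp (n : ℕ) [NeZero n] (p : Sig (Fin m) (Fin s) × ℤ) :
    (Fin 2 × Fin n) ⊕ (Fin (5 + m + s) × Fin n) :=
  match p.1.index with
  | .inl y => .inl (y, modIndex n p.2)
  | .inr o => .inr (o, modIndex n p.2)

theorem ltl_reductionSpec (x : AcceptanceInstance) :
    (reductionSpec x).ltl n = x.formula.map (ringProp n) := by
  refine (LTL.map_map _ _ _).trans (congrArg (fun r => x.formula.map r) ?_)
  funext ⟨σ, z⟩
  rcases σ with _ | _ | _ | _ | _ | (_ | _) | q | a <;> rfl

theorem ringProp_mem_trace (F : MooreMachine (Set (Fin 2 × Fin n)) (Set (Fin (5 + m + s))))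
    (t : ℕ → Set (Fin 2 × Fin n)) (i : ℕ) (p : Sig (Fin m) (Fin s) × ℤ) :
    ringProp n p ∈ (ringMachine F).trace t i ↔ p ∈ (snapshots F t i).view 0 := by
  obtain ⟨σ, z⟩ := p
  have hout : ∀ o, ((Sum.inr (o, modIndex n z) : _ ⊕ _) ∈ (ringMachine F).trace t i) ↔
      o ∈ F.out (procState F (modIndex n (0 + z)) ((List.range i).map t)) := by
    intro o
    rw [zero_add, ← mem_tree_ringMachine]
    simp [MooreMachine.trace]
  have hin : ∀ y, ((Sum.inl (y, modIndex n z) : _ ⊕ _) ∈ (ringMachine F).trace t i) ↔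
      (y, modIndex n (-(0 - z))) ∈ t i := by
    intro y
    simp [MooreMachine.trace]
  rcases σ with _ | _ | _ | _ | _ | (_ | _) | q | a
  · exact hin 0
  · exact hin 1
  all_goals exact hout _

/-- The conditions of the specification on the first input, for all processes. -/
structure InitOK (x : AcceptanceInstance) {n : ℕ} [NeZero n]
    (F : MooreMachine (Set (Fin 2 × Fin n)) (Set (Fin (5 + x.numStates + x.numSymbols)))) :
    Prop where
  head : ∀ X X' i, Snapshot.HeadInit x.machine (snapshot F [] X) (snapshot F [X] X') i
  cell : ∀ X X' i, Snapshot.CellInit x.word (snapshot F [] X) (snapshot F [X] X') i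

/-- The specification holds on all traces iff its conditions hold at all processes for all input
histories; by rotation symmetry, it makes no difference that it refers to process `0` only. -/
theorem satisfies_iff (x : AcceptanceInstance)
    (F : MooreMachine (Set (Fin 2 × Fin n)) (Set (Fin (5 + x.numStates + x.numSymbols)))) :
    ((rotationSymmetric n (Fin 2) _).aggregate F).Satisfies ((reductionSpec x).ltl n) ↔
      InitOK x F ∧ ∀ h ≠ [], ∀ X X' i,
        Snapshot.Step x.machine (snapshot F h X) (snapshot F (h ++ [X]) X') i := by
  have key : ∀ t : ℕ → Set (Fin 2 × Fin n),
      ((reductionSpec x).ltl n).Holds (((rotationSymmetric n (Fin 2) _).aggregate F).trace t) 0 ↔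
        x.formula.Holds (fun i => (snapshots F t i).view 0) 0 := by
    intro t
    rw [ltl_reductionSpec]
    refine (LTL.holds_map (ringProp n) x.formula ((ringMachine F).trace t) 0).trans ?_
    have e : (fun i => ringProp n ⁻¹' (ringMachine F).trace t i) =
        fun i => (snapshots F t i).view 0 :=
      funext fun i => Set.ext fun p => ringProp_mem_trace F t i p
    rw [e]
  have local_iff : ((rotationSymmetric n (Fin 2) _).aggregate F).Satisfies
      ((reductionSpec x).ltl n) ↔ ∀ t i,
        Snapshot.HeadInit x.machine (snapshots F t 0) (snapshots F t 1) i ∧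
        Snapshot.CellInit x.word (snapshots F t 0) (snapshots F t 1) i ∧
        ∀ j, 1 ≤ j → Snapshot.Step x.machine (snapshots F t j) (snapshots F t (j + 1)) i := by
    constructor
    · intro hs t i
      have h1 := (key _).1 (hs fun j => rotate i (t j))
      rw [← x.holds_formula (snapshots F t) i]
      convert h1 using 1
      funext j
      have h2 : ∀ σ z, snapshots F (fun j => rotate i (t j)) j σ z =
          snapshots F t j σ (z + i) := by
        intro σ z
        rw [snapshots, snapshots, ← snapshot_rotate, List.map_map]
        rfl
      ext ⟨σ, z⟩
      have e1 : i - z = 0 - z + i := by ring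
      have e2 : i + z = 0 + z + i := by ring
      cases σ <;> simp only [Snapshot.view, Set.mem_ofPred_eq, h2, e1, e2]
    · exact fun h t => (key t).2 ((x.holds_formula _ 0).2 (h t 0))
  rw [local_iff]
  constructor
  · intro h
    refine ⟨⟨fun X X' i => (h (fun j => if j = 0 then X else X') i).1,
      fun X X' i => (h (fun j => if j = 0 then X else X') i).2.1⟩, fun hist hne X X' i => ?_⟩
    have h1 := (h (fun j => (hist ++ [X]).getD j X') i).2.2 hist.length
      (List.length_pos_iff.2 hne)
    have e1 : (List.range hist.length).map (fun j => (hist ++ [X]).getD j X') = hist := by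
      refine List.ext_getElem (by simp) fun j hj hj' => ?_
      simp [List.getElem?_append_left hj', hj']
    have e2 : (List.range (hist.length + 1)).map (fun j => (hist ++ [X]).getD j X') =
        hist ++ [X] := by
      rw [List.range_succ, List.map_append, e1]
      simp
    simp only [snapshots, e1, e2] at h1
    simpa using h1
  · rintro ⟨h0, h1⟩ t i
    refine ⟨h0.head _ _ i, h0.cell _ _ i, fun j hj => ?_⟩
    have := h1 ((List.range j).map t) (by simp; omega) (t j) (t (j + 1)) i
    simpa [snapshots, List.range_succ] using this

/-! ### An accepting run defeats every implementation -/

theorem TapeConfig.space_eq {Q Γ : Type} (c : TapeConfig Q Γ) (d : Bool) :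
    c.space = (c.side d).length + 1 + (c.side !d).length := by
  cases d <;> simp [space, side]
  omega

theorem ATM.lt_space_shift {Q Γ : Type} (M : ATM Q Γ) (c : TapeConfig Q Γ) (d : Bool) :
    (c.side !d).length + 1 < (M.shift c d).space := by
  rw [TapeConfig.space_eq _ d, M.shift_side_not, List.length_cons]
  omega

theorem int_dvd_sgn_mul {n : ℕ} {d : Bool} {k : ℕ} (hk : 0 < k) (h : (n : ℤ) ∣ sgn d * k) :
    n ≤ k := by
  have h' : (n : ℤ) ∣ (k : ℕ) := by
    cases d
    · simpa [sgn] using h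
    · simpa [sgn] using h
  exact Nat.le_of_dvd hk (by exact_mod_cast h')

namespace Snapshot

variable {Q Γ : Type} {M : ATM Q Γ} {V V' : Snapshot Q Γ}

/-- On the ring of `n` processes, there is no head except for the one at `p`, and no used cell
outside its piece of tape. -/
structure Alone (n : ℕ) (V : Snapshot Q Γ) (ℓ : Bool → ℕ) (p : ℤ) : Prop where
  periodic : ∀ σ x y, (n : ℤ) ∣ x - y → V σ x → V σ y
  heads : ∀ x, V.Head x → (n : ℤ) ∣ x - p
  cells : ∀ x, V .used x → ∃ d j, j ≤ ℓ d ∧ (n : ℤ) ∣ x - (p + sgn d * (j : ℕ))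

namespace Alone

variable {n : ℕ} {c : TapeConfig Q Γ} {ℓ : Bool → ℕ} {p : ℤ}

theorem effect (A : Alone n V ℓ p) (H : V.Stores c ℓ p none) (hS : ∀ x, Step M V V' x)
    (hper : ∀ σ x y, (n : ℤ) ∣ x - y → V' σ x → V' σ y) : Alone n V' ℓ p := by
  have hp : ∀ x d, ¬ V (.pend d) x := fun x d hx =>
    pend_ready_false hS (A.periodic _ _ _ (A.heads x (head_of_pend hx)) hx) H.status
  refine ⟨hper, fun x hx => ?_, fun x hx => ?_⟩
  · rcases head_new_dir hS hx with h | ⟨d, h, -⟩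
    · exact A.heads x (.inl h)
    · exact absurd h (hp _ _)
  · rcases used_new_dir hS hx with h | ⟨d, h⟩
    · exact A.cells x h
    · exact absurd h (hp _ _)

theorem pend_eq {d e : Bool} {x : ℤ} (A : Alone n V ℓ p) (H : V.Stores c ℓ p (some d))
    (hS : ∀ x, Step M V V' x) (hx : V (.pend e) x) : e = d := by
  have h1 : V (.pend e) p := A.periodic _ _ _ (A.heads x (head_of_pend hx)) hx
  by_contra hne
  obtain rfl : e = !d := by cases d <;> cases e <;> simp_all
  exact pend_not_false hS H.status h1

theorem shift {d : Bool} (A : Alone n V ℓ p) (H : V.Stores c ℓ p (some d))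
    (hS : ∀ x, Step M V V' x) (hper : ∀ σ x y, (n : ℤ) ∣ x - y → V' σ x → V' σ y) :
    Alone n V' (fun e => if e = d then ℓ e - 1 else ℓ e + 1) (p + sgn d) := by
  have hp : ∀ x e, V (.pend e) (x - sgn e) → (n : ℤ) ∣ x - (p + sgn d) := by
    intro x e hx
    obtain rfl := A.pend_eq H hS hx
    have := A.heads _ (head_of_pend hx)
    rwa [sub_sub, add_comm] at this
  refine ⟨hper, fun x hx => ?_, fun x hx => ?_⟩
  · rcases head_new_dir hS hx with h | ⟨e, h, -⟩
    · exact absurd (A.periodic _ _ _ (A.heads x (.inl h)) h) (pend_ready_false hS H.status)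
    · exact hp x e h
  · rcases used_new_dir hS hx with h | ⟨e, h⟩
    · obtain ⟨e, j, hj, hd⟩ := A.cells x h
      by_cases he : e = d
      · subst he
        cases j with
        | zero =>
          refine ⟨!e, 1, by simp, ?_⟩
          rw [sgn_not]
          simpa using hd
        | succ j =>
          refine ⟨e, j, by simp; omega, ?_⟩
          convert hd using 2
          push_cast
          ring
      · obtain rfl : e = !d := by cases d <;> cases e <;> simp_all
        refine ⟨!d, j + 1, by simpa using hj, ?_⟩
        convert hd using 2
        push_cast
        rw [sgn_not]
        ring
    · exact ⟨d, 0, by simp, by simpa using hp x e h⟩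

/-- A motion is not blocked as long as the space does not exceed the number of processes. -/
theorem not_blocked {d : Bool} (A : Alone n V ℓ p) (H : V.Stores c ℓ p (some d))
    (hS : ∀ x, Step M V V' x) (hn : (M.shift c d).space ≤ n) : V.Edge d p ∨ V.Vacant d p := by
  by_contra hcon
  rw [not_or] at hcon
  have h0 : ℓ d = 0 := by
    by_contra h0
    exact hcon.1 (by simpa using H.edge d 0 (by omega))
  -- A used cell ahead belongs to the piece of tape of this head, whose other end has been reached
  -- around the ring. Then the piece has `n` cells, and the motion would take one more.
  refine hcon.2 ⟨fun hu => ?_, fun hu => ?_⟩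
  · have hlt := M.lt_space_shift c d
    have hlen := H.len (!d)
    obtain ⟨e, j, hj, hdvd⟩ := A.cells _ hu
    have hle : n ≤ 1 + ℓ (!d) := by
      by_cases he : e = d
      · subst he
        obtain rfl : j = 0 := by omega
        have := int_dvd_sgn_mul (d := e) (k := 1) (by omega) (by simpa using hdvd)
        omega
      · obtain rfl : e = !d := by cases d <;> cases e <;> simp_all
        have := int_dvd_sgn_mul (d := d) (k := 1 + j) (by omega) (by
          convert hdvd using 1
          rw [sgn_not]
          push_cast
          ring)
        omega
    omega
  · have := A.pend_eq H hS hu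
    simp at this

end Alone

end Snapshot

open Snapshot

section Soundness

variable {x : AcceptanceInstance} {n : ℕ} [NeZero n]
  {F : MooreMachine (Set (Fin 2 × Fin n)) (Set (Fin (5 + x.numStates + x.numSymbols)))}

theorem snapshot_periodic (h : List (Set (Fin 2 × Fin n))) (X : Set (Fin 2 × Fin n))
    (σ : Sig (Fin x.numStates) (Fin x.numSymbols)) (y z : ℤ) (hd : (n : ℤ) ∣ y - z)
    (hy : snapshot F h X σ y) : snapshot F h X σ z :=
  (snapshot_congr F h X σ hd) ▸ hy

theorem snapshot_output (h : List (Set (Fin 2 × Fin n))) (X X' : Set (Fin 2 × Fin n))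
    (σ : Sig (Fin x.numStates) (Fin x.numSymbols)) (hs : σ ≠ .start) (hc : σ ≠ .choice) (z : ℤ)
    (h' : snapshot F h X σ z) : snapshot F h X' σ z := by
  rcases σ with _ | _ | _ | _ | _ | (_ | _) | q | a <;> first | contradiction | exact h'

theorem snapshot_effect (h : List (Set (Fin 2 × Fin n))) (X X' : Set (Fin 2 × Fin n)) (p : ℤ)
    (m : Fin x.numStates × Fin x.numSymbols × HeadMove)
    (h' : (snapshot F h X).Effect p m) : (snapshot F h X').Effect p m := by
  refine ⟨snapshot_output _ _ _ _ (by simp) (by simp) _ h'.1,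
    snapshot_output _ _ _ _ (by simp) (by simp) _ h'.2.1,
    snapshot_output _ _ _ _ ?_ ?_ _ h'.2.2⟩ <;>
  cases m.2.2 <;> simp [Sig.head, HeadMove.dir]

/-- After the inputs `h`, the ring shows the configuration `c` and nothing else. -/
def Shows (F : MooreMachine (Set (Fin 2 × Fin n)) (Set (Fin (5 + x.numStates + x.numSymbols))))
    (h : List (Set (Fin 2 × Fin n))) (c : TapeConfig (Fin x.numStates) (Fin x.numSymbols)) : Prop :=
  h ≠ [] ∧ ∃ ℓ p, ∀ X, (snapshot F h X).Stores c ℓ p none ∧ Alone n (snapshot F h X) ℓ p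

/-- If the machine executes a transition within the space given by the ring, then the ring can be
made to show the resulting configuration: one further moment for the transition, and another one for
the motion of the head. -/
theorem shows_applyMove
    (hS : ∀ h ≠ [], ∀ X X' i, Step x.machine (snapshot F h X) (snapshot F (h ++ [X]) X') i)
    {h : List (Set (Fin 2 × Fin n))} {c : TapeConfig (Fin x.numStates) (Fin x.numSymbols)}
    {ℓ : Bool → ℕ} {p : ℤ} (hne : h ≠ [])
    (hc : ∀ X, (snapshot F h X).Stores c ℓ p none ∧ Alone n (snapshot F h X) ℓ p)
    {X X' : Set (Fin 2 × Fin n)} {m : Fin x.numStates × Fin x.numSymbols × HeadMove}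
    (he : (snapshot F (h ++ [X]) X').Effect p m) (hn : (x.machine.applyMove c m).space ≤ n) :
    ∃ h', Shows F h' (x.machine.applyMove c m) := by
  obtain ⟨q, a, m⟩ := m
  rw [ATM.applyMove_eq_resolve] at hn ⊢
  have h1 : ∀ Y, (snapshot F (h ++ [X]) Y).Stores ⟨q, c.left, a, c.right⟩ ℓ p m.dir ∧
      Alone n (snapshot F (h ++ [X]) Y) ℓ p := fun Y =>
    ⟨(hc X).1.effect (hS h hne X Y) (snapshot_effect _ X' Y p _ he),
      (hc X).2.effect (hc X).1 (hS h hne X Y) (snapshot_periodic _ _)⟩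
  cases hm : m.dir with
  | none =>
    rw [hm] at h1
    exact ⟨h ++ [X], by simp, ℓ, p, h1⟩
  | some d =>
    rw [hm] at h1 hn
    have hne' : h ++ [X] ≠ [] := by simp
    refine ⟨h ++ [X] ++ [∅], by simp, fun e => if e = d then ℓ e - 1 else ℓ e + 1, p + sgn d,
      fun Y => ?_⟩
    have hS' := hS _ hne' ∅ Y
    exact ⟨(h1 ∅).1.shift hS' ((h1 ∅).2.not_blocked (h1 ∅).1 hS' hn),
      (h1 ∅).2.shift (h1 ∅).1 hS' (snapshot_periodic _ _)⟩

/-- By induction on the accepting run tree: the environment chooses the child at existential nodes,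
the run tree contains whichever child the implementation chooses at universal nodes, and the rules
do not allow the implementation to show an accepting configuration. -/
theorem not_shows_of_acceptsFrom
    (hS : ∀ h ≠ [], ∀ X X' i, Step x.machine (snapshot F h X) (snapshot F (h ++ [X]) X') i)
    {c : TapeConfig (Fin x.numStates) (Fin x.numSymbols)}
    (hacc : x.machine.AcceptsFrom (fun c => c.space ≤ n) c) : ∀ h, ¬ Shows F h c := by
  have hok : ∀ {c}, x.machine.AcceptsFrom (fun c => c.space ≤ n) c → c.space ≤ n := by
    intro c hc
    cases hc <;> assumption
  have hdec : ∀ {h : List (Set (Fin 2 × Fin n))}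
      {c : TapeConfig (Fin x.numStates) (Fin x.numSymbols)} {ℓ p X X'}, h ≠ [] →
      (snapshot F h X).Stores c ℓ p none →
      (snapshot F h X).Decision (snapshot F (h ++ [X]) X') p (x.machine.g c.state)
        (x.machine.δ c.state c.head).1 (x.machine.δ c.state c.head).2 := fun hne H =>
    (hS _ hne _ _ _).decide _ _ H.status H.state H.head
  induction hacc with
  | accepting c _ hg =>
    rintro h ⟨hne, ℓ, p, hc⟩
    have := hdec (X := ∅) (X' := ∅) hne (hc ∅).1
    rw [hg] at this
    exact this (hc ∅).1.status
  | existential₁ c _ hg h₁ ih =>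
    rintro h ⟨hne, ℓ, p, hc⟩
    have := hdec (X := Set.univ) (X' := ∅) hne (hc _).1
    rw [hg] at this
    obtain ⟨h', hs⟩ := shows_applyMove hS hne hc (this.1 trivial) (hok h₁)
    exact ih h' hs
  | existential₂ c _ hg h₂ ih =>
    rintro h ⟨hne, ℓ, p, hc⟩
    have := hdec (X := ∅) (X' := ∅) hne (hc _).1
    rw [hg] at this
    obtain ⟨h', hs⟩ := shows_applyMove hS hne hc (this.2 id) (hok h₂)
    exact ih h' hs
  | universal c _ hg h₁ h₂ ih₁ ih₂ =>
    rintro h ⟨hne, ℓ, p, hc⟩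
    have := hdec (X := ∅) (X' := ∅) hne (hc _).1
    rw [hg] at this
    rcases this with he | he
    · obtain ⟨h', hs⟩ := shows_applyMove hS hne hc he (hok h₁)
      exact ih₁ h' hs
    · obtain ⟨h', hs⟩ := shows_applyMove hS hne hc he (hok h₂)
      exact ih₂ h' hs

/-- If exactly one process receives `start`, the ring shows the initial configuration. -/
theorem shows_initConfig (hI : InitOK x F)
    (hS : ∀ h ≠ [], ∀ X X' i, Step x.machine (snapshot F h X) (snapshot F (h ++ [X]) X') i)
    (hw : x.word ≠ []) (hk : x.word.length ≤ n) :
    Shows F [{((0 : Fin 2), modIndex n 0)}] (x.machine.initConfig x.word) := by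
  obtain ⟨a, w, hw'⟩ := List.exists_cons_of_ne_nil hw
  have hlen : x.word.length = w.length + 1 := by rw [hw']; rfl
  set X₀ : Set (Fin 2 × Fin n) := {((0 : Fin 2), modIndex n 0)} with hX₀
  have hst : ∀ z, snapshot (m := x.numStates) (s := x.numSymbols) F [] X₀ .start z ↔
      (n : ℤ) ∣ z := by
    intro z
    have : snapshot (m := x.numStates) (s := x.numSymbols) F [] X₀ .start z ↔
        modIndex n (-z) = modIndex n 0 := by
      simp [snapshot, Sig.index, hX₀]
    rw [this, modIndex_eq_iff]
    simp
  have small : ∀ i : ℕ, 0 < i → i < n → ¬ (n : ℤ) ∣ (i : ℤ) := fun i h0 hi hd =>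
    absurd (Nat.le_of_dvd h0 (by exact_mod_cast hd)) (by omega)
  have close : ∀ i j : ℕ, i < n → j < n → (n : ℤ) ∣ (i : ℤ) - j → i = j := by
    intro i j hi hj hd
    have := Int.eq_zero_of_abs_lt_dvd hd (by rw [abs_lt]; omega)
    omega
  refine ⟨by simp, fun d => if d then w.length else 0, 0, fun X => ?_⟩
  have hhead := hI.head X₀ X
  have hcell := hI.cell X₀ X
  simp only [HeadInit, CellInit, hst] at hhead hcell
  have hready := fun z hz => ((hhead z).resolve_right fun h => h.1 hz).2
  have hfree := fun z (hz : ¬ (n : ℤ) ∣ z) => ((hhead z).resolve_left fun h => hz h.1).2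
  have hcell' : ∀ i : ℕ, i < x.word.length → ∃ b, x.word[i]? = some b ∧
      snapshot F [X₀] X (.sym b) i ∧
      ((n : ℤ) ∣ i ∨ snapshot (m := x.numStates) (s := x.numSymbols) F [X₀] X .edge
        (i - 1)) := by
    intro i hi
    rcases hcell i with ⟨j, b, hb, hd, -, -, hsym, hedge⟩ | ⟨hno, -⟩
    · have hj : j < x.word.length := (List.getElem?_eq_some_iff.1 hb).1
      obtain rfl := close i j (by omega) (by omega) hd
      exact ⟨b, hb, hsym, hedge⟩
    · exact absurd (by simp) (hno i hi)
  constructor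
  · rw [hw']
    refine ⟨(hready 0 (by simp)).1, (hready 0 (by simp)).2.1, ?_, ?_, ?_, ?_, ?_, ?_, ?_⟩
    · obtain ⟨b, hb, hs, -⟩ := hcell' 0 (by omega)
      rw [hw'] at hb
      obtain rfl : a = b := by simpa using hb
      simpa [ATM.initConfig] using hs
    · rintro (_ | _) <;> simp [TapeConfig.side, ATM.initConfig]
    · rintro (_ | _) j b hj hb
      · simp at hj
      · simp only [if_true] at hj
        obtain ⟨b', hb', hs, -⟩ := hcell' (j + 1) (by omega)
        rw [hw', List.getElem?_cons_succ] at hb'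
        obtain rfl : b = b' := by simpa [TapeConfig.side, ATM.initConfig, hb'] using hb.symm
        simpa [sgn] using hs
    · rintro (_ | _) j hj
      · simp at hj
      · simp only [if_true] at hj
        obtain ⟨b', -, -, he⟩ := hcell' (j + 1) (by omega)
        simpa [Edge, sgn] using he.resolve_left (small (j + 1) (by omega) (by omega))
    · rintro (_ | _)
      · simpa [Edge, sgn] using (hready 0 (by simp)).2.2
      · simp only [Edge, sgn, if_true, one_mul, zero_add]
        by_cases hd : (n : ℤ) ∣ (w.length : ℤ) + 1
        · simpa using (hready _ hd).2.2
        · intro he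
          have hu := ((hS [X₀] (by simp) X ∅ _).edge_used he).2
          rcases hcell (w.length + 1) with ⟨j, b, hb, hdj, -⟩ | ⟨-, hno⟩
          · have hj : j < x.word.length := (List.getElem?_eq_some_iff.1 hb).1
            have hle : n ≤ w.length + 1 - j := by
              refine Nat.le_of_dvd (by omega) ?_
              rw [← Int.natCast_dvd_natCast, Nat.cast_sub (by omega)]
              exact_mod_cast hdj
            obtain rfl : j = 0 := by omega
            exact hd (by simpa using hdj)
          · exact hno hu
    · rintro (_ | _) j hj
      · simp at hj
      · simp only [if_true] at hj
        simpa [sgn] using hfree (j + 1 : ℕ) (small (j + 1) (by omega) (by omega))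
    · rintro (_ | _) hlt <;> simp [TapeConfig.side, ATM.initConfig] at hlt
  · refine ⟨snapshot_periodic _ _, fun z hz => ?_, fun z hz => ?_⟩
    · by_contra hd
      exact hfree z (by simpa using hd) hz
    · rcases hcell z with ⟨j, b, hb, hd, -⟩ | ⟨-, hno⟩
      · have hj : j < x.word.length := (List.getElem?_eq_some_iff.1 hb).1
        exact ⟨true, j, by simp; omega, by simpa [sgn] using hd⟩
      · exact absurd hz hno

/-- An implementation is refuted by the environment that gives `start` to a single process and then
plays the accepting run tree. -/
theorem not_realizable_of_acceptsInSpace (hw : x.word ≠ [])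
    (hacc : x.machine.AcceptsInSpace n x.word) : ¬ (reductionSpec x).Realizable n := by
  rintro ⟨F, hF⟩
  obtain ⟨hI, hS⟩ := (satisfies_iff x F).1 hF
  refine not_shows_of_acceptsFrom hS hacc _ (shows_initConfig hI hS hw ?_)
  obtain ⟨a, w, hw'⟩ := List.exists_cons_of_ne_nil hw
  have : (x.machine.initConfig x.word).space ≤ n := by
    cases hacc <;> assumption
  rw [hw'] at this ⊢
  simpa [ATM.initConfig, TapeConfig.space, add_comm] using this

end Soundness

/-! ### An implementation for words that are not accepted -/

/-- What the implementation knows about one process: the symbol in its tape cell (`none` if the cell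
is unused), whether the cell is joined to the next one, and the head on it with its status. -/
structure RingCell (Q Γ : Type) : Type where
  sym : Option Γ
  edge : Bool
  head : Option (Q × Option Bool)

instance {Q Γ : Type} [Finite Q] [Finite Γ] : Finite (RingCell Q Γ) :=
  Finite.of_injective (fun c : RingCell Q Γ => (c.sym, c.edge, c.head)) fun c c' h => by
    cases c
    cases c'
    simpa using h

namespace Snapshot

variable {Q Γ : Type}

/-- The valuation with the processes renumbered such that process `p` becomes process `0`. -/
def shift (V : Snapshot Q Γ) (p : ℤ) : Snapshot Q Γ := fun σ z => V σ (p + z)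

theorem edge_shift (V : Snapshot Q Γ) (p : ℤ) (d : Bool) (z : ℤ) :
    (V.shift p).Edge d z ↔ V.Edge d (p + z) := by
  cases d <;> simp [Edge, shift, add_sub_assoc]

theorem Stores.congr {V V' : Snapshot Q Γ} {c : TapeConfig Q Γ} {ℓ : Bool → ℕ} {p p' : ℤ}
    {h : Option Bool} (H : V.Stores c ℓ p h)
    (e : ∀ σ z, σ ≠ .start → σ ≠ .choice → (V σ (p + z) ↔ V' σ (p' + z))) :
    V'.Stores c ℓ p' h := by
  have e0 : ∀ σ, σ ≠ .start → σ ≠ .choice → (V σ p ↔ V' σ p') := fun σ h1 h2 => by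
    simpa using e σ 0 h1 h2
  have hE : ∀ d z, V.Edge d (p + z) ↔ V'.Edge d (p' + z) := by
    rintro (_ | _) z
    · simpa [Edge, add_sub_assoc] using e .edge (z - 1) (by simp) (by simp)
    · simpa [Edge] using e .edge z (by simp) (by simp)
  have hH : ∀ z, V.Head (p + z) ↔ V'.Head (p' + z) := fun z =>
    or_congr (e _ z (by simp) (by simp))
      (or_congr (e _ z (by simp) (by simp)) (e _ z (by simp) (by simp)))
  exact
    { status := (e0 _ (by cases h <;> simp [Sig.head]) (by cases h <;> simp [Sig.head])).1 H.status
      state := (e0 _ (by simp) (by simp)).1 H.state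
      head := (e0 _ (by simp) (by simp)).1 H.head
      len := H.len
      cell := fun d j a hj ha => (e _ _ (by simp) (by simp)).1 (H.cell d j a hj ha)
      edge := fun d j hj => (hE _ _).1 (H.edge d j hj)
      ends := fun d hd => H.ends d ((hE _ _).2 hd)
      free := fun d j hj hh => H.free d j hj ((hH _).2 hh)
      cut := fun d hd => (e _ _ (by simp) (by simp)).1 (H.cut d hd) }

/-- A head moves in direction `d` to the unused cell at `x`. -/
def Enters (V : Snapshot Q Γ) (d : Bool) (x : ℤ) : Prop :=
  V (.pend d) (x - sgn d) ∧ ¬ V .used x ∧ ¬ V (.pend !d) (x + sgn d)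

/-- A head in state `q` moves in direction `d` to the cell at `x`. -/
def Arrives (V : Snapshot Q Γ) (d : Bool) (q : Q) (x : ℤ) : Prop :=
  V (.pend d) (x - sgn d) ∧ V (.state q) (x - sgn d) ∧
    (V.Edge d (x - sgn d) ∨ ¬ V .used x ∧ ¬ V (.pend !d) (x + sgn d))

/-- Some configuration from which the machine `M` does not accept is stored at the ready head at
`x`, and the first alternative leads to a configuration from which `M` does not accept either. -/
def Safe (M : ATM Q Γ) (V : Snapshot Q Γ) (x : ℤ) : Prop :=
  ∃ c ℓ, V.Stores c ℓ x none ∧ ¬ M.AcceptsFrom (fun _ => True) (M.succ₁ c)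

theorem enters_shift (V : Snapshot Q Γ) (p : ℤ) (d : Bool) (x : ℤ) :
    (V.shift p).Enters d x ↔ V.Enters d (p + x) := by
  simp only [Enters, shift, add_sub_assoc, add_assoc]

theorem arrives_shift (V : Snapshot Q Γ) (p : ℤ) (d : Bool) (q : Q) (x : ℤ) :
    (V.shift p).Arrives d q x ↔ V.Arrives d q (p + x) := by
  simp only [Arrives, edge_shift]
  simp only [shift, add_sub_assoc, add_assoc]

theorem safe_shift (M : ATM Q Γ) (V : Snapshot Q Γ) (p : ℤ) (x : ℤ) :
    Safe M (V.shift p) x ↔ Safe M V (p + x) := by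
  have key : ∀ c ℓ, (V.shift p).Stores c ℓ x none ↔ V.Stores c ℓ (p + x) none := fun c ℓ =>
    ⟨fun H => H.congr fun σ z _ _ => by simp only [shift, add_assoc],
      fun H => H.congr fun σ z _ _ => by simp only [shift, add_assoc]⟩
  simp only [Safe, key]

end Snapshot

open Snapshot

section Ring

variable {Q Γ : Type}

/-- The valuation given by the contents of the ring and by the own inputs of the processes. -/
def ringSnapshot (G : ℤ → RingCell Q Γ) (st ch : ℤ → Prop) : Snapshot Q Γ
  | .start, z => st z
  | .choice, z => ch z
  | .used, z => (G z).sym ≠ none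
  | .edge, z => (G z).edge = true
  | .ready, z => ∃ q, (G z).head = some (q, none)
  | .pend d, z => ∃ q, (G z).head = some (q, some d)
  | .state q, z => ∃ h, (G z).head = some (q, h)
  | .sym a, z => (G z).sym = some a

/-- The outputs for the given contents of the ring. -/
def ringOutput (G : ℤ → RingCell Q Γ) : Snapshot Q Γ :=
  ringSnapshot G (fun _ => False) (fun _ => False)

theorem ringSnapshot_congr (G : ℤ → RingCell Q Γ) (st ch st' ch' : ℤ → Prop) (σ : Sig Q Γ) (z : ℤ)
    (hs : σ ≠ .start) (hc : σ ≠ .choice) :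
    ringSnapshot G st ch σ z ↔ ringSnapshot G st' ch' σ z := by
  cases σ <;> first | contradiction | exact Iff.rfl

theorem ringOutput_shift (G : ℤ → RingCell Q Γ) (p : ℤ) :
    ringOutput (fun z => G (p + z)) = (ringOutput G).shift p := by
  funext σ z
  cases σ <;> rfl

variable (M : ATM Q Γ)

open Classical in
/-- The alternative of the transition function that is chosen at `x`, if there is a head ready for
a transition: by the input for existential states, and for universal states such that the machine
still does not accept. -/
noncomputable def alternative (G : ℤ → RingCell Q Γ) (ch : ℤ → Prop) (x : ℤ) :
    Option (Q × Γ × HeadMove) :=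
  match (G x).head, (G x).sym with
  | some (q, none), some a =>
    match M.g q with
    | .existential => some (if ch x then (M.δ q a).1 else (M.δ q a).2)
    | .universal => some (if Safe M (ringOutput G) x then (M.δ q a).1 else (M.δ q a).2)
    | _ => none
  | _, _ => none

open Classical in
/-- The contents of the ring after one step. -/
noncomputable def nextRing (G : ℤ → RingCell Q Γ) (ch : ℤ → Prop) (x : ℤ) : RingCell Q Γ where
  sym := match alternative M G ch x with
    | some m => some m.2.1
    | none => if ∃ d, (ringOutput G).Enters d x then some M.blank else (G x).sym
  edge := (G x).edge || decide ((ringOutput G).Enters true (x + 1) ∨ (ringOutput G).Enters false x)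
  head := if h : ∃ q d, (ringOutput G).Arrives d q x then some (h.choose, none)
    else (alternative M G ch x).map fun m => (m.1, m.2.2.dir)

/-- The nearest predecessor of `x` (including `x`) with input `start` has distance `j`. -/
def NearestStart (st : ℤ → Prop) (x : ℤ) (j : ℕ) : Prop :=
  st (x - j) ∧ ∀ i : ℕ, i < j → ¬ st (x - i)

open Classical in
/-- The contents of the ring after the first input. -/
noncomputable def initRing (w : List Γ) (st : ℤ → Prop) (x : ℤ) : RingCell Q Γ where
  sym := if h : ∃ j, j < w.length ∧ NearestStart st x j then w[h.choose]? else none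
  edge := decide (¬ st (x + 1) ∧ ∃ j, j < w.length ∧ NearestStart st (x + 1) j)
  head := if st x then some (M.q₀, none) else none

/-! All notions commute with a renumbering of the processes, so that the processes agree on the
contents of the ring although each of them numbers the ring from its own position. -/

theorem alternative_shift (G : ℤ → RingCell Q Γ) (ch : ℤ → Prop) (p x : ℤ) :
    alternative M (fun z => G (p + z)) (fun z => ch (p + z)) x = alternative M G ch (p + x) := by
  have h : Safe M (ringOutput fun z => G (p + z)) x = Safe M (ringOutput G) (p + x) := by
    rw [ringOutput_shift, safe_shift]
  unfold alternative
  rw [h]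

theorem nextRing_shift (G : ℤ → RingCell Q Γ) (ch : ℤ → Prop) (p x : ℤ) :
    nextRing M (fun z => G (p + z)) (fun z => ch (p + z)) x = nextRing M G ch (p + x) := by
  have h1 : (ringOutput fun z => G (p + z)).Enters =
      fun d x => (ringOutput G).Enters d (p + x) := by
    funext d x
    rw [ringOutput_shift, enters_shift]
  have h2 : (ringOutput fun z => G (p + z)).Arrives =
      fun d q x => (ringOutput G).Arrives d q (p + x) := by
    funext d q x
    rw [ringOutput_shift, arrives_shift]
  unfold nextRing
  rw [alternative_shift, h1, h2, add_assoc]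

theorem initRing_shift (w : List Γ) (st : ℤ → Prop) (p x : ℤ) :
    initRing M w (fun z => st (p + z)) x = initRing M w st (p + x) := by
  have h1 : NearestStart (fun z => st (p + z)) = fun x j => NearestStart st (p + x) j := by
    funext x j
    simp only [NearestStart, add_sub_assoc]
  unfold initRing
  rw [h1, add_assoc]

/-- The invariant of the ring: at every head, a configuration is stored from which the machine does
not accept. -/
structure RingInv (V : Snapshot Q Γ) : Prop where
  edge_used : ∀ x, V .edge x → V .used x ∧ V .used (x + 1)
  head_used : ∀ x, V.Head x → V .used x
  heads : ∀ x h, V (.head h) x →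
    ∃ c ℓ, V.Stores c ℓ x h ∧ ¬ M.AcceptsFrom (fun _ => True) (M.resolve c h)

variable {M} {G : ℤ → RingCell Q Γ}

theorem head_ringOutput_iff (x : ℤ) : (ringOutput G).Head x ↔ (G x).head ≠ none := by
  simp only [Head, ringOutput, ringSnapshot]
  rcases (G x).head with _ | ⟨q, _ | _ | _⟩ <;> simp

/-- A cell that a head arrives at holds no other head, and no other head arrives there. -/
theorem RingInv.arrives_unique (I : RingInv M (ringOutput G)) {d e : Bool} {q q' : Q} {x : ℤ}
    (h : (ringOutput G).Arrives d q x) :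
    ¬ (ringOutput G).Head x ∧ ((ringOutput G).Arrives e q' x → q' = q) := by
  obtain ⟨hp, hq, hm⟩ := h
  set V := ringOutput G with hV
  have e1 : x - sgn d + sgn d = x := by ring
  obtain ⟨c, ℓ, H, -⟩ := I.heads _ (some d) hp
  have hfree : V.Edge d (x - sgn d) → 0 < ℓ d := fun he => by
    by_contra h0
    obtain h0 : ℓ d = 0 := by omega
    exact H.ends d (by simpa [h0] using he)
  have hused : V.Edge d (x - sgn d) → V .used x := fun he => by
    have := I.edge_used _ he
    cases d
    · simpa [sgn] using this.1
    · simpa [sgn] using this.2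
  constructor
  · rcases hm with hm | hm
    · simpa [e1] using H.free d 0 (hfree hm)
    · exact fun hh => hm.1 (I.head_used x hh)
  · rintro ⟨hp', hq', hm'⟩
    by_cases hde : e = d
    · subst hde
      obtain ⟨h1, hq⟩ := hq
      obtain ⟨h2, hq'⟩ := hq'
      rw [hq] at hq'
      exact (Prod.mk.inj (Option.some.inj hq')).1.symm
    · exfalso
      obtain rfl : e = !d := by cases d <;> cases e <;> simp_all
      have e2 : x - sgn (!d) = x + sgn d := by rw [sgn_not]; ring
      rw [e2] at hp' hm'
      rcases hm with hm | hm
      · rcases hm' with hm' | hm'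
        · rw [edge_not_add] at hm'
          have h1 := hfree hm
          have h2 : 1 < ℓ d := by
            by_contra h2
            obtain h2 : ℓ d = 1 := by omega
            exact H.ends d (by simpa [h2, e1] using hm')
          refine H.free d 1 h2 (head_of_pend (d := !d) ?_)
          convert hp' using 1
          push_cast
          ring
        · exact hm'.1 (hused hm)
      · exact hm.2 hp'

theorem sub_sgn_false (x : ℤ) : x - sgn false = x + 1 :=
  sub_neg_eq_add x 1

section Next

variable {ch : ℤ → Prop} {x : ℤ}

theorem alternative_eq_some {m : Q × Γ × HeadMove} (h : alternative M G ch x = some m) :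
    ∃ q a, (G x).head = some (q, none) ∧ (G x).sym = some a ∧
      (M.g q = .existential ∧ (ch x ∧ m = (M.δ q a).1 ∨ ¬ ch x ∧ m = (M.δ q a).2) ∨
        M.g q = .universal ∧ (Safe M (ringOutput G) x ∧ m = (M.δ q a).1 ∨
          ¬ Safe M (ringOutput G) x ∧ m = (M.δ q a).2)) := by
  unfold alternative at h
  split at h
  · rename_i q a hq ha
    refine ⟨q, a, hq, ha, ?_⟩
    split at h
    · rename_i hg
      refine .inl ⟨hg, ?_⟩
      split at h <;> simp_all
    · rename_i hg
      refine .inr ⟨hg, ?_⟩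
      split at h <;> simp_all
    · simp at h
  · simp at h

theorem nextRing_sym_of_alternative {m : Q × Γ × HeadMove} (h : alternative M G ch x = some m) :
    (nextRing M G ch x).sym = some m.2.1 := by
  simp [nextRing, h]

theorem nextRing_sym_of_none (h : alternative M G ch x = none) (hx : (G x).sym ≠ none) :
    (nextRing M G ch x).sym = (G x).sym := by
  have : ¬ ∃ d, (ringOutput G).Enters d x := fun ⟨d, h⟩ => h.2.1 hx
  simp [nextRing, h, this]

theorem nextRing_sym_of_enters {d : Bool} (h : (ringOutput G).Enters d x) :
    (nextRing M G ch x).sym = some M.blank := by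
  have h1 : alternative M G ch x = none := by
    rw [Option.eq_none_iff_forall_ne_some]
    intro m hm
    obtain ⟨q, a, -, ha, -⟩ := alternative_eq_some hm
    exact h.2.1 (by simp [ringOutput, ringSnapshot, ha])
  have h2 : ∃ d, (ringOutput G).Enters d x := ⟨d, h⟩
  simp only [nextRing, h1, if_pos h2]

theorem nextRing_sym_ne_none_iff :
    (nextRing M G ch x).sym ≠ none ↔ (G x).sym ≠ none ∨ ∃ d, (ringOutput G).Enters d x := by
  cases h : alternative M G ch x with
  | some m =>
    obtain ⟨q, a, -, ha, -⟩ := alternative_eq_some h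
    simp [nextRing_sym_of_alternative h, ha]
  | none =>
    by_cases h2 : ∃ d, (ringOutput G).Enters d x
    · obtain ⟨d, h2'⟩ := h2
      simp only [nextRing_sym_of_enters h2', ne_eq, reduceCtorEq, not_false_eq_true, true_iff]
      exact .inr ⟨d, h2'⟩
    · simp [nextRing, h, h2]

theorem nextRing_edge_iff : (nextRing M G ch x).edge = true ↔
    (G x).edge = true ∨ (ringOutput G).Enters true (x + 1) ∨ (ringOutput G).Enters false x := by
  simp [nextRing]

theorem nextRing_head_of_arrives (I : RingInv M (ringOutput G)) {d : Bool} {q : Q}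
    (h : (ringOutput G).Arrives d q x) : (nextRing M G ch x).head = some (q, none) := by
  have h1 : ∃ q d, (ringOutput G).Arrives d q x := ⟨q, d, h⟩
  have h2 := (I.arrives_unique h).2 h1.choose_spec.choose_spec
  simp only [nextRing, dif_pos h1, h2]

theorem nextRing_head_of_not_arrives (h : ∀ q d, ¬ (ringOutput G).Arrives d q x) :
    (nextRing M G ch x).head = (alternative M G ch x).map fun m => (m.1, m.2.2.dir) := by
  have h1 : ¬ ∃ q d, (ringOutput G).Arrives d q x := fun ⟨q, d, h'⟩ => h q d h'
  simp only [nextRing, dif_neg h1]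

theorem nextRing_effect (I : RingInv M (ringOutput G)) {m : Q × Γ × HeadMove}
    (h : alternative M G ch x = some m) (st' ch' : ℤ → Prop) :
    (ringSnapshot (nextRing M G ch) st' ch').Effect x m := by
  obtain ⟨q, a, hq, -⟩ := alternative_eq_some h
  have h1 := nextRing_head_of_not_arrives (M := M) (ch := ch) (x := x) (G := G) fun q' d h' =>
    (I.arrives_unique (e := d) (q' := q') h').1 ((head_ringOutput_iff x).2 (by simp [hq]))
  rw [h] at h1
  refine ⟨⟨_, h1⟩, nextRing_sym_of_alternative h, ?_⟩
  cases hm : m.2.2.dir <;> simp [Sig.head, ringSnapshot, h1, hm]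

theorem enters_add_iff (V : Snapshot Q Γ) (d : Bool) :
    V.Enters d (x + sgn d) ↔ V (.pend d) x ∧ V.Vacant d x := by
  have e : x + sgn d + sgn d = x + 2 * sgn d := by ring
  rw [Enters, Vacant, add_sub_cancel_right, e]

theorem arrives_add_iff (V : Snapshot Q Γ) (d : Bool) (q : Q) :
    V.Arrives d q (x + sgn d) ↔ V (.pend d) x ∧ V (.state q) x ∧ (V.Edge d x ∨ V.Vacant d x) := by
  have e : x + sgn d + sgn d = x + 2 * sgn d := by ring
  rw [Arrives, Vacant, add_sub_cancel_right, e]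

/-- The rules of the specification are obeyed. -/
theorem RingInv.step (I : RingInv M (ringOutput G)) (st st' ch' : ℤ → Prop) (x : ℤ) :
    Step M (ringSnapshot G st ch) (ringSnapshot (nextRing M G ch) st' ch') x where
  used_mono h := nextRing_sym_ne_none_iff.2 (.inl h)
  used_new h := by
    rcases nextRing_sym_ne_none_iff.1 h with h | ⟨d, h⟩
    · exact .inl h
    · right
      have := h.1
      cases d
      · rw [sub_sgn_false] at this
        exact .inr this
      · exact .inl this
  edge_mono h := nextRing_edge_iff.2 (.inl h)
  edge_new h := by
    rcases nextRing_edge_iff.1 h with h | h | h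
    · exact .inl h
    · have := (enters_add_iff (ringOutput G) true).1 h
      exact .inr (.inl ⟨this.1, this.2.1⟩)
    · have := h.1
      rw [sub_sgn_false] at this
      exact .inr (.inr ⟨this, h.2.1⟩)
  head_new h := by
    replace h := (head_ringOutput_iff (G := nextRing M G ch) x).1 h
    by_cases ha : ∃ q d, (ringOutput G).Arrives d q x
    · obtain ⟨q, d, h1, -, h2⟩ := ha
      replace h2 := h2.imp_right And.left
      cases d
      · simp only [Edge, Bool.false_eq_true, if_false, sub_sgn_false, add_sub_cancel_right] at h1 h2
        exact .inr (.inr ⟨h1, h2⟩)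
      · exact .inr (.inl ⟨h1, h2⟩)
    · push Not at ha
      rw [nextRing_head_of_not_arrives ha] at h
      obtain ⟨m, hm⟩ := Option.ne_none_iff_exists'.1 (fun h0 => h (by rw [h0]; rfl) :
        alternative M G ch x ≠ none)
      obtain ⟨q, a, hq, -⟩ := alternative_eq_some hm
      exact .inl ⟨q, hq⟩
  ready_pend d := by
    rintro ⟨⟨q, h⟩, q', h'⟩
    simp [h] at h'
  pend_pend := by
    rintro ⟨⟨q, h⟩, q', h'⟩
    simp [h] at h'
  edge_used := I.edge_used x
  head_used := I.head_used x
  edge_enter d hp hv := by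
    have h := (enters_add_iff (ringOutput G) d).2 ⟨hp, hv⟩
    cases d
    · exact nextRing_edge_iff.2 (.inr (.inr h))
    · exact nextRing_edge_iff.2 (.inr (.inl h))
  blank hu h := by
    have : ∃ d, (ringOutput G).Enters d x := by
      rcases h with h | h
      · exact ⟨true, h.1, hu, h.2⟩
      · refine ⟨false, ?_⟩
        simp only [Enters, sgn, sub_neg_eq_add, ← sub_eq_add_neg]
        exact ⟨h.1, hu, h.2⟩
    obtain ⟨d, h⟩ := this
    have := nextRing_sym_of_enters (M := M) (ch := ch) h
    exact ⟨by simp [ringSnapshot, this], this⟩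
  persist a ha hr := by
    have h1 : alternative M G ch x = none := by
      rw [Option.eq_none_iff_forall_ne_some]
      intro m hm
      obtain ⟨q, a, hq, -⟩ := alternative_eq_some hm
      exact hr ⟨q, hq⟩
    have ha' : (G x).sym = some a := ha
    exact (nextRing_sym_of_none h1 (by simp [ha'])).trans ha'
  move d q hp hq hl := by
    have := nextRing_head_of_arrives (ch := ch) I
      ((arrives_add_iff (ringOutput G) d q).2 ⟨hp, hq, hl⟩)
    exact ⟨⟨q, this⟩, none, this⟩
  decide q a hr hq ha := by
    have hr' := hr
    obtain ⟨q', hr⟩ := hr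
    obtain ⟨h, hq⟩ := hq
    rw [hr] at hq
    obtain ⟨rfl, -⟩ := Prod.mk.inj (Option.some.inj hq)
    have ha' : (G x).sym = some a := ha
    cases hg : M.g q' with
    | accepting =>
      exfalso
      obtain ⟨c, ℓ, H, hn⟩ := I.heads x none hr'
      obtain ⟨h, hs⟩ := H.state
      rw [hr] at hs
      obtain ⟨hs, -⟩ := Prod.mk.inj (Option.some.inj hs)
      exact hn (.accepting c trivial (by rw [← hs]; exact hg))
    | rejecting => exact hr'
    | existential =>
      constructor <;> intro hc <;> refine nextRing_effect I ?_ st' ch'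
      · have hc' : ch x := hc
        simp [alternative, hr, ha', hg, hc']
      · have hc' : ¬ ch x := hc
        simp [alternative, hr, ha', hg, hc']
    | universal =>
      by_cases hc : Safe M (ringOutput G) x
      · exact .inl (nextRing_effect I (by simp [alternative, hr, ha', hg, hc]) st' ch')
      · exact .inr (nextRing_effect I (by simp [alternative, hr, ha', hg, hc]) st' ch')

theorem Snapshot.Stores.state_eq {st : ℤ → Prop} {c : TapeConfig Q Γ} {ℓ : Bool → ℕ}
    {h h' : Option Bool} {q : Q} (H : (ringSnapshot G st ch).Stores c ℓ x h)
    (hq : (G x).head = some (q, h')) : c.state = q := by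
  obtain ⟨h, hs⟩ := H.state
  rw [hq] at hs
  exact (Prod.mk.inj (Option.some.inj hs)).1.symm

theorem Snapshot.Stores.head_eq {st : ℤ → Prop} {c : TapeConfig Q Γ} {ℓ : Bool → ℕ}
    {h : Option Bool} {a : Γ} (H : (ringSnapshot G st ch).Stores c ℓ x h)
    (ha : (G x).sym = some a) : c.head = a :=
  (Option.some.inj (ha.symm.trans H.head)).symm

/-- The decision at a ready head leads to a configuration from which the machine does not accept. -/
theorem RingInv.exists_stores_of_alternative (I : RingInv M (ringOutput G))
    {m : Q × Γ × HeadMove} (h : alternative M G ch x = some m) :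
    ∃ c ℓ, (ringOutput G).Stores c ℓ x none ∧
      ¬ M.AcceptsFrom (fun _ => True) (M.applyMove c m) := by
  obtain ⟨q, a, hq, ha, hm⟩ := alternative_eq_some h
  have key : ∀ {c ℓ}, (ringOutput G).Stores c ℓ x none →
      M.succ₁ c = M.applyMove c (M.δ q a).1 ∧ M.succ₂ c = M.applyMove c (M.δ q a).2 ∧
        M.g c.state = M.g q := fun H => by
    rw [ATM.succ₁, ATM.succ₂, H.state_eq hq, H.head_eq ha]
    exact ⟨rfl, rfl, rfl⟩
  obtain ⟨c, ℓ, H, hn⟩ := I.heads x none ⟨q, hq⟩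
  obtain ⟨h1, h2, hk⟩ := key H
  rcases hm with ⟨hg, ⟨-, rfl⟩ | ⟨-, rfl⟩⟩ | ⟨hg, ⟨hs, rfl⟩ | ⟨hs, rfl⟩⟩
  · exact ⟨c, ℓ, H, fun hA => hn (.existential₁ c trivial (hk.trans hg) (h1 ▸ hA))⟩
  · exact ⟨c, ℓ, H, fun hA => hn (.existential₂ c trivial (hk.trans hg) (h2 ▸ hA))⟩
  · obtain ⟨c', ℓ', H', hn'⟩ := hs
    exact ⟨c', ℓ', H', (key H').1 ▸ hn'⟩
  -- The first alternative leads to acceptance, so the second one cannot.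
  · have hA₁ : M.AcceptsFrom (fun _ => True) (M.succ₁ c) := by
      by_contra hA
      exact hs ⟨c, ℓ, H, hA⟩
    exact ⟨c, ℓ, H, fun hA => hn (.universal c trivial (hk.trans hg) hA₁ (h2 ▸ hA))⟩

/-- The invariant is preserved: an unblocked motion carries the stored configuration along, and a
transition was chosen so as to avoid acceptance. -/
theorem RingInv.next (I : RingInv M (ringOutput G)) :
    RingInv M (ringOutput (nextRing M G ch)) := by
  have hS : ∀ x, Step M (ringSnapshot G (fun _ => False) ch) (ringOutput (nextRing M G ch)) x :=
    I.step _ _ _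
  have hV : ∀ {c ℓ y h}, (ringOutput G).Stores c ℓ y h →
      (ringSnapshot G (fun _ => False) ch).Stores c ℓ y h := fun H =>
    H.congr fun σ z h1 h2 => ringSnapshot_congr _ _ _ _ _ _ _ h1 h2
  have hmono : ∀ y, (G y).sym ≠ none → (nextRing M G ch y).sym ≠ none := fun y hy =>
    nextRing_sym_ne_none_iff.2 (.inl hy)
  have henter : ∀ d y, (ringOutput G).Enters d y → (nextRing M G ch y).sym ≠ none ∧
      (nextRing M G ch (y - sgn d)).sym ≠ none := fun d y h =>
    ⟨nextRing_sym_ne_none_iff.2 (.inr ⟨d, h⟩), hmono _ (I.head_used _ (head_of_pend h.1))⟩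
  refine ⟨fun x hx => ?_, fun x hx => ?_, fun x h hx => ?_⟩
  · rcases nextRing_edge_iff.1 hx with hx | hx | hx
    · exact (I.edge_used x hx).imp (hmono _) (hmono _)
    · have := henter _ _ hx
      simp only [sgn, add_sub_cancel_right] at this
      exact this.symm
    · have := henter _ _ hx
      simpa [sgn, ringOutput, ringSnapshot] using this
  · replace hx := (head_ringOutput_iff (G := nextRing M G ch) x).1 hx
    by_cases ha : ∃ q d, (ringOutput G).Arrives d q x
    · obtain ⟨q, d, h1, -, h2⟩ := ha
      rcases h2 with h2 | h2
      · have := I.edge_used _ h2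
        cases d
        · simp only [Bool.false_eq_true, if_false, sub_sgn_false, add_sub_cancel_right] at this
          exact hmono _ this.1
        · simp only [if_true, sgn, sub_add_cancel] at this
          exact hmono _ this.2
      · by_cases hu : (G x).sym = none
        · exact (henter d x ⟨h1, h2⟩).1
        · exact hmono x hu
    · push Not at ha
      rw [nextRing_head_of_not_arrives ha] at hx
      obtain ⟨m, hm⟩ := Option.ne_none_iff_exists'.1 (fun h0 => hx (by rw [h0]; rfl) :
        alternative M G ch x ≠ none)
      simp [ringOutput, ringSnapshot, nextRing_sym_of_alternative hm]
  · have hhead : ∃ q, (nextRing M G ch x).head = some (q, h) := by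
      cases h with
      | none => exact hx
      | some d => exact hx
    obtain ⟨q, hq⟩ := hhead
    by_cases ha : ∃ q d, (ringOutput G).Arrives d q x
    · obtain ⟨q', d, ha⟩ := ha
      rw [nextRing_head_of_arrives I ha] at hq
      obtain ⟨-, rfl⟩ := Prod.mk.inj (Option.some.inj hq)
      obtain ⟨c, ℓ, H, hn⟩ := I.heads (x - sgn d) (some d) ha.1
      have e1 : x - sgn d + sgn d = x := by ring
      have hl : (ringOutput G).Edge d (x - sgn d) ∨ (ringOutput G).Vacant d (x - sgn d) := by
        have := (arrives_add_iff (x := x - sgn d) (ringOutput G) d q').1 (by rwa [e1])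
        exact this.2.2
      have := (hV H).shift hS (by exact hl)
      rw [e1] at this
      exact ⟨_, _, this, hn⟩
    · push Not at ha
      rw [nextRing_head_of_not_arrives ha] at hq
      obtain ⟨m, hm, hmq⟩ := Option.map_eq_some_iff.1 hq
      obtain ⟨-, rfl⟩ := Prod.mk.inj hmq
      obtain ⟨c, ℓ, H, hn⟩ := I.exists_stores_of_alternative hm
      obtain ⟨q', a', mv⟩ := m
      refine ⟨_, _, (hV H).effect hS (nextRing_effect I hm _ _), ?_⟩
      rwa [← M.applyMove_eq_resolve]

end Next

end Ring

/-! ### Realizability of the specification -/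

theorem NearestStart.unique {st : ℤ → Prop} {x : ℤ} {j j' : ℕ} (h : NearestStart st x j)
    (h' : NearestStart st x j') : j = j' := by
  rcases lt_trichotomy j j' with hj | hj | hj
  · exact absurd h.1 (h'.2 j hj)
  · exact hj
  · exact absurd h'.1 (h.2 j' hj)

section InitialRing

variable {Q Γ : Type} {M : ATM Q Γ} {w : List Γ} {st : ℤ → Prop} {x : ℤ}

theorem initRing_sym {j : ℕ} {a : Γ} (h : NearestStart st x j) (ha : w[j]? = some a) :
    (initRing M w st x).sym = some a := by
  obtain ⟨hj, -⟩ := List.getElem?_eq_some_iff.1 ha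
  have h1 : ∃ j, j < w.length ∧ NearestStart st x j := ⟨j, hj, h⟩
  have h2 := h1.choose_spec.2.unique h
  simp only [initRing, dif_pos h1, h2, ha]

theorem initRing_sym_ne_none_iff : (initRing M w st x).sym ≠ none ↔
    ∃ j, j < w.length ∧ NearestStart st x j := by
  constructor
  · intro h
    by_contra hn
    simp [initRing, hn] at h
  · rintro ⟨j, hj, h⟩
    rw [initRing_sym h (List.getElem?_eq_getElem hj)]
    simp

theorem initRing_edge_iff : (initRing M w st x).edge = true ↔
    ¬ st (x + 1) ∧ ∃ j, j < w.length ∧ NearestStart st (x + 1) j := by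
  simp [initRing]

theorem initRing_head_iff : (initRing M w st x).head ≠ none ↔ st x := by
  by_cases h : st x <;> simp [initRing, h]

theorem headInit_initRing {V : Snapshot Q Γ} (hV : ∀ z, V .start z ↔ st z)
    (st' ch' : ℤ → Prop) (x : ℤ) :
    Snapshot.HeadInit M V (ringSnapshot (initRing M w st) st' ch') x := by
  by_cases h : st x
  · have h1 : (initRing M w st x).head = some (M.q₀, none) := by simp [initRing, h]
    refine .inl ⟨(hV x).2 h, ⟨_, h1⟩, ⟨_, h1⟩, fun he => ?_⟩
    have he' := (initRing_edge_iff.1 he).1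
    rw [sub_add_cancel] at he'
    exact he' h
  · exact .inr ⟨fun h' => h ((hV x).1 h'),
      fun h' => h (initRing_head_iff.1 ((head_ringOutput_iff x).1 h'))⟩

theorem cellInit_initRing {V : Snapshot Q Γ} (hV : ∀ z, V .start z ↔ st z)
    (st' ch' : ℤ → Prop) (x : ℤ) :
    Snapshot.CellInit w V (ringSnapshot (initRing M w st) st' ch') x := by
  classical
  simp only [Snapshot.CellInit, hV]
  by_cases h : ∃ j, j < w.length ∧ NearestStart st x j
  · obtain ⟨j, hj, hs⟩ := h
    have ha := List.getElem?_eq_getElem hj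
    refine .inl ⟨j, w[j], ha, hs.1, hs.2, initRing_sym_ne_none_iff.2 ⟨j, hj, hs⟩,
      initRing_sym hs ha, ?_⟩
    by_cases hx : st x
    · exact .inl hx
    · refine .inr (initRing_edge_iff.2 ?_)
      rw [sub_add_cancel]
      exact ⟨hx, j, hj, hs⟩
  · refine .inr ⟨fun i hi hs => ?_, fun hu => h (initRing_sym_ne_none_iff.1 hu)⟩
    have hex : ∃ i : ℕ, st (x - i) := ⟨i, hs⟩
    exact h ⟨Nat.find hex, (Nat.find_min' hex hs).trans_lt hi, Nat.find_spec hex,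
      fun i' hi' => Nat.find_min hex hi'⟩

/-- At every process with input `start`, the initial configuration is stored, cut off at the next
process with input `start`. -/
theorem ringInv_initRing (hw : w ≠ []) (hacc : ¬ M.Accepts w) :
    RingInv M (ringOutput (initRing M w st)) := by
  classical
  have hlen : 0 < w.length := List.length_pos_iff.2 hw
  have hstart : ∀ {z}, st z → NearestStart st z 0 := fun h => ⟨by simpa using h, by simp⟩
  refine ⟨fun x hx => ?_, fun x hx => ?_, fun x h hx => ?_⟩
  · obtain ⟨h1, j, hj, hs⟩ := initRing_edge_iff.1 hx
    refine ⟨initRing_sym_ne_none_iff.2 ?_, initRing_sym_ne_none_iff.2 ⟨j, hj, hs⟩⟩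
    cases j with
    | zero => exact absurd (by simpa using hs.1) h1
    | succ j =>
      have e : ∀ i : ℕ, x + 1 - (i + 1 : ℕ) = x - i := by intro i; push_cast; ring
      exact ⟨j, by omega, by simpa only [e] using hs.1,
        fun i hi => by simpa only [e] using hs.2 (i + 1) (by omega)⟩
  · exact initRing_sym_ne_none_iff.2
      ⟨0, hlen, hstart (initRing_head_iff.1 ((head_ringOutput_iff x).1 hx))⟩
  · have hhead : ∃ q, (initRing M w st x).head = some (q, h) := by
      cases h with
      | none => exact hx
      | some d => exact hx
    obtain ⟨q, hq⟩ := hhead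
    have hst : st x := (initRing_head_iff (M := M) (w := w)).1 (by simp [hq])
    have h1 : (initRing M w st x).head = some (M.q₀, none) := by simp [initRing, hst]
    rw [h1] at hq
    obtain ⟨-, rfl⟩ := Prod.mk.inj (Option.some.inj hq)
    obtain ⟨a, w', rfl⟩ := List.exists_cons_of_ne_nil hw
    -- The tape piece ends before the next process with input `start`.
    have hex : ∃ r : ℕ, r = w'.length ∨ st (x + r + 1) := ⟨_, .inl rfl⟩
    obtain ⟨r, hr, hmin⟩ : ∃ r : ℕ, (r = w'.length ∨ st (x + r + 1)) ∧
        ∀ i < r, ¬ (i = w'.length ∨ st (x + i + 1)) :=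
      ⟨Nat.find hex, Nat.find_spec hex, fun i hi => Nat.find_min hex hi⟩
    push Not at hmin
    have hle : r ≤ w'.length := by
      by_contra hn
      exact (hmin w'.length (by omega)).1 rfl
    have near : ∀ i : ℕ, (∀ i' < i, ¬ st (x + i' + 1)) → NearestStart st (x + i) i := by
      refine fun i hi => ⟨by simpa using hst, fun i' hi' hs => hi (i - i' - 1) (by omega) ?_⟩
      convert hs using 1
      rw [Nat.sub_sub, Nat.cast_sub (by omega)]
      push_cast
      ring
    have near' : ∀ i : ℕ, i ≤ r → NearestStart st (x + i) i := fun i hi =>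
      near i fun i' hi' => (hmin i' (by omega)).2
    refine ⟨M.initConfig (a :: w'), fun d => if d then r else 0, ?_, hacc⟩
    exact
      { status := ⟨_, h1⟩
        state := ⟨_, h1⟩
        head := initRing_sym (hstart hst) rfl
        len := by
          rintro (_ | _)
          · simp
          · simpa [ATM.initConfig, TapeConfig.side] using hle
        cell := by
          rintro (_ | _) j b hj hb
          · simp at hj
          · simp only [if_true] at hj
            have := near' (j + 1) (by omega)
            push_cast at this
            simp only [sgn, one_mul]
            exact initRing_sym this hb
        edge := by
          rintro (_ | _) j hj
          · simp at hj
          · simp only [if_true] at hj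
            have := near' (j + 1) (by omega)
            push_cast at this
            simp only [sgn, one_mul, Snapshot.Edge, if_true]
            refine initRing_edge_iff.2 ⟨(hmin j hj).2, j + 1, ?_, ?_⟩
            · simp only [List.length_cons]
              omega
            · rwa [add_assoc]
        ends := by
          rintro (_ | _) he
          · simp only [Snapshot.Edge, Bool.false_eq_true, if_false, Nat.cast_zero, mul_zero,
              add_zero] at he
            have := (initRing_edge_iff.1 he).1
            rw [sub_add_cancel] at this
            exact this hst
          · simp only [sgn, one_mul, Snapshot.Edge, if_true] at he
            obtain ⟨hn, j, hj, hs⟩ := initRing_edge_iff.1 he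
            have := near (r + 1) fun i hi => by
              rcases Nat.lt_succ_iff_lt_or_eq.1 hi with hi | rfl
              · exact (hmin i hi).2
              · exact hn
            push_cast at this
            rw [← add_assoc] at this
            have := hs.unique this
            have := hr.resolve_right hn
            simp only [List.length_cons] at hj
            omega
        free := by
          rintro (_ | _) j hj hh
          · simp at hj
          · simp only [if_true] at hj
            simp only [sgn, one_mul, ← add_assoc] at hh
            exact (hmin j hj).2 (initRing_head_iff.1 ((head_ringOutput_iff _).1 hh))
        cut := by
          rintro (_ | _) hl
          · simp [ATM.initConfig, TapeConfig.side] at hl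
          · have hl' : r < w'.length := hl
            simp only [sgn, one_mul, if_true, ← add_assoc]
            exact initRing_sym_ne_none_iff.2 ⟨0, hlen, hstart (hr.resolve_left hl'.ne)⟩ }

end InitialRing

section Implementation

variable {n : ℕ} [NeZero n] {m s : ℕ}

/-- The own inputs of the processes, which are indexed relative to a process that reads `X`. -/
def ownInput (X : Set (Fin 2 × Fin n)) (y : Fin 2) (z : ℤ) : Prop := (y, modIndex n (-z)) ∈ X

theorem ownInput_localInput (X : Set (Fin 2 × Fin n)) (p : ℤ) :
    ownInput (localInput (modIndex n p) X) = fun y z => ownInput X y (p + z) := by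
  funext y z
  simp only [ownInput, localInput, Set.mem_ofPred_eq, modIndex_sub]
  rw [show -z - p = -(p + z) by ring]

/-- Every process keeps track of the contents of the ring, relative to its own position. All
processes can do so, since each of them reads all inputs. -/
noncomputable def implementation (n : ℕ) [NeZero n] (M : ATM (Fin m) (Fin s)) (w : List (Fin s)) :
    MooreMachine (Set (Fin 2 × Fin n)) (Set (Fin (5 + m + s))) where
  State := Option (Fin n → RingCell (Fin m) (Fin s))
  finite := inferInstance
  init := none
  step
    | none, X => some fun j => initRing M w (ownInput X 0) (j : ℕ)
    | some r, X => some fun j => nextRing M (fun z => r (modIndex n z)) (ownInput X 1) (j : ℕ)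
  out
    | none => ∅
    | some r => {o | ∃ σ : Sig (Fin m) (Fin s), σ.index = .inr o ∧
        ringOutput (fun z => r (modIndex n z)) σ 0}

variable {M : ATM (Fin m) (Fin s)} {w : List (Fin s)}

/-- After the inputs `h`, the contents of the ring are `G`. -/
structure Contents (M : ATM (Fin m) (Fin s)) (w : List (Fin s)) (h : List (Set (Fin 2 × Fin n)))
    (G : ℤ → RingCell (Fin m) (Fin s)) : Prop where
  periodic : ∀ z z' : ℤ, (n : ℤ) ∣ z - z' → G z = G z'
  state : ∀ p : ℤ, procState (implementation n M w) (modIndex n p) h =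
    (some fun j : Fin n => G (p + (j : ℕ)) : Option (Fin n → RingCell (Fin m) (Fin s)))

theorem ownInput_periodic (X : Set (Fin 2 × Fin n)) (y : Fin 2) {a : ℤ} (ha : (n : ℤ) ∣ a) :
    (fun z => ownInput X y (a + z)) = ownInput X y := by
  funext z
  have : modIndex n (-(a + z)) = modIndex n (-z) := by
    rw [modIndex_eq_iff, show -(a + z) - -z = -a by ring]
    exact (dvd_neg).2 ha
  simp only [ownInput, this]

theorem Contents.unroll {h : List (Set (Fin 2 × Fin n))} {G : ℤ → RingCell (Fin m) (Fin s)}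
    (H : Contents M w h G) (p : ℤ) :
    (fun z => G (p + ((modIndex n z : Fin n) : ℕ))) = fun z => G (p + z) := by
  funext z
  refine H.periodic _ _ ?_
  rw [modIndex_val, add_sub_add_left_eq_sub]
  exact Int.dvd_sub_self_of_emod_eq rfl

theorem contents_singleton (X : Set (Fin 2 × Fin n)) :
    Contents M w [X] (initRing M w (ownInput X 0)) where
  periodic z z' hz := by
    have := initRing_shift M w (ownInput X 0) (z - z') z'
    rwa [ownInput_periodic X 0 hz, sub_add_cancel, eq_comm] at this
  state p := by
    simp only [procState, List.foldl_cons, List.foldl_nil, implementation, ownInput_localInput,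
      initRing_shift]

theorem Contents.append {h : List (Set (Fin 2 × Fin n))} {G : ℤ → RingCell (Fin m) (Fin s)}
    (H : Contents M w h G) (X : Set (Fin 2 × Fin n)) :
    Contents M w (h ++ [X]) (nextRing M G (ownInput X 1)) where
  periodic z z' hz := by
    have h1 := nextRing_shift M G (ownInput X 1) (z - z') z'
    have h2 : (fun u => G (z - z' + u)) = G := funext fun u => H.periodic _ _ (by simpa using hz)
    rwa [ownInput_periodic X 1 hz, h2, sub_add_cancel, eq_comm] at h1
  state p := by
    have h1 : procState (implementation n M w) (modIndex n p) (h ++ [X]) =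
        (implementation n M w).step (procState (implementation n M w) (modIndex n p) h)
          (localInput (modIndex n p) X) := by
      simp only [procState, List.foldl_concat]
    rw [h1, H.state p]
    simp only [implementation, ownInput_localInput, H.unroll, nextRing_shift]

theorem Contents.snapshot_eq {h : List (Set (Fin 2 × Fin n))} {G : ℤ → RingCell (Fin m) (Fin s)}
    (H : Contents M w h G) (X : Set (Fin 2 × Fin n)) :
    snapshot (implementation n M w) h X = ringSnapshot G (ownInput X 0) (ownInput X 1) := by
  have key : ∀ σ o z, Sig.index σ = .inr o →
      (o ∈ (implementation n M w).out (procState (implementation n M w) (modIndex n z) h) ↔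
        ringOutput G σ z) := by
    intro σ o z hσ
    rw [H.state z]
    simp only [implementation, Set.mem_ofPred_eq, H.unroll, ringOutput_shift]
    simp only [Snapshot.shift, add_zero]
    constructor
    · rintro ⟨σ', hσ', h⟩
      rwa [← Sig.index_injective (hσ'.trans hσ.symm)]
    · exact fun h => ⟨σ, hσ, h⟩
  funext σ z
  refine propext ?_
  rcases σ with _ | _ | _ | _ | _ | (_ | _) | q | a
  exacts [Iff.rfl, Iff.rfl, key .used _ z rfl, key .edge _ z rfl, key .ready _ z rfl,
    key (.pend false) _ z rfl, key (.pend true) _ z rfl, key (.state q) _ z rfl,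
    key (.sym a) _ z rfl]

/-- If the machine does not accept the word, the specification is realizable on every ring. -/
theorem realizable_of_not_accepts (n : ℕ) [NeZero n] {x : AcceptanceInstance} (hw : x.word ≠ [])
    (hacc : ¬ x.machine.Accepts x.word) : (reductionSpec x).Realizable n := by
  refine ⟨implementation n x.machine x.word,
    (satisfies_iff x (implementation n x.machine x.word)).2 ⟨⟨fun X X' i => ?_, fun X X' i => ?_⟩,
      fun h hne X X' i => ?_⟩⟩
  · rw [(contents_singleton X).snapshot_eq]
    exact headInit_initRing (fun _ => Iff.rfl) _ _ i
  · rw [(contents_singleton X).snapshot_eq]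
    exact cellInit_initRing (fun _ => Iff.rfl) _ _ i
  · have inv : ∃ G, Contents x.machine x.word h G ∧ RingInv x.machine (ringOutput G) := by
      clear X X' i
      induction h using List.reverseRecOn with
      | nil => exact absurd rfl hne
      | append_singleton h X ih =>
        rcases eq_or_ne h [] with rfl | hh
        · exact ⟨_, contents_singleton X, ringInv_initRing hw hacc⟩
        · obtain ⟨G, H, I⟩ := ih hh
          exact ⟨_, H.append X, I.next⟩
    obtain ⟨G, H, I⟩ := inv
    rw [H.snapshot_eq, (H.append X).snapshot_eq]
    exact I.step _ _ _ i

end Implementation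

theorem realizable_iff_not_accepts (x : AcceptanceInstance) (f : ℕ → ℕ) (n : ℕ) [NeZero n]
    (hw : x.word ≠ []) (hf : x.machine.IsSpaceBounded f) (hn : n = f x.word.length) :
    (reductionSpec x).Realizable n ↔ ¬ x.machine.Accepts x.word :=
  ⟨fun hr hacc => not_realizable_of_acceptsInSpace hw (hn ▸ hf x.word x.word_mem hacc) hr,
    realizable_of_not_accepts n hw⟩

/-! ### Memory and basic programs of the reduction -/

namespace StackCmd

section Block

variable {K : Type} {Γ : K → Type} [DecidableEq K]

/-- Sequential composition. -/
def block : List (StackCmd Γ) → StackCmd Γ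
  | [] => skip
  | c :: l => seq c (block l)

/-- Moves the contents of stack `k`, translated by `e`, to stack `k'`. -/
def pour (k k' : K) (e : Γ k → Γ k') : StackCmd Γ :=
  loop k Option.isSome (pop k fun o => o.elim skip fun a => push k' (e a))

theorem RunsIn.skip (S : ∀ k, List (Γ k)) : RunsIn skip S S 1 := ⟨1, le_rfl, .skip S⟩

theorem RunsIn.push (k : K) (a : Γ k) (S : ∀ k, List (Γ k)) :
    RunsIn (push k a) S (Function.update S k (a :: S k)) 1 := ⟨1, le_rfl, .push k a S⟩

theorem RunsIn.loop_done {k : K} {p : Option (Γ k) → Bool} {c : StackCmd Γ}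
    {S : ∀ k, List (Γ k)} (h : p (S k).head? = false) : RunsIn (StackCmd.loop k p c) S S 1 :=
  ⟨1, le_rfl, .loop_done h⟩

theorem RunsIn.loop_step {k : K} {p : Option (Γ k) → Bool} {c : StackCmd Γ}
    {S S₁ S₂ : ∀ k, List (Γ k)} {B₁ B₂ : ℕ} (h : p (S k).head? = true)
    (h₁ : RunsIn c S S₁ B₁) (h₂ : RunsIn (StackCmd.loop k p c) S₁ S₂ B₂) :
    RunsIn (StackCmd.loop k p c) S S₂ (B₁ + B₂ + 1) :=
  let ⟨_, ht₁, hx₁⟩ := h₁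
  let ⟨_, ht₂, hx₂⟩ := h₂
  ⟨_, by omega, .loop_step h hx₁ hx₂⟩

theorem RunsIn.pour {k k' : K} (h : k ≠ k') (e : Γ k → Γ k') (l : List (Γ k))
    (S : ∀ k, List (Γ k)) (hS : S k = l) :
    RunsIn (pour k k' e) S (Function.update (Function.update S k []) k' ((l.map e).reverse ++ S k'))
      (3 * l.length + 1) := by
  induction l generalizing S with
  | nil =>
    have e1 : Function.update (Function.update S k []) k' (([].map e).reverse ++ S k') = S := by
      have e0 : Function.update S k [] = S := by rw [← hS, Function.update_eq_self]
      rw [e0]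
      exact Function.update_eq_self k' S
    rw [e1]
    exact .loop_done (by rw [hS]; rfl)
  | cons a l ih =>
    set S₁ := Function.update (Function.update S k l) k' (e a :: S k') with hS₁
    have h1 : RunsIn (StackCmd.pop k fun o => o.elim StackCmd.skip fun a =>
        StackCmd.push k' (e a)) S S₁ 2 := by
      refine RunsIn.pop ?_
      have := RunsIn.push k' (e a) (Function.update S k l)
      rw [Function.update_of_ne h.symm] at this
      rw [hS]
      exact this
    have h2 := ih S₁ (by rw [hS₁, Function.update_of_ne h, Function.update_self])
    have e2 : Function.update (Function.update S₁ k []) k' ((l.map e).reverse ++ S₁ k') =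
        Function.update (Function.update S k []) k' (((a :: l).map e).reverse ++ S k') := by
      funext j
      by_cases hj : j = k'
      · subst hj
        simp [hS₁]
      · by_cases hk : j = k
        · subst hk
          simp [hj]
        · simp [hS₁, hj, hk]
    rw [e2] at h2
    refine (RunsIn.loop_step (by rw [hS]; rfl) h1 h2).mono ?_
    simp only [List.length_cons]
    omega

end Block

end StackCmd

namespace Reduction

open StackCmd

/-- The names of the counters. `tmp` is auxiliary; `states` and `symbols` are the numbers of states
and symbols; `rows` is the number of rows of the transition table still to be read; `q` is the row,
and `a` the column and later the position in the word; the others hold a state or a symbol that has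
been read. -/
inductive Counter : Type
  | tmp
  | rows
  | states
  | symbols
  | q
  | a
  | q₁
  | a₁
  | q₂
  | a₂
  deriving DecidableEq

instance : Fintype Counter :=
  Fintype.ofList [.tmp, .rows, .states, .symbols, .q, .a, .q₁, .a₁, .q₂, .a₂] fun c => by
    cases c <;> decide

/-- The stacks of the machine: the input, the output in reverse, the output, the types of the states
(in reverse, and in order), and the counters in unary. -/
inductive Store : Type
  | inp
  | out
  | rev
  | ktmp
  | kinds
  | cnt (c : Counter)
  deriving DecidableEq, Fintype

/-- The alphabets of the stacks. -/
def Alphabet : Store → Type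
  | .inp => Bool
  | .out => FormulaToken
  | .rev => FormulaToken
  | .ktmp => StateKind
  | .kinds => StateKind
  | .cnt _ => Unit

instance : Fintype FormulaToken :=
  Fintype.ofList [.one, .pos, .negative, .inp, .out, .neg, .or, .and, .next, .globally,
    .eventually, .untl] fun c => by cases c <;> decide

instance : Fintype StateKind :=
  Fintype.ofList [.accepting, .rejecting, .existential, .universal] fun c => by cases c <;> decide

instance : ∀ k, Fintype (Alphabet k)
  | .inp => inferInstanceAs (Fintype Bool)
  | .out => inferInstanceAs (Fintype FormulaToken)
  | .rev => inferInstanceAs (Fintype FormulaToken)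
  | .ktmp => inferInstanceAs (Fintype StateKind)
  | .kinds => inferInstanceAs (Fintype StateKind)
  | .cnt _ => inferInstanceAs (Fintype Unit)

/-- The contents of the stacks. -/
structure Mem : Type where
  inp : List Bool := []
  out : List FormulaToken := []
  rev : List FormulaToken := []
  ktmp : List StateKind := []
  kinds : List StateKind := []
  tmp : ℕ := 0
  rows : ℕ := 0
  states : ℕ := 0
  symbols : ℕ := 0
  q : ℕ := 0
  a : ℕ := 0
  q₁ : ℕ := 0
  a₁ : ℕ := 0
  q₂ : ℕ := 0
  a₂ : ℕ := 0

namespace Mem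

/-- The value of a counter. -/
def get (S : Mem) : Counter → ℕ
  | .tmp => S.tmp
  | .rows => S.rows
  | .states => S.states
  | .symbols => S.symbols
  | .q => S.q
  | .a => S.a
  | .q₁ => S.q₁
  | .a₁ => S.a₁
  | .q₂ => S.q₂
  | .a₂ => S.a₂

/-- The memory after setting a counter. -/
def set (S : Mem) (c : Counter) (v : ℕ) : Mem :=
  match c with
  | .tmp => { S with tmp := v }
  | .rows => { S with rows := v }
  | .states => { S with states := v }
  | .symbols => { S with symbols := v }
  | .q => { S with q := v }
  | .a => { S with a := v }
  | .q₁ => { S with q₁ := v }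
  | .a₁ => { S with a₁ := v }
  | .q₂ => { S with q₂ := v }
  | .a₂ => { S with a₂ := v }

/-- The memory as a family of stacks. -/
def contents (S : Mem) : ∀ k, List (Alphabet k)
  | .inp => S.inp
  | .out => S.out
  | .rev => S.rev
  | .ktmp => S.ktmp
  | .kinds => S.kinds
  | .cnt c => List.replicate (S.get c) ()

theorem get_set_self (S : Mem) (c : Counter) (v : ℕ) : (S.set c v).get c = v := by
  cases c <;> rfl

theorem get_set_of_ne (S : Mem) {c d : Counter} (h : d ≠ c) (v : ℕ) :
    (S.set c v).get d = S.get d := by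
  cases c <;> cases d <;> first | rfl | exact absurd rfl h

theorem set_get (S : Mem) (c : Counter) : S.set c (S.get c) = S := by
  cases c <;> rfl

theorem set_set (S : Mem) (c : Counter) (v w : ℕ) : (S.set c v).set c w = S.set c w := by
  cases c <;> rfl

theorem set_comm (S : Mem) {c d : Counter} (h : d ≠ c) (v w : ℕ) :
    (S.set c v).set d w = (S.set d w).set c v := by
  cases c <;> cases d <;> first | rfl | exact absurd rfl h

theorem contents_set (S : Mem) (c : Counter) (v : ℕ) :
    (S.set c v).contents = Function.update S.contents (.cnt c) (List.replicate v ()) := by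
  funext k
  by_cases h : k = .cnt c
  · subst h
    rw [Function.update_self]
    exact congrArg (fun n => List.replicate n ()) (S.get_set_self c v)
  · rw [Function.update_of_ne h]
    cases k
    case cnt d =>
      exact congrArg (fun n => List.replicate n ())
        (S.get_set_of_ne (fun hd => h (congrArg _ hd)) v)
    all_goals cases c <;> rfl

end Mem

/-- The programs over these stacks. -/
abbrev Cmd : Type := StackCmd Alphabet

/-- The program `c` transforms the memory `S` into `S'` in at most `B` steps. -/
def Runs (c : Cmd) (S S' : Mem) (B : ℕ) : Prop := RunsIn c S.contents S'.contents B

namespace Runs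

theorem mono {c : Cmd} {S S' : Mem} {B B' : ℕ} (h : Runs c S S' B) (hB : B ≤ B') :
    Runs c S S' B' := RunsIn.mono h hB

theorem nil (S : Mem) : Runs (block []) S S 1 := RunsIn.skip _

theorem cons {c : Cmd} {l : List Cmd} {S S₁ S₂ : Mem} {B₁ B₂ : ℕ} (h₁ : Runs c S S₁ B₁)
    (h₂ : Runs (block l) S₁ S₂ B₂) : Runs (block (c :: l)) S S₂ (B₁ + B₂) := RunsIn.seq h₁ h₂

theorem push_out (t : FormulaToken) (S : Mem) :
    Runs (push (Γ := Alphabet) .out t) S { S with out := t :: S.out } 1 := by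
  refine Eq.subst (motive := fun s => RunsIn _ S.contents s 1) ?_ (RunsIn.push _ _ _)
  funext k
  cases k <;> rfl

theorem push_ktmp (t : StateKind) (S : Mem) :
    Runs (push (Γ := Alphabet) .ktmp t) S { S with ktmp := t :: S.ktmp } 1 := by
  refine Eq.subst (motive := fun s => RunsIn _ S.contents s 1) ?_ (RunsIn.push _ _ _)
  funext k
  cases k <;> rfl

theorem push_cnt (c : Counter) (S : Mem) :
    Runs (push (Γ := Alphabet) (.cnt c) ()) S (S.set c (S.get c + 1)) 1 := by
  refine Eq.subst (motive := fun s => RunsIn _ S.contents s 1) ?_ (RunsIn.push _ _ _)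
  rw [Mem.contents_set]
  rfl

theorem pop_inp {f : Option Bool → Cmd} {S S' : Mem} {b : Bool} {l : List Bool} {B : ℕ}
    (h : S.inp = b :: l) (hf : Runs (f (some b)) { S with inp := l } S' B) :
    Runs (pop (Γ := Alphabet) .inp f) S S' (B + 1) := by
  refine RunsIn.pop ?_
  have e1 : (S.contents .inp).head? = some b := by simp only [Mem.contents, h]; rfl
  have e2 : Function.update S.contents .inp (S.contents .inp).tail =
      Mem.contents { S with inp := l } := by
    funext k
    cases k <;> first | rfl | (simp only [Mem.contents, h]; rfl)
  rw [e1, e2]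
  exact hf

theorem pop_kinds {f : Option StateKind → Cmd} {S S' : Mem} {b : StateKind} {l : List StateKind}
    {B : ℕ} (h : S.kinds = b :: l) (hf : Runs (f (some b)) { S with kinds := l } S' B) :
    Runs (pop (Γ := Alphabet) .kinds f) S S' (B + 1) := by
  refine RunsIn.pop ?_
  have e1 : (S.contents .kinds).head? = some b := by simp only [Mem.contents, h]; rfl
  have e2 : Function.update S.contents .kinds (S.contents .kinds).tail =
      Mem.contents { S with kinds := l } := by
    funext k
    cases k <;> first | rfl | (simp only [Mem.contents, h]; rfl)
  rw [e1, e2]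
  exact hf

theorem pop_cnt {c : Counter} {f : Option Unit → Cmd} {S S' : Mem} {n B : ℕ}
    (h : S.get c = n + 1) (hf : Runs (f (some ())) (S.set c n) S' B) :
    Runs (pop (Γ := Alphabet) (.cnt c) f) S S' (B + 1) := by
  refine RunsIn.pop ?_
  have e0 : S.contents (.cnt c) = List.replicate (n + 1) () := by
    rw [← h]
    rfl
  have e2 : Function.update S.contents (.cnt c) (S.contents (.cnt c)).tail = (S.set c n).contents := by
    rw [e0, Mem.contents_set]
    rfl
  rw [e2, e0]
  exact hf

end Runs

/-- Repeats `body`, decrementing the counter `c` before and incrementing the counter `d` after each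
repetition, until `c` is zero. -/
def transfer (c d : Counter) (body : Cmd) : Cmd :=
  loop (.cnt c) Option.isSome
    (pop (.cnt c) fun _ => block [body, push (Γ := Alphabet) (.cnt d) ()])

/-- Sets a counter to zero. -/
def clear (c : Counter) : Cmd := loop (.cnt c) Option.isSome (pop (.cnt c) fun _ => skip)

/-- Reads a number in unary into the counter `c`. -/
def readUnary (c : Counter) : Cmd :=
  block [loop (Γ := Alphabet) .inp (fun o : Option Bool => o == some true)
      (pop .inp fun _ => push (Γ := Alphabet) (.cnt c) ()),
    pop .inp fun _ => skip]

namespace Runs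

theorem transfer_done {c d : Counter} {body : Cmd} {S : Mem} (h : S.get c = 0) :
    Runs (transfer c d body) S S 1 := by
  refine RunsIn.loop_done ?_
  simp only [Mem.contents, h]
  rfl

theorem transfer_step {c d : Counter} {body : Cmd} {S S₁ S₂ : Mem} {n B₁ B₂ : ℕ}
    (h : S.get c = n + 1) (h₁ : Runs body (S.set c n) S₁ B₁)
    (h₂ : Runs (transfer c d body) (S₁.set d (S₁.get d + 1)) S₂ B₂) :
    Runs (transfer c d body) S S₂ (B₁ + B₂ + 4) := by
  have h3 := pop_cnt (f := fun _ => block [body, push (Γ := Alphabet) (.cnt d) ()]) h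
    (h₁.cons ((push_cnt d S₁).cons (.nil _)))
  refine mono (B := _ + B₂ + 1) (RunsIn.loop_step ?_ h3 h₂) (by omega)
  simp only [Mem.contents, h]
  rfl

/-- A transfer that performs `n` repetitions, the `j`-th of them leading from `T j` to `T (j + 1)`
when the two counters of the transfer are disregarded. -/
theorem transfer {c d : Counter} (hcd : c ≠ d) {body : Cmd} (T : ℕ → Mem) (n B : ℕ)
    (h : ∀ j < n, Runs body (((T j).set c (n - 1 - j)).set d j)
      (((T (j + 1)).set c (n - 1 - j)).set d j) B) :
    Runs (transfer c d body) (((T 0).set c n).set d 0) (((T n).set c 0).set d n)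
      (n * (B + 4) + 1) := by
  have key : ∀ i ≤ n, Runs (Reduction.transfer c d body) (((T (n - i)).set c i).set d (n - i))
      (((T n).set c 0).set d n) (i * (B + 4) + 1) := by
    intro i
    induction i with
    | zero =>
      intro _
      refine mono (transfer_done ?_) (by omega)
      rw [Mem.get_set_of_ne _ hcd, Mem.get_set_self]
    | succ i ih =>
      intro hi
      have h1 := h (n - (i + 1)) (by omega)
      have e1 : n - 1 - (n - (i + 1)) = i := by omega
      have e2 : n - (i + 1) + 1 = n - i := by omega
      rw [e1, e2] at h1
      refine mono (B := B + (i * (B + 4) + 1) + 4)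
        (transfer_step (n := i) (S₁ := ((T (n - i)).set c i).set d (n - (i + 1))) ?_ ?_ ?_) ?_
      · rw [Mem.get_set_of_ne _ hcd, Mem.get_set_self]
      · rw [Mem.set_comm _ hcd, Mem.set_set]
        exact h1
      · rw [Mem.get_set_self, Mem.set_set, e2]
        exact ih (by omega)
      · rw [Nat.add_mul]
        omega
  simpa using key n le_rfl

theorem clear (c : Counter) (S : Mem) : Runs (clear c) S (S.set c 0) (3 * S.get c + 1) := by
  generalize hn : S.get c = n
  induction n generalizing S with
  | zero =>
    have : S.set c 0 = S := by rw [← hn, Mem.set_get]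
    rw [this]
    refine RunsIn.loop_done ?_
    simp only [Mem.contents, hn]
    rfl
  | succ n ih =>
    have h1 := pop_cnt (f := fun _ => skip) hn (RunsIn.skip (S.set c n).contents)
    have h2 := ih (S.set c n) (Mem.get_set_self ..)
    rw [Mem.set_set] at h2
    refine mono (B := 1 + 1 + _ + 1) (RunsIn.loop_step ?_ h1 h2) (by omega)
    simp only [Mem.contents, hn]
    rfl

theorem readUnary (c : Counter) {S : Mem} {n : ℕ} {l : List Bool} (h : S.inp = unary n ++ l)
    (h0 : S.get c = 0) :
    Runs (readUnary c) S (({ S with inp := l } : Mem).set c n) (3 * n + 4) := by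
  have key : ∀ n l S, S.inp = unary n ++ l →
      Runs (loop (Γ := Alphabet) .inp (fun o : Option Bool => o == some true)
        (StackCmd.pop .inp fun _ => StackCmd.push (Γ := Alphabet) (.cnt c) ()))
        S (({ S with inp := false :: l } : Mem).set c (S.get c + n)) (3 * n + 1) := by
    intro n l
    induction n with
    | zero =>
      intro S h
      have h' : S.inp = false :: l := h
      have e1 : (({ S with inp := false :: l } : Mem).set c (S.get c + 0)) = S := by
        rw [← h']
        exact S.set_get c
      rw [e1]
      refine RunsIn.loop_done ?_
      simp only [Mem.contents, h']
      rfl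
    | succ n ih =>
      intro S h
      have h' : S.inp = true :: (unary n ++ l) := h
      have h1 := pop_inp (f := fun _ => StackCmd.push (Γ := Alphabet) (.cnt c) ()) h'
        (push_cnt c _)
      have h2 := ih _ (show (Mem.set { S with inp := unary n ++ l } c
        (Mem.get { S with inp := unary n ++ l } c + 1)).inp = _ by cases c <;> rfl)
      have e1 : ({ (Mem.set { S with inp := unary n ++ l } c
          (Mem.get { S with inp := unary n ++ l } c + 1)) with inp := false :: l } : Mem).set c
            ((Mem.set { S with inp := unary n ++ l } c
              (Mem.get { S with inp := unary n ++ l } c + 1)).get c + n) =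
          ({ S with inp := false :: l } : Mem).set c (S.get c + (n + 1)) := by
        rw [Mem.get_set_self, Nat.add_assoc, Nat.add_comm 1 n]
        cases c <;> rfl
      rw [e1] at h2
      refine mono (B := 1 + 1 + _ + 1) (RunsIn.loop_step ?_ h1 h2) (by omega)
      simp only [Mem.contents, h']
      rfl
  have h1 := key n l S h
  rw [h0, Nat.zero_add] at h1
  have h2 := pop_inp (f := fun _ => skip)
    (S := (({ S with inp := false :: l } : Mem).set c n)) (b := false) (l := l)
    (by cases c <;> rfl) (RunsIn.skip _)
  have e1 : ({ (({ S with inp := false :: l } : Mem).set c n) with inp := l } : Mem) =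
      ({ S with inp := l } : Mem).set c n := by
    cases c <;> rfl
  rw [e1] at h2
  exact (h1.cons (cons h2 (.nil _))).mono (by omega)

end Runs

/-- Appends the value of a counter in unary, without an end marker, to the output. -/
def emitCounter (c : Counter) : Cmd :=
  block [transfer c .tmp (push (Γ := Alphabet) .out .one), transfer .tmp c skip]

/-- Appends the given tokens to the output. -/
def emitTokens : List FormulaToken → Cmd
  | [] => skip
  | t :: l => seq (push (Γ := Alphabet) .out t) (emitTokens l)

namespace Runs

theorem emitCounter (c : Counter) {S : Mem} (h : S.tmp = 0) :
    Runs (emitCounter c) S { S with out := List.replicate (S.get c) .one ++ S.out }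
      (10 * S.get c + 3) := by
  by_cases hc : c = .tmp
  · subst hc
    have h0 : S.get .tmp = 0 := h
    rw [h0]
    exact cons (B₁ := 1) (transfer_done h0) (cons (B₁ := 1) (transfer_done h0) (.nil _))
  · set n := S.get c with hn
    set T : ℕ → Mem := fun j => { S with out := List.replicate j .one ++ S.out } with hT
    have e0 : ((T 0).set c n).set .tmp 0 = S := by
      have h1 : S.set .tmp 0 = S := by rw [← h]; exact S.set_get .tmp
      change (S.set c (S.get c)).set .tmp 0 = S
      rw [Mem.set_get, h1]
    have e1 : ((T n).set .tmp 0).set c n = T n := by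
      have hg : (T n).get c = n := by rw [hn]; cases c <;> rfl
      have h1 : (T n).set .tmp 0 = T n := by rw [← h]; exact (T n).set_get .tmp
      rw [h1]
      exact hg ▸ (T n).set_get c
    have h1 := transfer hc (body := StackCmd.push (Γ := Alphabet) .out .one) T n 1 fun j _ => by
      refine Eq.subst (motive := fun s => Runs _ _ s 1) ?_ (push_out _ _)
      cases c <;> rfl
    have h2 := transfer (Ne.symm hc) (body := skip) (fun _ => T n) n 1 fun j _ => RunsIn.skip _
    rw [e0] at h1
    rw [Mem.set_comm _ hc, e1] at h2
    exact (cons h1 (cons h2 (.nil _))).mono (by omega)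

theorem emitTokens (l : List FormulaToken) (S : Mem) :
    Runs (emitTokens l) S { S with out := l.reverse ++ S.out } (l.length + 1) := by
  induction l generalizing S with
  | nil => exact RunsIn.skip _
  | cons t l ih =>
    have h1 := RunsIn.seq (push_out t S) (ih _)
    rw [List.reverse_cons, List.append_assoc, List.length_cons]
    exact mono (B := _ + _) h1 (by omega)

theorem pour_kinds (S : Mem) :
    Runs (pour (Γ := Alphabet) .ktmp .kinds fun t => t) S
      { S with ktmp := [], kinds := S.ktmp.reverse ++ S.kinds } (3 * S.ktmp.length + 1) := by
  refine Eq.subst (motive := fun s => RunsIn _ S.contents s _) ?_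
    (RunsIn.pour (Γ := Alphabet) (k := .ktmp) (k' := .kinds) (by decide) (fun t => t) S.ktmp _ rfl)
  funext k
  cases k
  case kinds => exact congrArg (fun l => l.reverse ++ S.kinds) (List.map_id' S.ktmp)
  all_goals rfl

theorem pour_rev (S : Mem) :
    Runs (pour (Γ := Alphabet) .out .rev fun t => t) S
      { S with out := [], rev := S.out.reverse ++ S.rev } (3 * S.out.length + 1) := by
  refine Eq.subst (motive := fun s => RunsIn _ S.contents s _) ?_
    (RunsIn.pour (Γ := Alphabet) (k := .out) (k' := .rev) (by decide) (fun t => t) S.out _ rfl)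
  funext k
  cases k
  case rev => exact congrArg (fun l => l.reverse ++ S.rev) (List.map_id' S.out)
  all_goals rfl

end Runs

end Reduction

/-! ### Output of formulas -/

/-- The first tokens of a proposition, up to a fixed part of its number. -/
def Sig.lead {Q Γ : Type} : Sig Q Γ → List FormulaToken
  | start => [.inp]
  | choice => [.inp, .one]
  | used => [.out]
  | edge => [.out, .one]
  | ready => [.out, .one, .one]
  | pend false => [.out, .one, .one, .one]
  | pend true => [.out, .one, .one, .one, .one]
  | state _ => [.out, .one, .one, .one, .one, .one]
  | sym _ => [.out, .one, .one, .one, .one, .one]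

/-- The remaining part of the number of a proposition, for `m` states. -/
def Sig.offset (m : ℕ) : Sig ℕ ℕ → ℕ
  | state q => q
  | sym a => m + a
  | _ => 0

/-- The tokens of a proposition, for `m` states, when states and symbols are natural numbers. -/
def natTokens (m : ℕ) (p : Sig ℕ ℕ × ℤ) : List FormulaToken :=
  p.1.lead ++ (List.replicate (p.1.offset m) .one ++ .pos :: tokenInt p.2)

theorem tokenProp_index {m s : ℕ} (σ : Sig (Fin m) (Fin s)) (z : ℤ) :
    tokenProp (σ.index, z) = natTokens m (σ.map Fin.val Fin.val, z) := by
  rcases σ with _ | _ | _ | _ | _ | (_ | _) | q | a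
  case state | sym =>
    simp only [Sig.index, tokenProp, tokenNat, natTokens, Sig.map, Sig.lead, Sig.offset,
      Nat.add_assoc, List.replicate_add 5, List.append_assoc]
    rfl
  all_goals rfl

namespace LTL

variable {α β : Type}

theorem tokens_map (r : α → β) (e : β → List FormulaToken) (φ : LTL α) :
    (φ.map r).tokens e = φ.tokens fun p => e (r p) := by
  induction φ <;> simp_all [map, tokens]

theorem tokens_congr {e e' : α → List FormulaToken} (h : ∀ p, e p = e' p) (φ : LTL α) :
    φ.tokens e = φ.tokens e' := by
  rw [funext h]

theorem tokens_bigAnd (e : α → List FormulaToken) (ψ : LTL α) (l : List (LTL α)) :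
    (bigAnd ψ l).tokens e = (l.flatMap fun φ => .and :: φ.tokens e) ++ ψ.tokens e := by
  induction l with
  | nil => rfl
  | cons φ l ih =>
    simp only [bigAnd, List.foldr_cons, tokens, List.flatMap_cons] at ih ⊢
    rw [ih]
    simp

end LTL

/-- Renaming of the states and the symbols in a formula. -/
def LTL.rename {Q Γ Q' Γ' : Type} (f : Q → Q') (g : Γ → Γ') (φ : LTL (Sig Q Γ × ℤ)) :
    LTL (Sig Q' Γ' × ℤ) := φ.map (Prod.map (Sig.map f g) id)

section Rename

variable {Q Γ Q' Γ' : Type} (f : Q → Q') (g : Γ → Γ')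

theorem rename_frameRules : (frameRules : List (LTL (Sig Q Γ × ℤ))).map (LTL.rename f g) =
    frameRules := rfl

theorem rename_blankRule (b : Γ) : (blankRule b : LTL (Sig Q Γ × ℤ)).rename f g = blankRule (g b) :=
  rfl

theorem rename_headInit (q : Q) : (headInit q : LTL (Sig Q Γ × ℤ)).rename f g = headInit (f q) :=
  rfl

theorem rename_verum : (verum : LTL (Sig Q Γ × ℤ)).rename f g = verum := rfl

theorem rename_tableRules (κ : StateKind) (q : Q) (a : Γ) (m₁ m₂ : Q × Γ × HeadMove) :
    (tableRules κ q a m₁ m₂).map (LTL.rename f g) =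
      tableRules κ (f q) (g a) (f m₁.1, g m₁.2.1, m₁.2.2) (f m₂.1, g m₂.2.1, m₂.2.2) := by
  obtain ⟨q₁, a₁, _ | _ | _⟩ := m₁ <;> obtain ⟨q₂, a₂, _ | _ | _⟩ := m₂ <;> cases κ <;> rfl

theorem rename_cellInit (j : ℕ) (w : List Γ) : (cellInit j w : LTL (Sig Q Γ × ℤ)).rename f g =
    cellInit j (w.map g) := by
  induction w generalizing j with
  | nil => rfl
  | cons a w ih =>
    simp only [cellInit, List.map_cons, ← ih]
    rfl

end Rename

theorem tokens_map_index {m s : ℕ} (φ : LTL (Sig (Fin m) (Fin s) × ℤ)) :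
    (φ.map (Prod.map Sig.index id)).tokens tokenProp =
      (φ.rename Fin.val Fin.val).tokens (natTokens m) := by
  rw [LTL.rename, LTL.tokens_map, LTL.tokens_map]
  exact LTL.tokens_congr (fun p => tokenProp_index p.1 p.2) φ

namespace Reduction

open StackCmd

/-- The counters that contribute to the number of a proposition. -/
def counters : Sig Counter Counter → List Counter
  | .state c => [c]
  | .sym c => [.states, c]
  | _ => []

/-- Appends the values of several counters to the output. -/
def emitCounters : List Counter → Cmd
  | [] => skip
  | c :: l => seq (emitCounter c) (emitCounters l)

/-- Appends a formula to the output; its states and symbols are the values of counters. -/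
def emit : LTL (Sig Counter Counter × ℤ) → Cmd
  | .atom p => block [emitTokens p.1.lead, emitCounters (counters p.1),
      emitTokens (.pos :: tokenInt p.2)]
  | .neg φ => seq (push (Γ := Alphabet) .out .neg) (emit φ)
  | .or φ ψ => seq (push (Γ := Alphabet) .out .or) (seq (emit φ) (emit ψ))
  | .and φ ψ => seq (push (Γ := Alphabet) .out .and) (seq (emit φ) (emit ψ))
  | .next φ => seq (push (Γ := Alphabet) .out .next) (emit φ)
  | .globally φ => seq (push (Γ := Alphabet) .out .globally) (emit φ)
  | .eventually φ => seq (push (Γ := Alphabet) .out .eventually) (emit φ)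
  | .untl φ ψ => seq (push (Γ := Alphabet) .out .untl) (seq (emit φ) (emit ψ))

/-- Appends a list of formulas, each of them preceded by a conjunction sign. -/
def emitRules : List (LTL (Sig Counter Counter × ℤ)) → Cmd
  | [] => skip
  | φ :: l => seq (push (Γ := Alphabet) .out .and) (seq (emit φ) (emitRules l))

/-- A bound for the running time of `emit`, per unit of the largest counter value. -/
def emitCost : LTL (Sig Counter Counter × ℤ) → ℕ
  | .atom p => 40 + p.2.natAbs
  | .neg φ => emitCost φ + 1
  | .or φ ψ => emitCost φ + emitCost ψ + 1
  | .and φ ψ => emitCost φ + emitCost ψ + 1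
  | .next φ => emitCost φ + 1
  | .globally φ => emitCost φ + 1
  | .eventually φ => emitCost φ + 1
  | .untl φ ψ => emitCost φ + emitCost ψ + 1

/-- A bound for the running time of `emitRules`, per unit of the largest counter value. -/
def rulesCost : List (LTL (Sig Counter Counter × ℤ)) → ℕ
  | [] => 1
  | φ :: l => emitCost φ + rulesCost l + 1

/-- No counter exceeds `N`, and the auxiliary counter is zero. -/
structure Mem.Bounded (S : Mem) (N : ℕ) : Prop where
  tmp : S.tmp = 0
  le : ∀ c, S.get c ≤ N

theorem Mem.Bounded.out {S : Mem} {N : ℕ} (h : S.Bounded N) (o : List FormulaToken) :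
    ({ S with out := o } : Mem).Bounded N :=
  ⟨h.tmp, fun c => by have := h.le c; cases c <;> exact this⟩

namespace Runs

variable {S : Mem} {N : ℕ}

theorem get_out (S : Mem) (o : List FormulaToken) : Mem.get { S with out := o } = S.get := by
  funext c
  cases c <;> rfl

theorem emitCounters (l : List Counter) (h : S.Bounded N) :
    Runs (emitCounters l) S
      { S with out := List.replicate (l.map S.get).sum .one ++ S.out }
      (l.length * (10 * N + 3) + 1) := by
  induction l generalizing S with
  | nil => exact mono (RunsIn.skip (Γ := Alphabet) _) (by simp)
  | cons c l ih =>
    have h1 := emitCounter c h.tmp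
    have h2 := ih (h.out (List.replicate (S.get c) .one ++ S.out))
    rw [get_out, ← List.append_assoc, List.replicate_append_replicate, Nat.add_comm] at h2
    refine mono (B := _ + _) (RunsIn.seq h1 h2) ?_
    have := h.le c
    rw [List.length_cons, Nat.add_mul]
    omega

theorem sum_counters (S : Mem) (σ : Sig Counter Counter) :
    ((counters σ).map S.get).sum = (σ.map S.get S.get).offset S.states := by
  cases σ <;> simp [counters, Sig.map, Sig.offset, Mem.get]

theorem emit (φ : LTL (Sig Counter Counter × ℤ)) (h : S.Bounded N) :
    Runs (emit φ) S
      { S with out := ((φ.rename S.get S.get).tokens (natTokens S.states)).reverse ++ S.out }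
      (emitCost φ * (N + 1)) := by
  have un : ∀ (t : FormulaToken) (φ : LTL (Sig Counter Counter × ℤ)) (S : Mem)
      (o : List FormulaToken),
      Runs (Reduction.emit φ) { S with out := t :: S.out } { S with out := o.reverse ++ t :: S.out }
        (emitCost φ * (N + 1)) →
      Runs (seq (StackCmd.push (Γ := Alphabet) .out t) (Reduction.emit φ)) S
        { S with out := (t :: o).reverse ++ S.out } ((emitCost φ + 1) * (N + 1)) := by
    intro t φ S o h
    rw [List.reverse_cons, List.append_assoc]
    refine mono (B := _ + _) (RunsIn.seq (push_out t S) h) ?_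
    rw [Nat.add_mul]
    omega
  have bin : ∀ (t : FormulaToken) (φ ψ : LTL (Sig Counter Counter × ℤ)) (S : Mem)
      (o o' : List FormulaToken),
      Runs (Reduction.emit φ) { S with out := t :: S.out } { S with out := o.reverse ++ t :: S.out }
        (emitCost φ * (N + 1)) →
      Runs (Reduction.emit ψ) { S with out := o.reverse ++ t :: S.out }
        { S with out := o'.reverse ++ (o.reverse ++ t :: S.out) } (emitCost ψ * (N + 1)) →
      Runs (seq (StackCmd.push (Γ := Alphabet) .out t)
        (seq (Reduction.emit φ) (Reduction.emit ψ))) S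
        { S with out := (t :: (o ++ o')).reverse ++ S.out }
        ((emitCost φ + emitCost ψ + 1) * (N + 1)) := by
    intro t φ ψ S o o' h h'
    rw [List.reverse_cons, List.append_assoc, List.reverse_append, List.append_assoc]
    refine mono (B := _ + (_ + _)) (RunsIn.seq (push_out t S) (RunsIn.seq h h')) ?_
    rw [Nat.add_mul, Nat.add_mul]
    omega
  have step : ∀ φ : LTL (Sig Counter Counter × ℤ), (∀ {S : Mem}, S.Bounded N →
      Runs (Reduction.emit φ) S
        { S with out := ((φ.rename S.get S.get).tokens (natTokens S.states)).reverse ++ S.out }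
        (emitCost φ * (N + 1))) → ∀ {S : Mem}, S.Bounded N → ∀ o,
      Runs (Reduction.emit φ) { S with out := o }
        { S with out := ((φ.rename S.get S.get).tokens (natTokens S.states)).reverse ++ o }
        (emitCost φ * (N + 1)) := by
    intro φ ih S h o
    have := ih (h.out o)
    rwa [get_out] at this
  induction φ generalizing S with
  | atom p =>
    have h1 := emitTokens p.1.lead S
    have h2 := emitCounters (counters p.1) (h.out (p.1.lead.reverse ++ S.out))
    have h3 := emitTokens (.pos :: tokenInt p.2)
      { S with out := List.replicate ((counters p.1).map S.get).sum .one ++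
        (p.1.lead.reverse ++ S.out) }
    rw [get_out] at h2
    have e1 : (LTL.tokens (natTokens S.states) (LTL.rename S.get S.get (.atom p))).reverse ++ S.out =
        (.pos :: tokenInt p.2).reverse ++ (List.replicate ((counters p.1).map S.get).sum .one ++
          (p.1.lead.reverse ++ S.out)) := by
      have e2 : (p.1.map S.get S.get).lead = p.1.lead := by
        rcases p with ⟨_ | _ | _ | _ | _ | (_ | _) | _ | _, _⟩ <;> rfl
      simp only [LTL.rename, LTL.map, LTL.tokens, natTokens, Prod.map_fst, Prod.map_snd, id, e2,
        sum_counters, List.reverse_append, List.append_assoc, List.reverse_replicate]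
    rw [e1]
    refine (cons h1 (cons h2 (cons h3 (.nil _)))).mono ?_
    have l1 : p.1.lead.length ≤ 6 := by
      rcases p with ⟨_ | _ | _ | _ | _ | (_ | _) | _ | _, _⟩ <;> simp [Sig.lead]
    have l2 : (counters p.1).length ≤ 2 := by
      rcases p with ⟨_ | _ | _ | _ | _ | (_ | _) | _ | _, _⟩ <;> simp [counters]
    have l3 : (tokenInt p.2).length = p.2.natAbs + 1 := by simp [tokenInt]
    have l4 := Nat.mul_le_mul_right (10 * N + 3) l2
    have l5 : p.2.natAbs ≤ p.2.natAbs * (N + 1) := Nat.le_mul_of_pos_right _ (by omega)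
    simp only [emitCost, List.length_cons, l3, Nat.add_mul]
    omega
  | neg φ ih | next φ ih | globally φ ih | eventually φ ih => exact un _ _ _ _ (step φ ih h _)
  | or φ ψ ih ih' | and φ ψ ih ih' | untl φ ψ ih ih' =>
    exact bin _ _ _ _ _ _ (step φ ih h _) (step ψ ih' h _)

theorem emitRules (l : List (LTL (Sig Counter Counter × ℤ))) (h : S.Bounded N) :
    Runs (emitRules l) S
      { S with out := ((l.map (LTL.rename S.get S.get)).flatMap
        fun φ => .and :: φ.tokens (natTokens S.states)).reverse ++ S.out }
      (rulesCost l * (N + 1)) := by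
  induction l generalizing S with
  | nil => exact mono (RunsIn.skip (Γ := Alphabet) _) (by simp [rulesCost])
  | cons φ l ih =>
    have h1 := emit φ (h.out (.and :: S.out))
    have h2 := ih (h.out (((φ.rename S.get S.get).tokens (natTokens S.states)).reverse ++
      .and :: S.out))
    rw [get_out] at h1 h2
    have h3 := RunsIn.seq (push_out .and S) (RunsIn.seq h1 h2)
    rw [List.map_cons, List.flatMap_cons, List.reverse_append, List.append_assoc,
      List.reverse_cons, List.append_assoc]
    refine mono (B := _ + (_ + _)) h3 ?_
    simp only [rulesCost, Nat.add_mul]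
    omega

end Runs

end Reduction

/-! ### The program of the reduction -/

section Partial

variable {A : Type} {n : ℕ}

/-- The codes of the elements from index `j` on. -/
def codesFrom (e : Fin n → List A) (j : ℕ) : List A := ((List.ofFn e).drop j).flatten

/-- The codes of the elements before index `j`. -/
def codesBefore (e : Fin n → List A) (j : ℕ) : List A := ((List.ofFn e).take j).flatten

theorem codesFrom_val (e : Fin n → List A) (i : Fin n) :
    codesFrom e i = e i ++ codesFrom e (i + 1) := by
  rw [codesFrom, codesFrom, List.drop_eq_getElem_cons (by simp)]
  simp

theorem codesFrom_self (e : Fin n → List A) : codesFrom e n = [] := by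
  rw [codesFrom, List.drop_of_length_le (by simp), List.flatten_nil]

theorem codesBefore_succ (e : Fin n → List A) (i : Fin n) :
    codesBefore e (i + 1) = codesBefore e i ++ e i := by
  rw [codesBefore, codesBefore, List.take_succ_eq_append_getElem (by simp)]
  simp

theorem codesBefore_self (e : Fin n → List A) : codesBefore e n = (List.ofFn e).flatten := by
  rw [codesBefore, List.take_of_length_le (by simp)]

end Partial

namespace Reduction

open StackCmd

/-- The head motion with the given two-bit code. -/
def decodeMove : Option Bool → Option Bool → HeadMove
  | some true, _ => .right
  | _, some true => .stay
  | _, _ => .left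

/-- The type of states with the given two-bit code. -/
def decodeKind : Option Bool → Option Bool → StateKind
  | some true, some true => .universal
  | some true, _ => .existential
  | _, some true => .rejecting
  | _, _ => .accepting

/-- Reads the code of a head motion and continues with `f` applied to it. -/
def readMove (f : HeadMove → Cmd) : Cmd :=
  pop (Γ := Alphabet) .inp fun b => pop (Γ := Alphabet) .inp fun b' => f (decodeMove b b')

/-- Reads the type of a state and stores it. -/
def readKind : Cmd :=
  pop (Γ := Alphabet) .inp fun b => pop (Γ := Alphabet) .inp fun b' =>
    push (Γ := Alphabet) .ktmp (decodeKind b b')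

/-- Reads an entry of the transition table, for a state of type `κ`, and outputs its rules. -/
def entryCmd (κ : StateKind) : Cmd :=
  block [readUnary .q₁, readUnary .a₁, readMove fun d₁ =>
    block [readUnary .q₂, readUnary .a₂, readMove fun d₂ =>
      block [emitRules (tableRules κ .q .a (.q₁, .a₁, d₁) (.q₂, .a₂, d₂)),
        clear .q₁, clear .a₁, clear .q₂, clear .a₂]]]

/-- Reads a row of the transition table, for a state of type `κ`, and outputs its rules. -/
def rowCmd (κ : StateKind) : Cmd :=
  block [transfer .symbols .a (entryCmd κ), transfer .a .symbols skip]

/-- Reads the transition table and outputs its rules. -/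
def tableCmd : Cmd :=
  transfer .rows .q (pop (Γ := Alphabet) .kinds fun o => rowCmd (o.getD .accepting))

/-- The output for an entry of the transition table. -/
def entryTokens {m s : ℕ} (κ : StateKind) (q a : ℕ)
    (e : (Fin m × Fin s × HeadMove) × (Fin m × Fin s × HeadMove)) : List FormulaToken :=
  (tableRules κ q a ((e.1.1 : ℕ), (e.1.2.1 : ℕ), e.1.2.2)
    ((e.2.1 : ℕ), (e.2.2.1 : ℕ), e.2.2.2)).flatMap
    fun φ => .and :: φ.tokens (natTokens m)

namespace Runs

theorem readMove {f : HeadMove → Cmd} {S S' : Mem} {d : HeadMove} {l : List Bool} {B : ℕ}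
    (h : S.inp = encodeHeadMove d ++ l) (hf : Runs (f d) { S with inp := l } S' B) :
    Runs (readMove f) S S' (B + 2) := by
  cases d <;> exact pop_inp h (pop_inp rfl hf)

theorem readKind {S : Mem} {κ : StateKind} {l : List Bool} (h : S.inp = encodeStateKind κ ++ l) :
    Runs readKind S { S with inp := l, ktmp := κ :: S.ktmp } 3 := by
  cases κ <;> exact pop_inp h (pop_inp rfl (push_ktmp _ _))

theorem entryCmd {m s N : ℕ} (κ : StateKind)
    (e : (Fin m × Fin s × HeadMove) × (Fin m × Fin s × HeadMove)) (l : List Bool)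
    (o : List FormulaToken) (κs : List StateKind) (r sy q a : ℕ) (hm : m ≤ N) (hs : s ≤ N)
    (hr : r ≤ N) (hsy : sy ≤ N) (hq : q ≤ N) (ha : a ≤ N) :
    Runs (entryCmd κ)
      { inp := encodePair encodeMove encodeMove e ++ l, out := o, kinds := κs, rows := r,
        states := m, symbols := sy, q := q, a := a }
      { inp := l, out := (entryTokens κ q a e).reverse ++ o, kinds := κs, rows := r, states := m,
        symbols := sy, q := q, a := a } (4000 * (N + 1)) := by
  obtain ⟨⟨q₁, a₁, d₁⟩, q₂, a₂, d₂⟩ := e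
  simp only [encodePair, encodeMove, encodeFin, List.append_assoc]
  let T (i : List Bool) (o : List FormulaToken) (v₁ w₁ v₂ w₂ : ℕ) : Mem :=
    { inp := i, out := o, kinds := κs, rows := r, states := m, symbols := sy, q := q, a := a,
      q₁ := v₁, a₁ := w₁, q₂ := v₂, a₂ := w₂ }
  have b : (T l o q₁ a₁ q₂ a₂).Bounded N :=
    ⟨rfl, fun c => by cases c <;> simp only [Mem.get, T] <;> omega⟩
  have hc : rulesCost (tableRules κ .q .a (.q₁, .a₁, d₁) (.q₂, .a₂, d₂)) ≤ 3500 := by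
    cases κ <;> cases d₁ <;> cases d₂ <;> decide
  have h5 := (emitRules (tableRules κ .q .a (.q₁, .a₁, d₁) (.q₂, .a₂, d₂)) b).mono
    (Nat.mul_le_mul_right (N + 1) hc)
  rw [rename_tableRules] at h5
  set o' := (entryTokens κ q a ((q₁, a₁, d₁), q₂, a₂, d₂)).reverse ++ o
  have h5' : Runs _ (T l o q₁ a₁ q₂ a₂) (T l o' q₁ a₁ q₂ a₂) (3500 * (N + 1)) := h5
  have c₁ : Runs _ (T l o' q₁ a₁ q₂ a₂) (T l o' 0 a₁ q₂ a₂) (3 * q₁ + 1) := clear .q₁ _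
  have c₂ : Runs _ (T l o' 0 a₁ q₂ a₂) (T l o' 0 0 q₂ a₂) (3 * a₁ + 1) := clear .a₁ _
  have c₃ : Runs _ (T l o' 0 0 q₂ a₂) (T l o' 0 0 0 a₂) (3 * q₂ + 1) := clear .q₂ _
  have c₄ : Runs _ (T l o' 0 0 0 a₂) (T l o' 0 0 0 0) (3 * a₂ + 1) := clear .a₂ _
  have r₁ (i : List Bool) : Runs _ (T (unary q₁ ++ i) o 0 0 0 0) (T i o q₁ 0 0 0) (3 * q₁ + 4) :=
    readUnary .q₁ rfl rfl
  have r₂ (i : List Bool) : Runs _ (T (unary a₁ ++ i) o q₁ 0 0 0) (T i o q₁ a₁ 0 0) (3 * a₁ + 4) :=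
    readUnary .a₁ rfl rfl
  have r₃ (i : List Bool) : Runs _ (T (unary q₂ ++ i) o q₁ a₁ 0 0) (T i o q₁ a₁ q₂ 0)
    (3 * q₂ + 4) := readUnary .q₂ rfl rfl
  have r₄ (i : List Bool) : Runs _ (T (unary a₂ ++ i) o q₁ a₁ q₂ 0) (T i o q₁ a₁ q₂ a₂)
    (3 * a₂ + 4) := readUnary .a₂ rfl rfl
  refine mono (cons (r₁ _) (cons (r₂ _) (cons (readMove rfl (cons (r₃ _) (cons (r₄ _)
    (cons (readMove rfl (cons h5' (cons c₁ (cons c₂ (cons c₃ (cons c₄ (.nil _)))))))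
    (.nil _))))) (.nil _)))) ?_
  omega

end Runs

end Reduction


namespace Reduction

open StackCmd

/-- The output for the transition table. -/
def tableTokens {m s : ℕ} (g : Fin m → StateKind)
    (δ : Fin m → Fin s → (Fin m × Fin s × HeadMove) × (Fin m × Fin s × HeadMove)) :
    List FormulaToken :=
  (List.ofFn fun q => (List.ofFn fun a => entryTokens (g q) q a (δ q a)).flatten).flatten

namespace Runs

theorem rowCmd {m s N : ℕ} (κ : StateKind)
    (e : Fin s → (Fin m × Fin s × HeadMove) × (Fin m × Fin s × HeadMove)) (l : List Bool)
    (o : List FormulaToken) (κs : List StateKind) (r q : ℕ) (hm : m ≤ N) (hs : s ≤ N)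
    (hr : r ≤ N) (hq : q ≤ N) :
    Runs (rowCmd κ)
      { inp := encodeFn (encodePair encodeMove encodeMove) e ++ l, out := o, kinds := κs, rows := r,
        states := m, symbols := s, q := q }
      { inp := l, out := (List.ofFn fun a => entryTokens κ q a (e a)).flatten.reverse ++ o,
        kinds := κs, rows := r, states := m, symbols := s, q := q }
      (5000 * (N + 1) * (N + 1)) := by
  set E : Fin s → List Bool := fun a => encodePair encodeMove encodeMove (e a)
  set O : Fin s → List FormulaToken := fun a => entryTokens κ q a (e a)
  have h1 := transfer (c := .symbols) (d := .a) (by decide) (body := Reduction.entryCmd κ)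
    (fun j => { inp := codesFrom E j ++ l, out := (codesBefore O j).reverse ++ o,
                kinds := κs, rows := r, states := m, q := q }) s (4000 * (N + 1)) fun j hj => by
      have hE : codesFrom E j ++ l =
          encodePair encodeMove encodeMove (e ⟨j, hj⟩) ++ (codesFrom E (j + 1) ++ l) := by
        rw [← List.append_assoc]
        exact congrArg (· ++ l) (codesFrom_val E ⟨j, hj⟩)
      have hO : (codesBefore O (j + 1)).reverse ++ o =
          (entryTokens κ q j (e ⟨j, hj⟩)).reverse ++ ((codesBefore O j).reverse ++ o) := by
        rw [← List.append_assoc, ← List.reverse_append]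
        exact congrArg (fun t => t.reverse ++ o) (codesBefore_succ O ⟨j, hj⟩)
      simp only [hE, hO]
      exact entryCmd κ (e ⟨j, hj⟩) _ _ κs r (s - 1 - j) q j hm hs hr (by omega) hq (by omega)
  have h2 := transfer (c := .a) (d := .symbols) (by decide) (body := skip)
    (fun _ => { inp := l, out := (List.ofFn O).flatten.reverse ++ o,
                kinds := κs, rows := r, states := m, q := q }) s 1 fun j _ => RunsIn.skip _
  simp only [codesBefore_self, codesFrom_self] at h1
  refine mono (cons h1 (cons h2 (.nil _))) ?_
  have h3 : s * (4000 * (N + 1) + 4) ≤ N * (4000 * (N + 1) + 4) := Nat.mul_le_mul_right _ hs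
  nlinarith

theorem tableCmd {m s N : ℕ} (g : Fin m → StateKind)
    (δ : Fin m → Fin s → (Fin m × Fin s × HeadMove) × (Fin m × Fin s × HeadMove)) (l : List Bool)
    (o : List FormulaToken) (hm : m ≤ N) (hs : s ≤ N) :
    Runs tableCmd
      { inp := encodeTable δ ++ l, out := o, kinds := List.ofFn g, rows := m, states := m,
        symbols := s }
      { inp := l, out := (tableTokens g δ).reverse ++ o, states := m, symbols := s, q := m }
      (6000 * (N + 1) * (N + 1) * (N + 1)) := by
  set E : Fin m → List Bool := fun q => encodeFn (encodePair encodeMove encodeMove) (δ q)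
  set O : Fin m → List FormulaToken := fun q =>
    (List.ofFn fun a => entryTokens (g q) q a (δ q a)).flatten
  set G : Fin m → List StateKind := fun q => [g q]
  have h1 := transfer (c := .rows) (d := .q) (by decide)
    (body := pop (Γ := Alphabet) .kinds fun o => Reduction.rowCmd (o.getD .accepting))
    (fun j => { inp := codesFrom E j ++ l, out := (codesBefore O j).reverse ++ o,
                kinds := codesFrom G j, states := m, symbols := s }) m
    (5000 * (N + 1) * (N + 1) + 1) fun j hj => by
      have hE : codesFrom E j ++ l =
          encodeFn (encodePair encodeMove encodeMove) (δ ⟨j, hj⟩) ++ (codesFrom E (j + 1) ++ l) := by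
        rw [← List.append_assoc]
        exact congrArg (· ++ l) (codesFrom_val E ⟨j, hj⟩)
      have hO : (codesBefore O (j + 1)).reverse ++ o =
          (O ⟨j, hj⟩).reverse ++ ((codesBefore O j).reverse ++ o) := by
        rw [← List.append_assoc, ← List.reverse_append]
        exact congrArg (fun t => t.reverse ++ o) (codesBefore_succ O ⟨j, hj⟩)
      have hG : codesFrom G j = g ⟨j, hj⟩ :: codesFrom G (j + 1) := codesFrom_val G ⟨j, hj⟩
      simp only [hE, hO, hG]
      exact pop_kinds rfl
        (rowCmd (g ⟨j, hj⟩) (δ ⟨j, hj⟩) _ _ _ (m - 1 - j) j hm hs (by omega) (by omega))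
  have hG : codesFrom G 0 = List.ofFn g := by
    have : List.ofFn G = (List.ofFn g).map fun k => [k] := by rw [List.map_ofFn]; rfl
    rw [codesFrom, List.drop_zero, this, ← List.flatMap_def, List.flatMap_singleton']
  simp only [codesBefore_self, codesFrom_self, hG] at h1
  refine mono h1 ?_
  have h3 : m * (5000 * (N + 1) * (N + 1) + 1 + 4) ≤ N * (5000 * (N + 1) * (N + 1) + 1 + 4) :=
    Nat.mul_le_mul_right _ hm
  nlinarith [Nat.zero_le (N * N * N), Nat.zero_le (N * N)]

end Runs

/-- Outputs the proposition `start` with the index given by a counter. -/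
def emitStart (c : Counter) : Cmd :=
  block [emitTokens [.inp, .pos], emitCounter c, emitTokens [.pos]]

/-- What is required of a cell that holds the symbol `a` initially. -/
def cellFilled {Q Γ : Type} (a : Γ) : LTL (Sig Q Γ × ℤ) :=
  .and (.next (.and (sAt .used 0) (sAt (.sym a) 0))) (.or (sAt .start 0) (.next (sAt .edge (-1))))

/-- Reads the word and outputs the description of the initial tape. -/
def wordCmd : Cmd :=
  loop (Γ := Alphabet) .inp Option.isSome (block [readUnary .a₁, emitTokens [.or, .and],
    emitStart .a, emit (cellFilled .a₁), emitTokens [.and, .neg], emitStart .a, clear .a₁,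
    push (Γ := Alphabet) (.cnt .a) ()])

/-- The tokens of the proposition `start` with index `j`. -/
def startTokens (j : ℕ) : List FormulaToken := [.inp, .pos] ++ (List.replicate j .one ++ [.pos])

/-- The output for the word, of which `j` characters have been read before. -/
def wordTokens (m : ℕ) : ℕ → List ℕ → List FormulaToken
  | _, [] => []
  | j, a :: w => [.or, .and] ++ (startTokens j ++ ((cellFilled a).tokens (natTokens m) ++
      ([.and, .neg] ++ (startTokens j ++ wordTokens m (j + 1) w))))

theorem tokens_cellInit (m j : ℕ) (w : List ℕ) : (cellInit j w).tokens (natTokens m) =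
    wordTokens m j w ++ (LTL.next (.neg (sAt .used 0))).tokens (natTokens m) := by
  have hs : ∀ j : ℕ, natTokens m (.start, (j : ℤ)) = startTokens j := fun j => by
    simp [natTokens, startTokens, tokenInt, Sig.lead, Sig.offset]
  induction w generalizing j with
  | nil => rfl
  | cons a w ih =>
    simp only [cellInit, wordTokens, LTL.tokens, ih, sAt, hs, cellFilled]
    simp

namespace Runs

theorem emitStart (c : Counter) {S : Mem} (h : S.tmp = 0) :
    Runs (emitStart c) S { S with out := (startTokens (S.get c)).reverse ++ S.out }
      (10 * S.get c + 9) := by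
  have h2 := emitCounter c (S := { S with out := [FormulaToken.inp, .pos].reverse ++ S.out }) h
  rw [get_out] at h2
  have h3 := (cons (emitTokens [.inp, .pos] S) (cons h2 (cons (emitTokens [.pos] _) (.nil _))))
  rw [startTokens, List.reverse_append, List.reverse_append, List.reverse_replicate,
    List.append_assoc, List.append_assoc]
  refine mono h3 ?_
  simp only [List.length_cons, List.length_nil]
  omega

theorem wordCmd {s N : ℕ} (m j : ℕ) (w : List (Fin s)) (o : List FormulaToken) (q : ℕ) (hm : m ≤ N)
    (hs : s ≤ N) (hj : j + w.length ≤ N) (hq : q ≤ N) :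
    Runs wordCmd
      { inp := (w.map encodeFin).flatten, out := o, states := m, symbols := s, q := q, a := j }
      { out := (wordTokens m j (w.map Fin.val)).reverse ++ o, states := m, symbols := s, q := q,
        a := j + w.length } (w.length * (1000 * (N + 1)) + 1) := by
  induction w generalizing j o with
  | nil => exact (RunsIn.loop_done rfl : Runs _ _ _ 1).mono (by omega)
  | cons c w ih =>
    rw [List.length_cons] at hj
    have hc := c.isLt
    let T (i : List Bool) (o : List FormulaToken) (v j : ℕ) : Mem :=
      { inp := i, out := o, states := m, symbols := s, q := q, a := j, a₁ := v }
    set i := (w.map encodeFin).flatten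
    set o₂ := [FormulaToken.or, .and].reverse ++ o
    set o₃ := (startTokens j).reverse ++ o₂
    set o₄ := ((cellFilled (c : ℕ)).tokens (natTokens m)).reverse ++ o₃
    set o₅ := [FormulaToken.and, .neg].reverse ++ o₄
    set o₆ := (startTokens j).reverse ++ o₅
    have b : (T i o₃ c j).Bounded N :=
      ⟨rfl, fun c' => by cases c' <;> simp only [Mem.get, T] <;> omega⟩
    have hk : emitCost (cellFilled (Q := Counter) Counter.a₁) ≤ 250 := by decide
    have h1 : Runs _ (T (unary c ++ i) o 0 j) (T i o c j) (3 * c + 4) := readUnary .a₁ rfl rfl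
    have h2 : Runs _ (T i o c j) (T i o₂ c j) 3 := emitTokens [.or, .and] _
    have h3 : Runs _ (T i o₂ c j) (T i o₃ c j) (10 * j + 9) := emitStart .a rfl
    have h4 : Runs _ (T i o₃ c j) (T i o₄ c j) (250 * (N + 1)) :=
      (emit (cellFilled .a₁) b).mono (Nat.mul_le_mul_right _ hk)
    have h5 : Runs _ (T i o₄ c j) (T i o₅ c j) 3 := emitTokens [.and, .neg] _
    have h6 : Runs _ (T i o₅ c j) (T i o₆ c j) (10 * j + 9) := emitStart .a rfl
    have h7 : Runs _ (T i o₆ c j) (T i o₆ 0 j) (3 * c + 1) := clear .a₁ _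
    have h8 : Runs _ (T i o₆ 0 j) (T i o₆ 0 (j + 1)) 1 := push_cnt .a _
    have h9 := ih (j + 1) o₆ (by omega)
    have e1 : (wordTokens m j ((c :: w).map Fin.val)).reverse ++ o =
        (wordTokens m (j + 1) (w.map Fin.val)).reverse ++ o₆ := by
      simp only [List.map_cons, wordTokens, List.reverse_append, List.append_assoc, o₆, o₅, o₄, o₃,
        o₂]
    have e2 : j + (c :: w).length = j + 1 + w.length := by simp only [List.length_cons]; omega
    rw [e1, e2]
    refine mono (B := _ + _ + 1) (RunsIn.loop_step ?_ (cons h1 (cons h2 (cons h3 (cons h4 (cons h5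
      (cons h6 (cons h7 (cons h8 (.nil _))))))))) h9) ?_
    · change (unary c ++ i).head?.isSome = true
      generalize (c : ℕ) = v
      cases v <;> rfl
    · rw [List.length_cons, Nat.add_mul]
      omega

end Runs

end Reduction

/-! ### Polynomial-time computability of the reduction -/

theorem StackCmd.Exec.length_le {K : Type} {Γ : K → Type} [DecidableEq K] {c : StackCmd Γ}
    {S S' : ∀ k, List (Γ k)} {t : ℕ} (h : Exec c S S' t) (k : K) :
    (S' k).length ≤ (S k).length + t := by
  induction h with
  | skip S => omega
  | push k' a S =>
    by_cases hk : k = k'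
    · subst hk
      simp
    · rw [Function.update_of_ne hk]
      omega
  | seq h₁ h₂ ih₁ ih₂ => omega
  | @pop k' f S S' t h ih =>
    by_cases hk : k = k'
    · subst hk
      rw [Function.update_self, List.length_tail] at ih
      omega
    · rw [Function.update_of_ne hk] at ih
      omega
  | loop_done h => omega
  | loop_step h h₁ h₂ ih₁ ih₂ => omega

namespace Reduction

open StackCmd

/-- Reads the numbers at the beginning of the input and outputs everything that precedes the rules
for the transition table. -/
def headerCmd : Cmd :=
  block [readUnary .states, readUnary .symbols,
    emitTokens [.one, .one, .pos, .one, .one, .one, .one, .one], emitCounter .states,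
    emitCounter .symbols, emitTokens [.pos, .and],
    readUnary .q₁, emit (headInit .q₁), clear .q₁, emitTokens [.and, .next, .globally],
    emitRules frameRules, readUnary .a₁, emitRules [blankRule .a₁], clear .a₁]

/-- Skips the input alphabet and reads the types of the states. -/
def kindsCmd : Cmd :=
  block [transfer .symbols .tmp (pop (Γ := Alphabet) .inp fun _ => skip),
    transfer .tmp .symbols skip,
    transfer .states .tmp (block [readKind, push (Γ := Alphabet) (.cnt .rows) ()]),
    transfer .tmp .states skip, pour (Γ := Alphabet) .ktmp .kinds fun t => t]

/-- Writes the code of the specification in reverse, and leaves all other stacks empty. -/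
def mainCmd : Cmd :=
  block [headerCmd, kindsCmd, tableCmd, emit verum, wordCmd, emit (.next (.neg (sAt .used 0))),
    clear .states, clear .symbols, clear .q, clear .a]

/-- The program that computes the reduction. -/
def program : Cmd := seq mainCmd (pour (Γ := Alphabet) .out .rev fun t => t)

/-- The output for a list of rules. -/
def rulesTokens (m : ℕ) (l : List (LTL (Sig ℕ ℕ × ℤ))) : List FormulaToken :=
  l.flatMap fun φ => .and :: φ.tokens (natTokens m)

/-- The output that precedes the rules for the transition table: the numbers of propositions, the
rule for the initial heads, and the rules that do not depend on the transition function. -/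
def headerTokens (m s q₀ b : ℕ) : List FormulaToken :=
  [.one, .one, .pos, .one, .one, .one, .one, .one] ++ (List.replicate m .one ++
    (List.replicate s .one ++ ([.pos, .and] ++ ((headInit q₀).tokens (natTokens m) ++
      ([.and, .next, .globally] ++ (rulesTokens m frameRules ++ rulesTokens m [blankRule b]))))))

namespace Runs

theorem headerCmd {m s q₀ b N : ℕ} (l : List Bool) (hm : m ≤ N) (hs : s ≤ N) (hq : q₀ ≤ N)
    (hb : b ≤ N) :
    Runs headerCmd { inp := unary m ++ (unary s ++ (unary q₀ ++ (unary b ++ l))) }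
      { inp := l, out := (headerTokens m s q₀ b).reverse, states := m, symbols := s }
      (4000 * (N + 1)) := by
  let T (i : List Bool) (o : List FormulaToken) (m s v w : ℕ) : Mem :=
    { inp := i, out := o, states := m, symbols := s, q₁ := v, a₁ := w }
  set o₁ := [FormulaToken.one, .one, .pos, .one, .one, .one, .one, .one].reverse ++ []
  set o₂ := List.replicate m FormulaToken.one ++ o₁
  set o₃ := List.replicate s FormulaToken.one ++ o₂
  set o₄ := [FormulaToken.pos, .and].reverse ++ o₃
  set o₅ := ((headInit q₀).tokens (natTokens m)).reverse ++ o₄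
  set o₆ := [FormulaToken.and, .next, .globally].reverse ++ o₅
  set o₇ := (rulesTokens m frameRules).reverse ++ o₆
  set o₈ := (rulesTokens m [blankRule b]).reverse ++ o₇
  have e : (headerTokens m s q₀ b).reverse = o₈ := by
    simp only [headerTokens, List.reverse_append, List.append_assoc, List.reverse_replicate, o₈, o₇,
      o₆, o₅, o₄, o₃, o₂, o₁, List.append_nil]
  have bd : ∀ i o v w, v ≤ N → w ≤ N → (T i o m s v w).Bounded N := fun i o v w hv hw =>
    ⟨rfl, fun c => by cases c <;> simp only [Mem.get, T] <;> omega⟩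
  rw [e]
  have h1 (i) : Runs _ (T (unary m ++ i) [] 0 0 0 0) (T i [] m 0 0 0) (3 * m + 4) :=
    readUnary .states rfl rfl
  have h2 (i) : Runs _ (T (unary s ++ i) [] m 0 0 0) (T i [] m s 0 0) (3 * s + 4) :=
    readUnary .symbols rfl rfl
  have h3 (i) : Runs _ (T i [] m s 0 0) (T i o₁ m s 0 0) 9 := emitTokens _ _
  have h4 (i) : Runs _ (T i o₁ m s 0 0) (T i o₂ m s 0 0) (10 * m + 3) := emitCounter .states rfl
  have h5 (i) : Runs _ (T i o₂ m s 0 0) (T i o₃ m s 0 0) (10 * s + 3) := emitCounter .symbols rfl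
  have h6 (i) : Runs _ (T i o₃ m s 0 0) (T i o₄ m s 0 0) 3 := emitTokens [.pos, .and] _
  have h7 (i) : Runs _ (T (unary q₀ ++ i) o₄ m s 0 0) (T i o₄ m s q₀ 0) (3 * q₀ + 4) :=
    readUnary .q₁ rfl rfl
  have h8 (i) : Runs _ (T i o₄ m s q₀ 0) (T i o₅ m s q₀ 0) (500 * (N + 1)) :=
    (emit (headInit .q₁) (bd _ _ _ _ hq (Nat.zero_le _))).mono
      (Nat.mul_le_mul_right _ (by decide))
  have h9 (i) : Runs _ (T i o₅ m s q₀ 0) (T i o₅ m s 0 0) (3 * q₀ + 1) := clear .q₁ _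
  have h10 (i) : Runs _ (T i o₅ m s 0 0) (T i o₆ m s 0 0) 4 :=
    emitTokens [.and, .next, .globally] _
  have h11 (i) : Runs (Reduction.emitRules frameRules) (T i o₆ m s 0 0) (T i o₇ m s 0 0)
      (2500 * (N + 1)) := by
    have := (emitRules frameRules (bd i o₆ 0 0 (Nat.zero_le _) (Nat.zero_le _))).mono
      (Nat.mul_le_mul_right (N + 1) (by decide : rulesCost frameRules ≤ 2500))
    rwa [rename_frameRules] at this
  have h12 (i) : Runs _ (T (unary b ++ i) o₇ m s 0 0) (T i o₇ m s 0 b) (3 * b + 4) :=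
    readUnary .a₁ rfl rfl
  have h13 (i) : Runs _ (T i o₇ m s 0 b) (T i o₈ m s 0 b) (500 * (N + 1)) :=
    (emitRules [blankRule .a₁] (bd _ _ _ _ (Nat.zero_le _) hb)).mono
      (Nat.mul_le_mul_right _ (by decide))
  have h14 (i) : Runs _ (T i o₈ m s 0 b) (T i o₈ m s 0 0) (3 * b + 1) := clear .a₁ _
  refine mono (cons (h1 _) (cons (h2 _) (cons (h3 _) (cons (h4 _) (cons (h5 _) (cons (h6 _)
    (cons (h7 _) (cons (h8 _) (cons (h9 _) (cons (h10 _) (cons (h11 _) (cons (h12 _)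
      (cons (h13 _) (cons (h14 _) (.nil _))))))))))))))) ?_
  omega

theorem kindsCmd {m s N : ℕ} (v : Fin s → Bool) (g : Fin m → StateKind) (l : List Bool)
    (o : List FormulaToken) (hm : m ≤ N) (hs : s ≤ N) :
    Runs kindsCmd
      { inp := encodeFn encodeBit v ++ (encodeFn encodeStateKind g ++ l), out := o, states := m,
        symbols := s }
      { inp := l, out := o, kinds := List.ofFn g, rows := m, states := m, symbols := s }
      (50 * (N + 1)) := by
  set E : Fin s → List Bool := fun a => encodeBit (v a)
  set F : Fin m → List Bool := fun q => encodeStateKind (g q)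
  set G : Fin m → List StateKind := fun q => [g q]
  set i := encodeFn encodeStateKind g ++ l
  have h1 := transfer (c := .symbols) (d := .tmp) (by decide)
    (body := pop (Γ := Alphabet) .inp fun _ => skip)
    (fun j => { inp := codesFrom E j ++ i, out := o, states := m }) s 2 fun j hj => by
      have hE : codesFrom E j = v ⟨j, hj⟩ :: codesFrom E (j + 1) := codesFrom_val E ⟨j, hj⟩
      simp only [hE]
      exact pop_inp rfl (RunsIn.skip _)
  have h2 := transfer (c := .tmp) (d := .symbols) (by decide) (body := skip)
    (fun _ => { inp := i, out := o, states := m }) s 1 fun j _ => RunsIn.skip _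
  have h3 := transfer (c := .states) (d := .tmp) (by decide)
    (body := block [Reduction.readKind, push (Γ := Alphabet) (.cnt .rows) ()])
    (fun j => { inp := codesFrom F j ++ l, out := o, ktmp := (codesBefore G j).reverse, rows := j,
                symbols := s }) m 5 fun j hj => by
      have hF : codesFrom F j ++ l = encodeStateKind (g ⟨j, hj⟩) ++ (codesFrom F (j + 1) ++ l) := by
        rw [← List.append_assoc]
        exact congrArg (· ++ l) (codesFrom_val F ⟨j, hj⟩)
      have hG : codesBefore G (j + 1) = codesBefore G j ++ [g ⟨j, hj⟩] :=
        codesBefore_succ G ⟨j, hj⟩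
      simp only [hF, hG, List.reverse_append]
      exact cons (readKind rfl) (cons (push_cnt .rows _) (.nil _))
  have h4 := transfer (c := .tmp) (d := .states) (by decide) (body := skip)
    (fun _ => { inp := l, out := o, ktmp := (List.ofFn g).reverse, rows := m, symbols := s }) m 1
    fun j _ => RunsIn.skip _
  have h5 := pour_kinds { inp := l, out := o, ktmp := (List.ofFn g).reverse, rows := m, states := m,
                          symbols := s }
  have hG : (List.ofFn G).flatten = List.ofFn g := by
    have : List.ofFn G = (List.ofFn g).map fun k => [k] := by rw [List.map_ofFn]; rfl
    rw [this, ← List.flatMap_def, List.flatMap_singleton']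
  simp only [codesFrom_self] at h1
  simp only [codesBefore_self, codesFrom_self, hG] at h3
  simp only [List.reverse_reverse, List.append_nil, List.length_reverse, List.length_ofFn] at h5
  refine mono (cons h1 (cons h2 (cons h3 (cons h4 (cons h5 (.nil _)))))) ?_
  omega

end Runs

/-- The code of the specification, in the order of its generation. -/
def specTokens (x : AcceptanceInstance) : List FormulaToken :=
  headerTokens x.numStates x.numSymbols x.machine.q₀ x.machine.blank ++
    (tableTokens x.machine.g x.machine.δ ++ (verum.tokens (natTokens x.numStates) ++
      (wordTokens x.numStates 0 (x.word.map Fin.val) ++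
        (LTL.next (.neg (sAt .used 0))).tokens (natTokens x.numStates))))

/-- The machine tables determine the code from left to right, so that it can be written while they
are read. -/
theorem encode_reductionSpec (x : AcceptanceInstance) :
    (reductionSpec x).encode = specTokens x := by
  have h1 : (x.formula.rename Fin.val Fin.val : LTL (Sig ℕ ℕ × ℤ)) =
      .and (headInit (x.machine.q₀ : ℕ)) (.and (.next (.globally (.bigAnd verum
        (x.rules.map (LTL.rename Fin.val Fin.val))))) (cellInit 0 (x.word.map Fin.val))) := by
    rw [← rename_cellInit, ← rename_headInit (g := (Fin.val : Fin x.numSymbols → ℕ)),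
      ← rename_verum (f := (Fin.val : Fin x.numStates → ℕ))
        (g := (Fin.val : Fin x.numSymbols → ℕ))]
    simp only [LTL.rename, AcceptanceInstance.formula, LTL.map, LTL.map_bigAnd]
    rfl
  have h2 : rulesTokens x.numStates (x.rules.map (LTL.rename Fin.val Fin.val)) =
      rulesTokens x.numStates frameRules ++ (rulesTokens x.numStates [blankRule x.machine.blank] ++
        tableTokens x.machine.g x.machine.δ) := by
    simp only [AcceptanceInstance.rules, List.map_append, List.map_cons, List.map_flatMap,
      rename_tableRules, rename_frameRules, rename_blankRule, rulesTokens, List.flatMap_append,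
      List.flatMap_cons, List.flatMap_assoc, tableTokens, entryTokens, List.ofFn_eq_map,
      ← List.flatMap_def, List.flatMap_nil, List.append_nil]
  have h3 : tokenNat (5 + x.numStates + x.numSymbols) =
      [.one, .one, .one, .one, .one] ++ (List.replicate x.numStates .one ++
        (List.replicate x.numSymbols .one ++ [.pos])) := by
    rw [tokenNat, List.replicate_add, List.replicate_add, List.append_assoc, List.append_assoc]
    rfl
  simp only [RotationSpec.encode, reductionSpec, tokens_map_index, h1, LTL.tokens,
    LTL.tokens_bigAnd, tokens_cellInit]
  rw [← rulesTokens, h2, h3]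
  simp [specTokens, headerTokens, tokenNat, List.replicate_succ, LTL.tokens]

theorem length_le_length_flatten_unary {s : ℕ} (w : List (Fin s)) :
    w.length ≤ (w.map encodeFin).flatten.length := by
  induction w with
  | nil => simp
  | cons a w ih => simp [encodeFin, unary] at ih ⊢; omega

theorem Runs.mainCmd (x : AcceptanceInstance) :
    Runs mainCmd { inp := x.encode } { out := (specTokens x).reverse }
      (12000 * (x.encode.length + 1) ^ 3) := by
  set N := x.encode.length with hN
  have hlen := length_le_length_flatten_unary x.word
  simp only [AcceptanceInstance.encode, unary, encodeFin, List.length_append, List.length_replicate,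
    List.length_singleton] at hN
  have hm : x.numStates ≤ N := by omega
  have hs : x.numSymbols ≤ N := by omega
  have hw : 0 + x.word.length ≤ N := by omega
  have hq : (x.machine.q₀ : ℕ) ≤ N := x.machine.q₀.isLt.le.trans hm
  have hb : (x.machine.blank : ℕ) ≤ N := x.machine.blank.isLt.le.trans hs
  set m := x.numStates
  set s := x.numSymbols
  let T (i : List Bool) (o : List FormulaToken) (m s q a : ℕ) : Mem :=
    { inp := i, out := o, states := m, symbols := s, q := q, a := a }
  have bd : ∀ i o q a, q ≤ N → a ≤ N → (T i o m s q a).Bounded N := fun i o q a hq ha =>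
    ⟨rfl, fun c => by cases c <;> simp only [Mem.get, T] <;> omega⟩
  set w := (x.word.map encodeFin).flatten
  set k := x.word.length
  set o₁ := (headerTokens m s x.machine.q₀ x.machine.blank).reverse
  set o₂ := (tableTokens x.machine.g x.machine.δ).reverse ++ o₁
  set o₃ := (verum.tokens (natTokens m)).reverse ++ o₂
  set o₄ := (wordTokens m 0 (x.word.map Fin.val)).reverse ++ o₃
  set o₅ := ((LTL.next (.neg (sAt .used 0))).tokens (natTokens m)).reverse ++ o₄
  have e : (specTokens x).reverse = o₅ := by
    simp only [specTokens, List.reverse_append, List.append_assoc, o₅, o₄, o₃, o₂, o₁, m, s]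
  rw [e]
  have h1 := Runs.headerCmd (encodeFn encodeBit (fun a => decide (a ∈ x.machine.inputAlphabet)) ++
    (encodeFn encodeStateKind x.machine.g ++ (encodeTable x.machine.δ ++ w))) hm hs hq hb
  have h2 := Runs.kindsCmd (fun a => decide (a ∈ x.machine.inputAlphabet)) x.machine.g
    (encodeTable x.machine.δ ++ w) o₁ hm hs
  have h3 := Runs.tableCmd x.machine.g x.machine.δ w o₁ hm hs
  have h4 : Runs _ (T w o₂ m s m 0) (T w o₃ m s m 0) (200 * (N + 1)) :=
    (emit verum (bd _ _ _ _ hm (Nat.zero_le _))).mono (Nat.mul_le_mul_right _ (by decide))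
  have h5 := Runs.wordCmd m 0 x.word o₃ m hm hs hw hm
  have h6 : Runs _ (T [] o₄ m s m (0 + k)) (T [] o₅ m s m (0 + k)) (200 * (N + 1)) :=
    (emit (.next (.neg (sAt .used 0))) (bd _ _ _ _ hm hw)).mono
      (Nat.mul_le_mul_right _ (by decide))
  have h7 : Runs _ (T [] o₅ m s m (0 + k)) (T [] o₅ 0 s m (0 + k)) (3 * m + 1) := clear .states _
  have h8 : Runs _ (T [] o₅ 0 s m (0 + k)) (T [] o₅ 0 0 m (0 + k)) (3 * s + 1) := clear .symbols _
  have h9 : Runs _ (T [] o₅ 0 0 m (0 + k)) (T [] o₅ 0 0 0 (0 + k)) (3 * m + 1) := clear .q _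
  have h10 : Runs _ (T [] o₅ 0 0 0 (0 + k)) (T [] o₅ 0 0 0 0) (3 * (0 + k) + 1) := clear .a _
  refine mono (cons h1 (cons h2 (cons h3 (cons h4 (cons h5 (cons h6 (cons h7 (cons h8 (cons h9
    (cons h10 (.nil _))))))))))) ?_
  have h11 : x.word.length * (1000 * (N + 1)) ≤ N * (1000 * (N + 1)) :=
    Nat.mul_le_mul_right _ (by omega)
  have h12 : N * (1000 * (N + 1)) = 1000 * (N * N) + 1000 * N := by ring
  have h13 : 6000 * (N + 1) * (N + 1) * (N + 1) =
      6000 * (N * N * N) + 18000 * (N * N) + 18000 * N + 6000 := by ring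
  have h14 : 12000 * (N + 1) ^ 3 =
      12000 * (N * N * N) + 36000 * (N * N) + 36000 * N + 12000 := by ring
  have h15 : 0 ≤ N * N * N := Nat.zero_le _
  omega

theorem runsIn_program (x : AcceptanceInstance) :
    RunsIn program (single .inp x.encode) (single .rev (reductionSpec x).encode)
      (50000 * (x.encode.length + 1) ^ 3) := by
  have h1 := Runs.mainCmd x
  have h2 := Runs.pour_rev { out := (specTokens x).reverse }
  have hlen : (specTokens x).length ≤ 12000 * (x.encode.length + 1) ^ 3 := by
    obtain ⟨t, ht, hx⟩ := h1
    have : (specTokens x).reverse.length ≤ 0 + t := hx.length_le .out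
    rw [List.length_reverse] at this
    omega
  simp only [List.reverse_reverse, List.append_nil, List.length_reverse] at h2
  have e1 : single .inp x.encode = Mem.contents { inp := x.encode } := by
    funext k
    by_cases hk : k = .inp
    · subst hk
      exact single_self _ _
    · refine (single_of_ne hk _).trans ?_
      cases k
      case inp => exact absurd rfl hk
      case cnt c => cases c <;> rfl
      all_goals rfl
  have e2 : single .rev (reductionSpec x).encode = Mem.contents { rev := specTokens x } := by
    rw [encode_reductionSpec]
    funext k
    by_cases hk : k = .rev
    · subst hk
      exact single_self _ _
    · refine (single_of_ne hk _).trans ?_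
      cases k
      case rev => exact absurd rfl hk
      case cnt c => cases c <;> rfl
      all_goals rfl
  have h3 : RunsIn program _ _ _ := RunsIn.seq h1 h2
  rw [← e1, ← e2] at h3
  refine h3.mono ?_
  have : 1 ≤ (x.encode.length + 1) ^ 3 := Nat.one_le_pow _ _ (by omega)
  omega

end Reduction

theorem tm2ComputableInPolyTime_reductionSpec :
    Nonempty (Turing.TM2ComputableInPolyTime AcceptanceInstance.encode RotationSpec.encode
      reductionSpec) :=
  StackCmd.tm2ComputableInPolyTime (Γ := Reduction.Alphabet) Reduction.program .inp .rev
    AcceptanceInstance.encode RotationSpec.encode reductionSpec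
    (Polynomial.C 50000 * (Polynomial.X + 1) ^ 3) fun x => by
      have e : (Polynomial.C 50000 * (Polynomial.X + 1) ^ 3 : Polynomial ℕ).eval x.encode.length =
          50000 * (x.encode.length + 1) ^ 3 := by simp
      obtain ⟨t, ht, hx⟩ := Reduction.runsIn_program x
      exact ⟨t, ht.trans e.ge, hx⟩

/-- There is one polynomial-time reduction that maps an alternating Turing machine `M` and a word
`w` to an LTL specification such that, whenever `M` is `f(k)`-space bounded, the specification is
symmetrically realizable with `n = f(|w|)` processes iff `M` does not accept `w`; and the size of
the specification is polynomial in `|Q| · |Γ| · |w|`. -/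
theorem mainTheorem4 :
    ∃ (reduction : AcceptanceInstance → RotationSpec) (p : Polynomial ℕ),
      Nonempty (Turing.TM2ComputableInPolyTime AcceptanceInstance.encode RotationSpec.encode
        reduction) ∧
      ∀ (x : AcceptanceInstance) (f : ℕ → ℕ) (n : ℕ) [NeZero n],
        x.word ≠ [] →
        x.machine.IsSpaceBounded f →
        n = f x.word.length →
        ((reduction x).ltl n).size ≤
            p.eval (x.numStates * x.numSymbols * x.word.length) ∧
          ((reduction x).Realizable n ↔ ¬ x.machine.Accepts x.word) := by
  refine ⟨reductionSpec, Polynomial.C 1000 * Polynomial.X, tm2ComputableInPolyTime_reductionSpec,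
    fun x f n _ hw hf hn => ⟨?_, realizable_iff_not_accepts x f n hw hf hn⟩⟩
  rw [Polynomial.eval_mul, Polynomial.eval_C, Polynomial.eval_X]
  exact ((LTL.size_map _ _).trans (LTL.size_map _ _)).trans_le (size_formula x hw)
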